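/- Let $f,g$ be Möbius transformations, i.e. elements of $PSL(2,\mathbb C)$. If $A,B\in SL(2,\mathbb C)$ represent $f,g$, put $\beta(f)=\operatorname{tr}^2(A)-4$ and $\gamma(f,g)=\operatorname{tr}(ABA^{-1}B^{-1})-2$; these do not depend on the choice of representatives. A good word on the letters $a,b$ is a word $w(a,b)=b^{s_1}a^{r_1}b^{s_2}a^{r_2}\cdots b^{s_{m-1}}a^{r_{m-1}}b^{s_m}$ with $m\ge 1$, $s_1=\pm1$, $s_j=(-1)^{j+1}s_1$ and $r_j\in\mathbb Z$ (zero exponents $r_j$ are allowed). For a good word $w$, its trace polynomial $p_w(z,x)$ is the unique polynomial with integer coefficients such that $\gamma(f,w(f,g))=p_w(\gamma(f,g),\beta(f))$ for all Möbius transformations $f,g$. **Theorem.** Let $f,g$ be Möbius transformations with $\beta=\beta(f)\ne-4$ and $\beta(g)=-4$ (so $g$ has order $2$), and let $\gamma=\gamma(f,g)$. Suppose that it is not the case that $\langle f,g\rangle$ is both discrete in $PSL(2,\mathbb C)$ and free on $f$ and $g$, where free on $f$ and $g$ means that the natural homomorphism from the free product $\langle f\rangle*\langle g\rangle$ onto $\langle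 f,g\rangle$ is an isomorphism. Then for every open set $U\subseteq\mathbb C$ containing $\gamma$ there is a good word $w$ which has a trace polynomial $p_w$ such that the polynomial $q_w(z)=p_w(z,\beta)\in\mathbb C[z]$ is not identically zero and has a root in $U$. -/

import Mathlib

namespace TraceRoots

/-- The group of Möbius transformations, `PSL(2, ℂ)`, with its quotient topology. -/
abbrev Moebius : Type := Matrix.ProjectiveSpecialLinearGroup (Fin 2) ℂ

/-- `β(A) = tr²(A) - 4` for a matrix `A`. -/
noncomputable def betaSL (A : Matrix.SpecialLinearGroup (Fin 2) ℂ) : ℂ :=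
  A.1.trace ^ 2 - 4

/-- `γ(A, B) = tr(A B A⁻¹ B⁻¹) - 2` for matrices `A`, `B`. -/
noncomputable def gammaSL (A B : Matrix.SpecialLinearGroup (Fin 2) ℂ) : ℂ :=
  (A * B * A⁻¹ * B⁻¹).1.trace - 2

theorem betaSL_congr {A A' : Matrix.SpecialLinearGroup (Fin 2) ℂ}
    (h : A⁻¹ * A' ∈ Subgroup.center (Matrix.SpecialLinearGroup (Fin 2) ℂ)) :
    betaSL A = betaSL A' := by
  obtain ⟨r, hr, hc⟩ := Matrix.SpecialLinearGroup.mem_center_iff.mp h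
  have hr2 : r ^ 2 = 1 := by simpa using hr
  have hA : A' = A * (A⁻¹ * A') := by group
  have ht : A'.1.trace = r * A.1.trace := by
    rw [hA]
    change (A.1 * (A⁻¹ * A').1).trace = _
    rw [← hc, Matrix.scalar_apply, ← Matrix.smul_one_eq_diagonal]
    simp
  unfold betaSL
  rw [ht, mul_pow, hr2, one_mul]

theorem gammaSL_congr {A A' B B' : Matrix.SpecialLinearGroup (Fin 2) ℂ}
    (hA : A⁻¹ * A' ∈ Subgroup.center (Matrix.SpecialLinearGroup (Fin 2) ℂ))
    (hB : B⁻¹ * B' ∈ Subgroup.center (Matrix.SpecialLinearGroup (Fin 2) ℂ)) :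
    gammaSL A B = gammaSL A' B' := by
  have key : ∀ P Q c d : Matrix.SpecialLinearGroup (Fin 2) ℂ,
      c ∈ Subgroup.center (Matrix.SpecialLinearGroup (Fin 2) ℂ) →
      d ∈ Subgroup.center (Matrix.SpecialLinearGroup (Fin 2) ℂ) →
      (P * c) * (Q * d) * (P * c)⁻¹ * (Q * d)⁻¹ = P * Q * P⁻¹ * Q⁻¹ := by
    intro P Q c d hc hd
    have hc' := Subgroup.mem_center_iff.mp hc
    have hd' := Subgroup.mem_center_iff.mp hd
    calc (P * c) * (Q * d) * (P * c)⁻¹ * (Q * d)⁻¹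
        = P * (c * Q) * d * c⁻¹ * P⁻¹ * d⁻¹ * Q⁻¹ := by group
      _ = P * (Q * c) * d * c⁻¹ * P⁻¹ * d⁻¹ * Q⁻¹ := by rw [hc' Q]
      _ = P * Q * (c * d) * c⁻¹ * P⁻¹ * d⁻¹ * Q⁻¹ := by group
      _ = P * Q * (d * c) * c⁻¹ * P⁻¹ * d⁻¹ * Q⁻¹ := by rw [hd' c]
      _ = P * Q * (d * P⁻¹) * d⁻¹ * Q⁻¹ := by group
      _ = P * Q * (P⁻¹ * d) * d⁻¹ * Q⁻¹ := by rw [hd' P⁻¹]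
      _ = P * Q * P⁻¹ * Q⁻¹ := by group
  have h := key A B _ _ hA hB
  rw [mul_inv_cancel_left, mul_inv_cancel_left] at h
  unfold gammaSL
  rw [h]

/-- The parameter `β(f) = tr²(f) - 4` of a Möbius transformation. -/
noncomputable def beta (f : Moebius) : ℂ :=
  Quotient.liftOn f betaSL fun _ _ h => betaSL_congr (QuotientGroup.leftRel_apply.mp h)

/-- The parameter `γ(f, g) = tr [f, g] - 2` of a pair of Möbius transformations. -/
noncomputable def gamma (f g : Moebius) : ℂ :=
  Quotient.liftOn₂ f g gammaSL fun _ _ _ _ h k =>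
    gammaSL_congr (QuotientGroup.leftRel_apply.mp h) (QuotientGroup.leftRel_apply.mp k)

theorem beta_mk (A : Matrix.SpecialLinearGroup (Fin 2) ℂ) :
    beta (QuotientGroup.mk A) = A.1.trace ^ 2 - 4 := rfl

theorem gamma_mk (A B : Matrix.SpecialLinearGroup (Fin 2) ℂ) :
    gamma (QuotientGroup.mk A) (QuotientGroup.mk B) = (A * B * A⁻¹ * B⁻¹).1.trace - 2 := rfl

/-- The alternating product
`b ^ s * a ^ r₁ * b ^ (-s) * a ^ r₂ * b ^ s * ⋯ * a ^ r_k * b ^ (± s)`, for the list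
`[r₁, …, r_k]` of exponents. -/
def altProd {G : Type*} [Group G] (a b : G) : ℤ → List ℤ → G
  | s, [] => b ^ s
  | s, r :: rs => b ^ s * a ^ r * altProd a b (-s) rs

/-- A good word on the letters `a`, `b` (the generators `0`, `1` of the free group): a word
`b ^ s₁ a ^ r₁ b ^ s₂ a ^ r₂ ⋯ a ^ r_{m-1} b ^ s_m` with `s₁ = ± 1`,
`s_j = (-1) ^ (j+1) s₁` and arbitrary integers `r_j`. -/
def IsGoodWord (w : FreeGroup (Fin 2)) : Prop :=
  ∃ (s : ℤ) (rs : List ℤ), (s = 1 ∨ s = -1) ∧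
    w = altProd (FreeGroup.of 0) (FreeGroup.of 1) s rs

/-- The element `w(f, g)` obtained by substituting `f` for `a` and `g` for `b`. -/
def evalWord {G : Type*} [Group G] (w : FreeGroup (Fin 2)) (f g : G) : G :=
  FreeGroup.lift ![f, g] w

/-- For `p ∈ ℤ[x][z]` and a complex number `β`, the one variable polynomial `p(β, z) ∈ ℂ[z]`. -/
noncomputable def specialize (p : Polynomial (Polynomial ℤ)) (β : ℂ) : Polynomial ℂ :=
  p.map (Polynomial.eval₂RingHom (Int.castRingHom ℂ) β)

/-- `p ∈ ℤ[x][z]` is the trace polynomial of the word `w`: for all Möbius transformations `f`, `g`,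
`γ(f, w(f, g))` is the value of `p` at `x = β(f)`, `z = γ(f, g)`. As `(β(f), γ(f, g))` takes all
values in `ℂ²`, there is at most one such `p`. -/
def IsTracePolynomial (w : FreeGroup (Fin 2)) (p : Polynomial (Polynomial ℤ)) : Prop :=
  ∀ f g : Moebius, gamma f (evalWord w f g) = (specialize p (beta f)).eval (gamma f g)

/-- The group `⟨f, g⟩` generated by `f` and `g` is a discrete subgroup of `PSL(2, ℂ)`. -/
def GeneratesDiscrete (f g : Moebius) : Prop :=
  DiscreteTopology (Subgroup.closure ({f, g} : Set Moebius))

/-- The group `⟨f, g⟩` is free on `f` and `g`: it is the free product `⟨f⟩ * ⟨g⟩`, that is, the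
natural map from the free product onto `⟨f, g⟩` is injective. -/
def IsFreeOn (f g : Moebius) : Prop :=
  Function.Injective
    (Monoid.Coprod.lift (Subgroup.zpowers f).subtype (Subgroup.zpowers g).subtype)

end TraceRoots

/-! ### Adjoint action on traceless matrices, and the obstruction over ℂ. -/

namespace TraceRoots

open Matrix

/-! Write `tr A = l + m` with `l m = 1`, so `β = (l - m)²`. If `γ ≠ 0`, the pair is conjugate to
`A_c = [[l, c], [0, m]]` and the half turn `J`, and `γ = β + c²`. Thus all pairs with this `β` and
`γ ≠ 0` lie in one holomorphic family in `c`, and each word in `A_c`, `J` is a matrix of polynomials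
in `c`. For a word `w` in which no exponent of `a` is generically trivial, `q_w(β + c²) =
gammaPoly(c)` is not the zero polynomial, by a degree count (`altProd_polyUpper_degree`). A root of
`q_w` in `U` is therefore a parameter `z` with `β + z² ∈ U` at which the word has `γ = 0`.

Suppose no such root exists; the group is then free and discrete. Freeness is direct: a relation
reduces to a good word up to powers of `f` at both ends, and that word has `γ(f, w) = γ(f, 1) = 0`
at the given parameter itself.

For discreteness, if an element of nonconstant trace had trace `2 cos(πp/q)` at some `z` near `c`,
its `q`-th power would be central there and its reduced form would give a root. So nonconstant
traces omit these values on a disc about `c`, hence omit `[-2, 2]` by the open mapping theorem, and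
Schwarz–Pick gives `|T'(c)| ≤ |T(c)² - 4| / ρ` (`hasTraceBound_of_forall_eval_ne_zero`). Testing
traces against a basis and taking powers turns this into `‖g'(c)‖ ≤ D ‖g(c) - 1‖` near the identity.

Now let the group at `c` be nondiscrete. The jets `g(c) + ε g'(c)` accumulate at `1`, and their
tangent vectors `X + ε Y` form a nonzero real Lie algebra, invariant under conjugation. By the
estimate, `Y` is a function of `X`. Complexified, this function is a derivation of `sl₂` compatible
with conjugation by `A_c + ε A_c'` and by `J`. It would make the deformation `c ↦ (A_c, J)`
infinitesimally trivial, which is impossible because `dγ/dc = 2c ≠ 0` (`IsTangentGraph.false`). The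
cases `γ = 0` and `c = 0` are roots for the words `b` and `b a b⁻¹`. -/

/-- The matrix `[[l, c], [0, m]]`. -/
def upperMat {R : Type*} [CommRing R] (l m c : R) : Matrix (Fin 2) (Fin 2) R := !![l, c; 0, m]

/-- The matrix of a half turn. -/
def turnMat (R : Type*) [CommRing R] : Matrix (Fin 2) (Fin 2) R := !![0, -1; 1, 0]

/-- The inverse of `turnMat`. -/
def turnMatInv (R : Type*) [CommRing R] : Matrix (Fin 2) (Fin 2) R := !![0, 1; -1, 0]

/-- The elementary nilpotent matrix `[[0, 1], [0, 0]]`. -/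
def nilMat : Matrix (Fin 2) (Fin 2) ℂ := !![0, 1; 0, 0]

theorem traceless_eta {R : Type*} [CommRing R] {X : Matrix (Fin 2) (Fin 2) R} (h : X.trace = 0) :
    X = !![X 0 0, X 0 1; X 1 0, -X 0 0] := by
  rw [Matrix.trace_fin_two] at h
  ext i j
  fin_cases i <;> fin_cases j <;> simp
  linear_combination h

/-- Irreducibility of the adjoint action. Conjugation by `J` fixes `J` and acts as `-1` on symmetric
traceless matrices, so an invariant subspace splits along this decomposition. The nonzero
determinant `d = -2c(l + m)((l - m)² + c²)` excludes anything between `0` and the whole space. -/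
theorem traceless_mem_of_invariant {l m c : ℂ} (hc : c ≠ 0) (ht : l + m ≠ 0)
    (hg : (l - m) ^ 2 + c ^ 2 ≠ 0) (N : Submodule ℂ (Matrix (Fin 2) (Fin 2) ℂ))
    (htr : ∀ X ∈ N, X.trace = 0)
    (hA : ∀ X ∈ N, upperMat l m c * X * upperMat m l (-c) ∈ N)
    (hA' : ∀ X ∈ N, upperMat m l (-c) * X * upperMat l m c ∈ N)
    (hJ : ∀ X ∈ N, turnMat ℂ * X * turnMatInv ℂ ∈ N) (hne : ∃ X ∈ N, X ≠ 0) :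
    ∀ X : Matrix (Fin 2) (Fin 2) ℂ, X.trace = 0 → X ∈ N := by
  have hdet : (2 * c) * (m * (l ^ 2 - m ^ 2 - c ^ 2) + l * (m ^ 2 - l ^ 2 - c ^ 2)) ≠ 0 := by
    have : m * (l ^ 2 - m ^ 2 - c ^ 2) + l * (m ^ 2 - l ^ 2 - c ^ 2) =
        -((l + m) * ((l - m) ^ 2 + c ^ 2)) := by ring
    rw [this]
    exact mul_ne_zero (mul_ne_zero two_ne_zero hc) (neg_ne_zero.mpr (mul_ne_zero ht hg))
  set d := (2 * c) * (m * (l ^ 2 - m ^ 2 - c ^ 2) + l * (m ^ 2 - l ^ 2 - c ^ 2)) with hd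
  by_cases hJN : turnMat ℂ ∈ N
  · have sym : ∀ x y : ℂ, !![x, y; y, -x] ∈ N := by
      intro x y
      have h1 := hA _ hJN
      have h2 := hA' _ hJN
      have h3 := N.sub_mem h1 (hJ _ h1)
      have h4 := N.sub_mem h2 (hJ _ h2)
      -- `h3` and `h4` are twice the symmetric parts of `A J A⁻¹` and `A⁻¹ J A`. They are
      -- independent because `d ≠ 0`, and the coefficients come from Cramer's rule.
      have h5 := N.add_mem (N.smul_mem ((x * (l ^ 2 - m ^ 2 - c ^ 2) + y * (2 * c * l)) / d) h3)
        (N.smul_mem ((y * (2 * c * m) - x * (m ^ 2 - l ^ 2 - c ^ 2)) / d) h4)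
      convert h5 using 1
      ext i j
      fin_cases i <;> fin_cases j <;>
        simp [upperMat, turnMat, turnMatInv] <;>
        field_simp <;> rw [hd] <;> ring
    intro X hX
    rw [traceless_eta hX]
    convert N.add_mem (sym (X 0 0) ((X 0 1 + X 1 0) / 2))
      (N.smul_mem ((X 1 0 - X 0 1) / 2) hJN) using 1
    ext i j
    fin_cases i <;> fin_cases j <;> simp [turnMat] <;> ring
  · exfalso
    -- `X + J X J⁻¹ = (X 1 0 - X 0 1) J`, so a nonsymmetric `X` would put `J` in `N`. Applied to `A
    -- X A⁻¹` and `A⁻¹ X A`, symmetry is a linear system for `X` with determinant `d` up to sign.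
    have sym : ∀ X ∈ N, X 0 1 = X 1 0 := by
      intro X hX
      have h4 := traceless_eta (htr X hX)
      generalize X 0 0 = x, X 0 1 = y, X 1 0 = z at h4
      subst h4
      by_contra hXs
      apply hJN
      have h1 := N.smul_mem (z - y)⁻¹ (N.add_mem hX (hJ _ hX))
      have h3 : z - y ≠ 0 := fun h => hXs (by simpa using (sub_eq_zero.mp h).symm)
      convert h1 using 1
      ext i j
      fin_cases i <;> fin_cases j <;> simp [turnMat, turnMatInv] <;> field_simp <;> ring1
    obtain ⟨X, hX, hX0⟩ := hne
    have h1 := sym _ (hA _ hX)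
    have h2 := sym _ (hA' _ hX)
    have h3 := sym _ hX
    have h4 := traceless_eta (htr X hX)
    apply hX0
    rw [h4, ← h3] at h1 h2
    simp [upperMat, Matrix.mul_apply, Fin.sum_univ_two] at h1 h2
    have h5 : d * X 0 0 = 0 := by
      rw [hd]; linear_combination (l ^ 2 - m ^ 2 - c ^ 2) * h2 - (m ^ 2 - l ^ 2 - c ^ 2) * h1
    have h6 : d * X 0 1 = 0 := by
      rw [hd]; linear_combination 2 * c * l * h2 + 2 * c * m * h1
    have h7 := (mul_eq_zero.mp h5).resolve_left hdet
    have h8 := (mul_eq_zero.mp h6).resolve_left hdet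
    rw [h4, ← h3, h7, h8]
    ext i j
    fin_cases i <;> fin_cases j <;> simp

/-- Closure properties of the tangent set, in dual number matrices `X + ε Y`, of the group
generated by `upperMat l m (c + ε)` and `turnMat`. -/
structure IsTangentGraph (l m c : ℂ)
    (W : Set (Matrix (Fin 2) (Fin 2) ℂ × Matrix (Fin 2) (Fin 2) ℂ)) : Prop where
  trace_fst : ∀ p ∈ W, p.1.trace = 0
  trace_snd : ∀ p ∈ W, p.2.trace = 0
  graph : ∀ Y, (0, Y) ∈ W → Y = 0
  bracket : ∀ p ∈ W, ∀ q ∈ W,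
    (p.1 * q.1 - q.1 * p.1, (p.1 * q.2 + p.2 * q.1) - (q.1 * p.2 + q.2 * p.1)) ∈ W
  upper : ∀ p ∈ W, (upperMat l m c * p.1 * upperMat m l (-c),
    nilMat * p.1 * upperMat m l (-c) + upperMat l m c * p.2 * upperMat m l (-c)
      - upperMat l m c * p.1 * nilMat) ∈ W
  upper_inv : ∀ p ∈ W, (upperMat m l (-c) * p.1 * upperMat l m c,
    - nilMat * p.1 * upperMat l m c + upperMat m l (-c) * p.2 * upperMat l m c
      + upperMat m l (-c) * p.1 * nilMat) ∈ W
  turn : ∀ p ∈ W, (turnMat ℂ * p.1 * turnMatInv ℂ, turnMat ℂ * p.2 * turnMatInv ℂ) ∈ W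
  exists_ne : ∃ p ∈ W, p.1 ≠ 0

/-- By irreducibility every traceless `X` has exactly one partner `Y = δ X`, and `δ` is a derivation
commuting with conjugation by `J`, hence a multiple of `ad J`. Compatibility with the deformed upper
triangular matrix makes this multiple vanish and then fails for `δ = 0`. -/
theorem IsTangentGraph.false_of_complex {l m c : ℂ} (hlm : l * m = 1) (hc : c ≠ 0)
    (ht : l + m ≠ 0) (hg : (l - m) ^ 2 + c ^ 2 ≠ 0)
    (W : Submodule ℂ (Matrix (Fin 2) (Fin 2) ℂ × Matrix (Fin 2) (Fin 2) ℂ))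
    (hW : IsTangentGraph l m c W) : False := by
  have hall := traceless_mem_of_invariant hc ht hg (W.map (LinearMap.fst ℂ _ _))
    (by rintro _ ⟨p, hp, rfl⟩; exact hW.trace_fst p hp)
    (by rintro _ ⟨p, hp, rfl⟩; exact ⟨_, hW.upper p hp, rfl⟩)
    (by rintro _ ⟨p, hp, rfl⟩; exact ⟨_, hW.upper_inv p hp, rfl⟩)
    (by rintro _ ⟨p, hp, rfl⟩; exact ⟨_, hW.turn p hp, rfl⟩)
    (by obtain ⟨p, hp, hp0⟩ := hW.exists_ne; exact ⟨_, ⟨p, hp, rfl⟩, hp0⟩)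
  have hgr : ∀ X Y Y', (X, Y) ∈ W → (X, Y') ∈ W → Y = Y' := by
    intro X Y Y' h h'
    have := W.sub_mem h h'
    rw [Prod.mk_sub_mk, sub_self] at this
    exact sub_eq_zero.mp (hW.graph _ this)
  have hex : ∀ X : Matrix (Fin 2) (Fin 2) ℂ, X.trace = 0 → ∃ Y, (X, Y) ∈ W := by
    intro X hX
    obtain ⟨p, hp, h⟩ := hall X hX
    obtain ⟨p1, p2⟩ := p
    simp only [LinearMap.fst_apply] at h
    subst h
    exact ⟨p2, hp⟩
  have hl : l ≠ 0 := left_ne_zero_of_mul_eq_one hlm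
  obtain ⟨YH, hH⟩ := hex !![1, 0; 0, -1] (by simp [Matrix.trace_fin_two])
  obtain ⟨YE, hE⟩ := hex !![0, 1; 0, 0] (by simp [Matrix.trace_fin_two])
  obtain ⟨YF, hF⟩ := hex !![0, 0; 1, 0] (by simp [Matrix.trace_fin_two])
  have e1 : YH = !![YH 0 0, YH 0 1; YH 1 0, -YH 0 0] := traceless_eta (hW.trace_snd _ hH)
  have e2 : YE = !![YE 0 0, YE 0 1; YE 1 0, -YE 0 0] := traceless_eta (hW.trace_snd _ hE)
  have e3 : YF = !![YF 0 0, YF 0 1; YF 1 0, -YF 0 0] := traceless_eta (hW.trace_snd _ hF)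
  generalize YH 0 0 = a1, YH 0 1 = b1, YH 1 0 = c1 at e1
  generalize YE 0 0 = a2, YE 0 1 = b2, YE 1 0 = c2 at e2
  generalize YF 0 0 = a3, YF 0 1 = b3, YF 1 0 = c3 at e3
  subst e1 e2 e3
  have key : ∀ X Y X' Y', (X, Y) ∈ W → (X', Y') ∈ W → X = X' →
      Y 0 0 = Y' 0 0 ∧ Y 0 1 = Y' 0 1 ∧ Y 1 0 = Y' 1 0 := by
    rintro X Y X' Y' h h' rfl
    rw [hgr _ _ _ h h']; simp
  -- The relations used are `J H J⁻¹ = -H`, `J E J⁻¹ = -F`, `[H, E] = 2E`, `[E, F] = H`, `A E A⁻¹ =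
  -- l² E` and `A H A⁻¹ = H - 2cl E`; the second component of each is a linear equation on `δ`.
  have r1 := key _ _ _ _ (hW.turn _ hH) (W.neg_mem hH) (by
    ext i j; fin_cases i <;> fin_cases j <;> simp [turnMat, turnMatInv])
  have r2 := key _ _ _ _ (hW.turn _ hE) (W.neg_mem hF) (by
    ext i j; fin_cases i <;> fin_cases j <;> simp [turnMat, turnMatInv])
  have r3 := key _ _ _ _ (hW.bracket _ hH _ hE) (W.smul_mem 2 hE) (by
    ext i j; fin_cases i <;> fin_cases j <;> simp; norm_num)
  have r4 := key _ _ _ _ (hW.bracket _ hE _ hF) hH (by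
    ext i j; fin_cases i <;> fin_cases j <;> simp)
  have r5 := key _ _ _ _ (hW.upper _ hE) (W.smul_mem (l ^ 2) hE) (by
    ext i j; fin_cases i <;> fin_cases j <;> simp [upperMat]; ring)
  have r6 := key _ _ _ _ (hW.upper _ hH) (W.add_mem hH (W.smul_mem (-(2 * c * l)) hE)) (by
    ext i j; fin_cases i <;> fin_cases j <;> simp [upperMat] <;>
      first | ring1 | linear_combination hlm)
  simp [turnMat, turnMatInv, upperMat, nilMat] at r1 r2 r3 r4 r5 r6
  obtain ⟨r12, r13⟩ := r1
  obtain ⟨r21, r22, r23⟩ := r2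
  obtain ⟨r31, r32, r33⟩ := r3
  obtain ⟨r41, r42, r43⟩ := r4
  obtain ⟨r51, r52, r53⟩ := r5
  obtain ⟨r61, r62, r63⟩ := r6
  have q1 : a1 = 0 := by linear_combination r32 / 2
  have q2 : c2 = 0 := by linear_combination -r33 / 4
  have q3 : b3 = 0 := by linear_combination -r22 + q2
  have q4 : c3 = b2 := by linear_combination -r23
  have q5 : b2 = 0 := by linear_combination r41 / 2 + q1 / 2 - q4 / 2
  -- The entry `a2` is the remaining multiple of `ad J`; this is where `c ≠ 0` is needed.
  have q6 : a2 = 0 := by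
    have : c * l * a2 = 0 := by
      subst q1 q2 q3 q4 q5
      linear_combination -r52 / 2
    exact (mul_eq_zero.mp this).resolve_left (mul_ne_zero hc hl)
  have q7 : c1 = 0 := by linear_combination -r31 - 2 * q6
  have q8 : b1 = 0 := by linear_combination r13 + q7
  subst q1 q2 q3 q4 q5 q6 q7 q8
  have : l = 0 := by linear_combination -r62 / 2
  exact hl this

end TraceRoots

/-! ### Passing from real to complex tangent spaces. -/

namespace TraceRoots

open Matrix

/-- Pairs of complex `2 × 2` matrices, standing for dual number matrices `X + ε Y`. -/
abbrev MatPair : Type := Matrix (Fin 2) (Fin 2) ℂ × Matrix (Fin 2) (Fin 2) ℂ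

/-- Applied to `q X = δ(iX) - i δ(X)`, this shows that a real derivation `δ` of `sl₂(ℂ)` is
compatible with `i`. The identity `[q X, Y] = [X, q Y]` on `H`, `E` and `iH` forces `q H = q E = 0`;
then every `q X` commutes with `H` and `E`. -/
theorem antilinear_eq_zero {q : Matrix (Fin 2) (Fin 2) ℂ → Matrix (Fin 2) (Fin 2) ℂ}
    (htr : ∀ X, X.trace = 0 → (q X).trace = 0)
    (hI : ∀ X, X.trace = 0 → q (Complex.I • X) = -(Complex.I • q X))
    (hbr : ∀ X Y, X.trace = 0 → Y.trace = 0 → q X * Y - Y * q X = X * q Y - q Y * X) :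
    ∀ X, X.trace = 0 → q X = 0 := by
  set H : Matrix (Fin 2) (Fin 2) ℂ := !![1, 0; 0, -1] with hH
  set E : Matrix (Fin 2) (Fin 2) ℂ := !![0, 1; 0, 0] with hE
  have tH : H.trace = 0 := by simp [hH, Matrix.trace_fin_two]
  have tE : E.trace = 0 := by simp [hE, Matrix.trace_fin_two]
  have tI : (Complex.I • H).trace = 0 := by rw [Matrix.trace_smul, tH, smul_zero]
  have ent : ∀ {A B : Matrix (Fin 2) (Fin 2) ℂ}, A = B →
      A 0 0 = B 0 0 ∧ A 0 1 = B 0 1 ∧ A 1 0 = B 1 0 := by rintro A _ rfl; simp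
  have h0 : q H = 0 ∧ q E = 0 := by
    have b1 := hbr H H tH tH
    have b2 := hbr E E tE tE
    have b3 := hbr H E tH tE
    have b4 := hbr (Complex.I • H) E tI tE
    rw [hI H tH] at b4
    have e1 := traceless_eta (htr H tH)
    have e2 := traceless_eta (htr E tE)
    generalize q H = QH at *
    generalize q E = QE at *
    generalize QH 0 0 = a1, QH 0 1 = a2, QH 1 0 = a3 at e1
    generalize QE 0 0 = c1, QE 0 1 = c2, QE 1 0 = c3 at e2
    subst e1 e2
    have r1 := ent b1
    have r2 := ent b2
    have r3 := ent b3
    have r4 := ent b4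
    simp only [hH, hE] at r1 r2 r3 r4
    simp [-mul_eq_mul_left_iff] at r1 r2 r3 r4
    obtain ⟨r11, -⟩ := r1
    obtain ⟨r21, r22⟩ := r2
    obtain ⟨r31, r32, -⟩ := r3
    obtain ⟨-, r42, -⟩ := r4
    have q1 : a2 = 0 := by linear_combination -r11 / 4
    have q2 : c3 = 0 := by linear_combination -r21 / 2
    have q3 : c1 = 0 := by linear_combination r22 / 4
    have q4 : a1 = c2 := by linear_combination r32 / 2
    have q5 : c2 = 0 := by
      have : Complex.I * c2 = 0 := by linear_combination -r42 / 4 - Complex.I * q4 / 2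
      exact (mul_eq_zero.mp this).resolve_left Complex.I_ne_zero
    subst q1 q2 q3 q4 q5 r31
    constructor <;> (ext i j; fin_cases i <;> fin_cases j <;> simp)
  intro X hX
  have b1 := hbr X H hX tH
  have b2 := hbr X E hX tE
  rw [h0.1] at b1
  rw [h0.2] at b2
  have e1 := traceless_eta (htr X hX)
  generalize q X = Q at *
  generalize Q 0 0 = a1, Q 0 1 = a2, Q 1 0 = a3 at e1
  subst e1
  have r1 := ent b1
  have r2 := ent b2
  simp only [hH, hE] at r1 r2
  simp at r1 r2
  obtain ⟨r11, r12⟩ := r1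
  obtain ⟨-, r22⟩ := r2
  have q2 : a2 = 0 := by linear_combination -r11 / 2
  subst r22 q2 r12
  ext i j; fin_cases i <;> fin_cases j <;> simp

/-- On a real tangent graph the function `X ↦ Y` commutes with multiplication by `i`. -/
theorem IsTangentGraph.snd_I_smul {l m c : ℂ} (hc : c ≠ 0)
    (ht : l + m ≠ 0) (hg : (l - m) ^ 2 + c ^ 2 ≠ 0)
    (W : Submodule ℝ MatPair) (hW : IsTangentGraph l m c W)
    (X Y Y' : Matrix (Fin 2) (Fin 2) ℂ) (h : (X, Y) ∈ W) (h' : (Complex.I • X, Y') ∈ W) :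
    Y' = Complex.I • Y := by
  have hgr : ∀ X Y Y', (X, Y) ∈ W → (X, Y') ∈ W → Y = Y' := by
    intro X Y Y' h h'
    have := W.sub_mem h h'
    rw [Prod.mk_sub_mk, sub_self] at this
    exact sub_eq_zero.mp (hW.graph _ this)
  -- The largest complex subspace of the projection of `W`. It is invariant, hence zero or all
  -- traceless matrices.
  let V : Submodule ℂ (Matrix (Fin 2) (Fin 2) ℂ) :=
    { carrier := {X | ∃ Y Y', (X, Y) ∈ W ∧ (Complex.I • X, Y') ∈ W}
      zero_mem' := ⟨0, 0, W.zero_mem, by rw [smul_zero]; exact W.zero_mem⟩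
      add_mem' := by
        rintro X₁ X₂ ⟨Y₁, Z₁, h1, h2⟩ ⟨Y₂, Z₂, h3, h4⟩
        exact ⟨Y₁ + Y₂, Z₁ + Z₂, W.add_mem h1 h3, by rw [smul_add]; exact W.add_mem h2 h4⟩
      smul_mem' := by
        rintro z X ⟨Y, Z, h1, h2⟩
        refine ⟨z.re • Y + z.im • Z, z.re • Z - z.im • Y, ?_, ?_⟩
        · convert W.add_mem (W.smul_mem z.re h1) (W.smul_mem z.im h2) using 1
          ext i j <;> simp
          linear_combination (-X i j) * (Complex.re_add_im z)
        · convert W.sub_mem (W.smul_mem z.re h2) (W.smul_mem z.im h1) using 1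
          ext i j <;> simp
          linear_combination (-X i j * Complex.I) * (Complex.re_add_im z) +
            (X i j * z.im) * Complex.I_sq }
  have hconj : ∀ P Q X : Matrix (Fin 2) (Fin 2) ℂ,
      P * (Complex.I • X) * Q = Complex.I • (P * X * Q) := by
    intro P Q X; rw [Matrix.mul_smul, Matrix.smul_mul]
  by_cases hne : ∃ X ∈ V, X ≠ 0
  · have hVi : ∀ {X Y Z}, (X, Y) ∈ W → (Complex.I • X, Z) ∈ W → X ∈ V :=
      fun h1 h2 => ⟨_, _, h1, h2⟩
    have hVe : ∀ {X}, X ∈ V → ∃ Y Z, (X, Y) ∈ W ∧ (Complex.I • X, Z) ∈ W := fun h => h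
    clear_value V
    have hall := traceless_mem_of_invariant hc ht hg V
      (fun X hX => by
        obtain ⟨Y, Z, h1, -⟩ := hVe hX
        exact hW.trace_fst _ h1)
      (fun X hX => by
        obtain ⟨Y, Z, h1, h2⟩ := hVe hX
        have h3 := hW.upper _ h2
        have h4 := hW.upper _ h1
        simp only [hconj, SetLike.mem_coe] at h3 h4
        exact hVi h4 h3)
      (fun X hX => by
        obtain ⟨Y, Z, h1, h2⟩ := hVe hX
        have h3 := hW.upper_inv _ h2
        have h4 := hW.upper_inv _ h1
        simp only [hconj, SetLike.mem_coe] at h3 h4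
        exact hVi h4 h3)
      (fun X hX => by
        obtain ⟨Y, Z, h1, h2⟩ := hVe hX
        have h3 := hW.turn _ h2
        have h4 := hW.turn _ h1
        simp only [hconj, SetLike.mem_coe] at h3 h4
        exact hVi h4 h3) hne
    have hex : ∀ X : Matrix (Fin 2) (Fin 2) ℂ, X.trace = 0 → ∃ Y, (X, Y) ∈ W := by
      intro X hX
      obtain ⟨Y, -, h, -⟩ := hVe (hall X hX)
      exact ⟨Y, h⟩
    choose! d hd using hex
    have hIt : ∀ X : Matrix (Fin 2) (Fin 2) ℂ, X.trace = 0 → (Complex.I • X).trace = 0 := by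
      intro X hX; rw [Matrix.trace_smul, hX, smul_zero]
    have hq := antilinear_eq_zero (q := fun X => d (Complex.I • X) - Complex.I • d X)
      (by
        intro X hX
        rw [Matrix.trace_sub, hIt _ (hW.trace_snd _ (hd X hX)),
          hW.trace_snd _ (hd _ (hIt X hX)), sub_zero])
      (by
        intro X hX
        have h1 : Complex.I • Complex.I • X = -X := by
          rw [smul_smul, Complex.I_mul_I, neg_one_smul]
        have h2 := hd _ (hIt _ (hIt X hX))
        rw [h1] at h2
        have h3 := hgr _ _ _ h2 (W.neg_mem (hd X hX))
        have h4 : Complex.I • Complex.I • d X = - d X := by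
          rw [smul_smul, Complex.I_mul_I, neg_one_smul]
        rw [h1, h3, smul_sub, h4]
        simp only [neg_sub])
      (by
        intro X Y hX hY
        -- Expanding `δ` of `[iX, Y] = [X, iY]` in both ways gives the commutation identity for `q`.
        have h1 := hW.bracket _ (hd _ (hIt X hX)) _ (hd Y hY)
        have h2 := hW.bracket _ (hd X hX) _ (hd _ (hIt Y hY))
        simp only [Matrix.mul_smul, Matrix.smul_mul] at h1 h2
        have h3 := hgr _ _ _ h1 h2
        simp only [sub_mul, mul_sub, Matrix.mul_smul, Matrix.smul_mul]
        rw [← sub_eq_zero] at h3 ⊢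
        rw [← h3]
        abel)
    have hX := hW.trace_fst _ h
    rw [hgr _ _ _ h (hd X hX), hgr _ _ _ h' (hd _ (hIt X hX))]
    exact sub_eq_zero.mp (hq X hX)
  · have hX : X = 0 := by
      by_contra hX
      exact hne ⟨X, ⟨Y, Y', h, h'⟩, hX⟩
    subst hX
    rw [smul_zero] at h'
    rw [hW.graph _ h, hW.graph _ h', smul_zero]

theorem IsTangentGraph.false {l m c : ℂ} (hlm : l * m = 1) (hc : c ≠ 0)
    (ht : l + m ≠ 0) (hg : (l - m) ^ 2 + c ^ 2 ≠ 0)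
    (W : Submodule ℝ MatPair) (hW : IsTangentGraph l m c W) : False := by
  -- The complexification `W + iW`. It is still a graph: if `u + iv` has first component `0`, then
  -- `v.1 = i u.1`, so `v.2 = i u.2` by `snd_I_smul` and the second component vanishes too.
  let WC : Submodule ℂ MatPair :=
    { carrier := {p | ∃ u ∈ W, ∃ v ∈ W, p = u + Complex.I • v}
      zero_mem' := ⟨0, W.zero_mem, 0, W.zero_mem, by simp⟩
      add_mem' := by
        rintro _ _ ⟨u, hu, v, hv, rfl⟩ ⟨u', hu', v', hv', rfl⟩
        exact ⟨_, W.add_mem hu hu', _, W.add_mem hv hv', by rw [smul_add]; abel⟩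
      smul_mem' := by
        rintro z _ ⟨u, hu, v, hv, rfl⟩
        refine ⟨_, W.sub_mem (W.smul_mem z.re hu) (W.smul_mem z.im hv),
          _, W.add_mem (W.smul_mem z.re hv) (W.smul_mem z.im hu), ?_⟩
        have hz := Complex.re_add_im z
        ext i j <;> simp
        · linear_combination (-u.1 i j - Complex.I * v.1 i j) * hz +
            (v.1 i j * z.im) * Complex.I_sq
        · linear_combination (-u.2 i j - Complex.I * v.2 i j) * hz +
            (v.2 i j * z.im) * Complex.I_sq }
  have htr : ∀ A B : Matrix (Fin 2) (Fin 2) ℂ, A.trace = 0 → B.trace = 0 →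
      (A + Complex.I • B).trace = 0 := by
    intro A B hA hB
    rw [Matrix.trace_add, Matrix.trace_smul, hA, hB, smul_zero, add_zero]
  refine IsTangentGraph.false_of_complex hlm hc ht hg WC ⟨?_, ?_, ?_, ?_, ?_, ?_, ?_, ?_⟩
  · rintro _ ⟨u, hu, v, hv, rfl⟩
    exact htr _ _ (hW.trace_fst _ hu) (hW.trace_fst _ hv)
  · rintro _ ⟨u, hu, v, hv, rfl⟩
    exact htr _ _ (hW.trace_snd _ hu) (hW.trace_snd _ hv)
  · rintro Y ⟨u, hu, v, hv, h⟩
    have h1 : 0 = u.1 + Complex.I • v.1 := congrArg Prod.fst h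
    have h2 : Y = u.2 + Complex.I • v.2 := congrArg Prod.snd h
    have h3 : v.1 = Complex.I • u.1 := by
      have : u.1 = -(Complex.I • v.1) := eq_neg_of_add_eq_zero_left h1.symm
      rw [this, smul_neg, smul_smul, Complex.I_mul_I, neg_one_smul, neg_neg]
    have h4 := hW.snd_I_smul hc ht hg W u.1 u.2 v.2 hu (by rw [← h3]; exact hv)
    rw [h2, h4, smul_smul, Complex.I_mul_I, neg_one_smul, add_neg_cancel]
  · rintro _ ⟨u, hu, v, hv, rfl⟩ _ ⟨u', hu', v', hv', rfl⟩
    have hI : ∀ A : Matrix (Fin 2) (Fin 2) ℂ, Complex.I • Complex.I • A = -A := by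
      intro A; rw [smul_smul, Complex.I_mul_I, neg_one_smul]
    refine ⟨_, W.sub_mem (hW.bracket _ hu _ hu') (hW.bracket _ hv _ hv'),
      _, W.add_mem (hW.bracket _ hu _ hv') (hW.bracket _ hv _ hu'), ?_⟩
    refine Prod.ext ?_ ?_
    · simp only [Prod.fst_add, Prod.smul_fst, Prod.fst_sub, add_mul, mul_add, Matrix.mul_smul,
        Matrix.smul_mul, smul_add, smul_sub, hI]
      abel
    · simp only [Prod.fst_add, Prod.smul_fst, Prod.snd_add, Prod.smul_snd, Prod.snd_sub,
        add_mul, mul_add, Matrix.mul_smul,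
        Matrix.smul_mul, smul_add, smul_sub, hI]
      abel
  · rintro _ ⟨u, hu, v, hv, rfl⟩
    refine ⟨_, hW.upper _ hu, _, hW.upper _ hv, ?_⟩
    refine Prod.ext ?_ ?_ <;>
    · simp only [Prod.fst_add, Prod.smul_fst, Prod.snd_add, Prod.smul_snd,
        add_mul, mul_add, Matrix.mul_smul, Matrix.smul_mul, smul_add, smul_sub]
      try abel
  · rintro _ ⟨u, hu, v, hv, rfl⟩
    refine ⟨_, hW.upper_inv _ hu, _, hW.upper_inv _ hv, ?_⟩
    refine Prod.ext ?_ ?_ <;>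
    · simp only [Prod.fst_add, Prod.smul_fst, Prod.snd_add, Prod.smul_snd,
        add_mul, mul_add, Matrix.mul_smul, Matrix.smul_mul, smul_add]
      try abel
  · rintro _ ⟨u, hu, v, hv, rfl⟩
    refine ⟨_, hW.turn _ hu, _, hW.turn _ hv, ?_⟩
    refine Prod.ext ?_ ?_ <;>
    · simp only [Prod.fst_add, Prod.smul_fst, Prod.snd_add, Prod.smul_snd,
        add_mul, mul_add, Matrix.mul_smul, Matrix.smul_mul]
  · obtain ⟨p, hp, hp0⟩ := hW.exists_ne
    exact ⟨p, ⟨p, hp, 0, W.zero_mem, by simp⟩, hp0⟩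

end TraceRoots

/-! ### Tangent vectors to a group inside a normed algebra. -/

namespace TraceRoots

open Filter Topology


section Tangent

variable {E : Type*} [NormedRing E]

/-- The binomial remainders are dominated termwise by those of the scalar `1 + ‖a‖`; commutativity
of `E` plays no role. -/
theorem norm_pow_sub_one_le (a : E) (k : ℕ) :
    ‖(1 + a) ^ k - 1‖ ≤ (1 + ‖a‖) ^ k - 1 ∧
      ‖(1 + a) ^ k - 1 - k • a‖ ≤ (1 + ‖a‖) ^ k - 1 - k * ‖a‖ := by
  induction k with
  | zero => simp
  | succ k ih =>
    obtain ⟨h1, h2⟩ := ih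
    have h3 : ‖((1 + a) ^ k - 1) * a‖ ≤ ((1 + ‖a‖) ^ k - 1) * ‖a‖ :=
      (norm_mul_le _ _).trans (mul_le_mul_of_nonneg_right h1 (norm_nonneg a))
    constructor
    · have : (1 + a) ^ (k + 1) - 1 = ((1 + a) ^ k - 1) + ((1 + a) ^ k - 1) * a + a := by
        rw [pow_succ]; noncomm_ring
      rw [this]
      refine (norm_add₃_le).trans ?_
      rw [pow_succ]; linarith
    · have : (1 + a) ^ (k + 1) - 1 - (k + 1) • a =
          ((1 + a) ^ k - 1 - k • a) + ((1 + a) ^ k - 1) * a := by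
        rw [pow_succ, add_smul, one_smul]; noncomm_ring
      rw [this]
      refine (norm_add_le _ _).trans ?_
      rw [pow_succ]; push_cast; linarith

theorem one_add_pow_le_exp {x : ℝ} (hx : 0 ≤ x) (k : ℕ) : (1 + x) ^ k ≤ Real.exp (k * x) := by
  rw [Real.exp_nat_mul]
  gcongr
  rw [add_comm]; exact Real.add_one_le_exp x

theorem norm_pow_sub_linear_le (a : E) (k : ℕ) (h : k * ‖a‖ ≤ 1) :
    ‖(1 + a) ^ k - 1 - k • a‖ ≤ (k * ‖a‖) ^ 2 := by
  have h0 : 0 ≤ k * ‖a‖ := by positivity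
  have h1 := (norm_pow_sub_one_le a k).2
  have h2 := one_add_pow_le_exp (norm_nonneg a) k
  have h3 := Real.abs_exp_sub_one_sub_id_le (x := k * ‖a‖) (by rwa [abs_of_nonneg h0])
  have h4 := le_abs_self (Real.exp (k * ‖a‖) - 1 - k * ‖a‖)
  linarith

variable {G : Type*} [Group G] [NormedAlgebra ℝ E]

/-- The tangent vectors at `1` to the image of a homomorphism `ψ : G →* E`: the limits of
`t⁻¹ • (ψ (u t) - 1)` as `t → 0+`, for families `u t` in `G`. -/
def tangentVectors (ψ : G →* E) : Set E :=
  {X | ∃ u : ℝ → G, Tendsto (fun t => t⁻¹ • (ψ (u t) - 1)) (𝓝[>] 0) (𝓝 X)}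

theorem tendsto_one_of_tangent {ψ : G →* E} {u : ℝ → G} {X : E}
    (h : Tendsto (fun t => t⁻¹ • (ψ (u t) - 1)) (𝓝[>] 0) (𝓝 X)) :
    Tendsto (fun t => ψ (u t)) (𝓝[>] 0) (𝓝 1) := by
  have h1 : Tendsto (fun t : ℝ => t) (𝓝[>] 0) (𝓝 0) := tendsto_nhdsWithin_of_tendsto_nhds tendsto_id
  have h2 := (h1.smul h).add_const (1 : E)
  rw [zero_smul, zero_add] at h2
  refine h2.congr' ?_
  filter_upwards [self_mem_nhdsWithin] with t ht
  rw [smul_smul, mul_inv_cancel₀ (ne_of_gt ht), one_smul, sub_add_cancel]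

theorem tendsto_inv_one_of_tangent [CompleteSpace E] {ψ : G →* E} {u : ℝ → G} {X : E}
    (h : Tendsto (fun t => t⁻¹ • (ψ (u t) - 1)) (𝓝[>] 0) (𝓝 X)) :
    Tendsto (fun t => ψ (u t)⁻¹) (𝓝[>] 0) (𝓝 1) := by
  have h1 := (NormedRing.inverse_continuousAt (1 : Eˣ)).tendsto.comp (tendsto_one_of_tangent h)
  rw [Units.val_one, Ring.inverse_one] at h1
  refine h1.congr fun t => ?_
  have : ψ (u t) = ((Units.map ψ) (toUnits (u t)) : Eˣ) := rfl
  rw [Function.comp_apply, this, Ring.inverse_unit]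
  rfl

theorem zero_mem_tangentVectors (ψ : G →* E) : (0 : E) ∈ tangentVectors ψ :=
  ⟨fun _ => 1, by simp⟩

theorem add_mem_tangentVectors {ψ : G →* E} {X Y : E} (hX : X ∈ tangentVectors ψ)
    (hY : Y ∈ tangentVectors ψ) : X + Y ∈ tangentVectors ψ := by
  obtain ⟨u, hu⟩ := hX
  obtain ⟨v, hv⟩ := hY
  refine ⟨fun t => u t * v t, ?_⟩
  have h := (hu.mul (tendsto_one_of_tangent hv)).add hv
  rw [mul_one] at h
  refine h.congr fun t => ?_
  rw [map_mul, smul_mul_assoc, ← smul_add, sub_mul, one_mul, sub_add_sub_cancel]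

theorem neg_mem_tangentVectors [CompleteSpace E] {ψ : G →* E} {X : E}
    (hX : X ∈ tangentVectors ψ) : -X ∈ tangentVectors ψ := by
  obtain ⟨u, hu⟩ := hX
  refine ⟨fun t => (u t)⁻¹, ?_⟩
  have h := ((tendsto_inv_one_of_tangent hu).mul hu).neg
  rw [one_mul] at h
  refine h.congr fun t => ?_
  rw [mul_smul_comm, mul_sub, ← map_mul, inv_mul_cancel, map_one, mul_one, ← smul_neg, neg_sub]

theorem pos_smul_mem_tangentVectors {ψ : G →* E} {X : E} (hX : X ∈ tangentVectors ψ)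
    {s : ℝ} (hs : 0 < s) : s • X ∈ tangentVectors ψ := by
  obtain ⟨u, hu⟩ := hX
  refine ⟨fun t => u (s * t), ?_⟩
  have h1 : Tendsto (fun t : ℝ => s * t) (𝓝[>] 0) (𝓝[>] 0) := by
    refine tendsto_nhdsWithin_iff.mpr ⟨?_, ?_⟩
    · refine tendsto_nhdsWithin_of_tendsto_nhds ?_
      simpa using (continuous_const_mul s).tendsto (0 : ℝ)
    · filter_upwards [self_mem_nhdsWithin] with t ht
      exact mul_pos hs ht
  have h2 := (hu.comp h1).const_smul s
  refine h2.congr fun t => ?_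
  simp only [Function.comp_apply]
  rw [smul_smul, mul_inv, mul_inv_cancel_left₀ hs.ne']

/-- Group commutators at time `√t` are `1 + t [X, Y] + o(t)`. -/
theorem lie_mem_tangentVectors [CompleteSpace E] {ψ : G →* E} {X Y : E}
    (hX : X ∈ tangentVectors ψ) (hY : Y ∈ tangentVectors ψ) :
    X * Y - Y * X ∈ tangentVectors ψ := by
  obtain ⟨u, hu⟩ := hX
  obtain ⟨v, hv⟩ := hY
  refine ⟨fun t => u √t * v √t * (u √t)⁻¹ * (v √t)⁻¹, ?_⟩
  have h1 : Tendsto (fun t : ℝ => √t) (𝓝[>] 0) (𝓝[>] 0) := by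
    refine tendsto_nhdsWithin_iff.mpr ⟨?_, ?_⟩
    · refine tendsto_nhdsWithin_of_tendsto_nhds ?_
      simpa using Real.continuous_sqrt.tendsto (0 : ℝ)
    · filter_upwards [self_mem_nhdsWithin] with t ht
      exact Real.sqrt_pos.mpr ht
  have h2 := ((((hu.mul hv).sub (hv.mul hu)).mul (tendsto_inv_one_of_tangent hu)).mul
    (tendsto_inv_one_of_tangent hv)).comp h1
  rw [mul_one, mul_one] at h2
  refine h2.congr' ?_
  filter_upwards [self_mem_nhdsWithin] with t ht
  simp only [Function.comp_apply]
  have h3 : (√t)⁻¹ * (√t)⁻¹ = t⁻¹ := by rw [← mul_inv, Real.mul_self_sqrt (le_of_lt ht)]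
  have h4 : ψ (v √t) * ψ (u √t) * ψ (u √t)⁻¹ * ψ (v √t)⁻¹ = 1 := by
    simp only [← map_mul]
    rw [mul_inv_cancel_right, mul_inv_cancel, map_one]
  simp only [smul_mul_assoc, mul_smul_comm, smul_smul, h3, ← smul_sub]
  congr 1
  have h5 : ∀ a b : E, (a - 1) * (b - 1) - (b - 1) * (a - 1) = a * b - b * a := by
    intro a b; noncomm_ring
  rw [h5, sub_mul, sub_mul, h4, map_mul, map_mul, map_mul]

theorem conj_mem_tangentVectors {ψ : G →* E} {X : E} (hX : X ∈ tangentVectors ψ) (g : G) :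
    ψ g * X * ψ g⁻¹ ∈ tangentVectors ψ := by
  obtain ⟨u, hu⟩ := hX
  refine ⟨fun t => g * u t * g⁻¹, ?_⟩
  refine ((hu.const_mul (ψ g)).mul_const (ψ g⁻¹)).congr fun t => ?_
  rw [mul_smul_comm, smul_mul_assoc, mul_sub, sub_mul, mul_one, ← map_mul ψ g g⁻¹,
    mul_inv_cancel, map_one, map_mul, map_mul]

/-- The tangent vectors form a real vector space. -/
def tangentSpace [CompleteSpace E] (ψ : G →* E) : Submodule ℝ E where
  carrier := tangentVectors ψ
  zero_mem' := zero_mem_tangentVectors ψ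
  add_mem' := add_mem_tangentVectors
  smul_mem' := by
    intro s X hX
    rcases lt_trichotomy s 0 with hs | rfl | hs
    · rw [← neg_neg (s • X), ← neg_smul]
      exact neg_mem_tangentVectors (pos_smul_mem_tangentVectors hX (neg_pos.mpr hs))
    · rw [zero_smul]; exact zero_mem_tangentVectors ψ
    · exact pos_smul_mem_tangentVectors hX hs

/-- A limit of difference quotients along a sequence in `G` is a tangent vector. -/
theorem mem_tangentVectors_of_seq {ψ : G →* E} {g : ℕ → G} {τ : ℕ → ℝ} {X : E}
    (hτ : ∀ n, 0 < τ n) (hτ0 : Tendsto τ atTop (𝓝 0))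
    (h : Tendsto (fun n => (τ n)⁻¹ • (ψ (g n) - 1)) atTop (𝓝 X)) : X ∈ tangentVectors ψ := by
  have key : ∀ ε > 0, ∃ δ > 0, ∀ t : ℝ, 0 < t → t < δ →
      ∃ u : G, ‖t⁻¹ • (ψ u - 1) - X‖ < ε := by
    intro ε hε
    set M := ‖X‖ + 1 with hM
    have hMpos : 0 < M := by positivity
    -- The first bound gives `tM < 1`, as the quadratic estimate for powers requires; the second
    -- makes its error `(tM)² / t` at most `ε / 4`.
    refine ⟨min (1 / M) (ε / (4 * M ^ 2)), by positivity, fun t ht0 ht => ?_⟩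
    have ht1 : t * M < 1 := by
      have := ht.trans_le (min_le_left _ _)
      rwa [lt_div_iff₀ hMpos] at this
    have ht2 : t * M ^ 2 < ε / 4 := by
      have := ht.trans_le (min_le_right _ _)
      rw [lt_div_iff₀ (by positivity)] at this
      linarith
    have e1 : ∀ᶠ n in atTop, ‖(τ n)⁻¹ • (ψ (g n) - 1) - X‖ < min 1 (ε / 4) :=
      (tendsto_iff_norm_sub_tendsto_zero.mp h).eventually_lt_const (by positivity)
    have e2 : ∀ᶠ n in atTop, τ n < t * (ε / (4 * M)) :=
      hτ0.eventually_lt_const (by positivity)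
    obtain ⟨n, hn1, hn2⟩ := (e1.and e2).exists
    have hn3 := hn1.trans_le (min_le_left _ _)
    have hn4 := hn1.trans_le (min_le_right _ _)
    set a := ψ (g n) - 1 with ha
    set D := (τ n)⁻¹ • a with hD
    have haD : a = τ n • D := by rw [hD, smul_smul, mul_inv_cancel₀ (hτ n).ne', one_smul]
    have hDM : ‖D‖ ≤ M := by
      have := norm_sub_norm_le D X
      linarith
    have hna : ‖a‖ ≤ τ n * M := by
      rw [haD, norm_smul, Real.norm_of_nonneg (hτ n).le]
      exact mul_le_mul_of_nonneg_left hDM (hτ n).le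
    -- The element for time `t` is `g n ^ k` with `k τ n ≈ t`: a small step `τ n X` repeated `k`
    -- times is about `t X`.
    set k := ⌊t / τ n⌋₊ with hk
    have hk1 : k * τ n ≤ t := by
      rw [← le_div_iff₀ (hτ n)]
      exact Nat.floor_le (by have := hτ n; positivity)
    have hk2 : t < (k + 1) * τ n := by
      rw [← div_lt_iff₀ (hτ n)]
      exact Nat.lt_floor_add_one _
    have hka : k * ‖a‖ ≤ t * M := by
      calc k * ‖a‖ ≤ k * (τ n * M) := by gcongr
        _ = (k * τ n) * M := by ring
        _ ≤ t * M := by gcongr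
    have h1 := norm_pow_sub_linear_le a k (hka.trans ht1.le)
    refine ⟨g n ^ k, ?_⟩
    have h2 : ψ (g n ^ k) = (1 + a) ^ k := by rw [map_pow, ha, add_sub_cancel]
    have h3 : t⁻¹ • (ψ (g n ^ k) - 1) - X =
        t⁻¹ • ((1 + a) ^ k - 1 - k • a) + ((k * τ n / t - 1) • D + (D - X)) := by
      rw [h2]
      have : k • a = (k * τ n) • D := by
        rw [mul_smul, ← haD, Nat.cast_smul_eq_nsmul]
      rw [this, smul_sub t⁻¹ _ ((k * τ n) • D), smul_smul, sub_smul, one_smul]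
      rw [show t⁻¹ * (k * τ n) = k * τ n / t by ring]
      abel
    rw [h3]
    have n1 : ‖t⁻¹ • ((1 + a) ^ k - 1 - k • a)‖ ≤ ε / 4 := by
      rw [norm_smul, norm_inv, Real.norm_of_nonneg ht0.le, inv_mul_le_iff₀ ht0]
      have : (k * ‖a‖) ^ 2 ≤ (t * M) ^ 2 := by gcongr
      nlinarith
    have n2 : ‖(k * τ n / t - 1) • D‖ ≤ ε / 4 := by
      rw [norm_smul]
      have h4 : ‖(k * τ n / t - 1 : ℝ)‖ ≤ ε / (4 * M) := by
        rw [Real.norm_eq_abs, abs_le]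
        constructor
        · have : 1 - ε / (4 * M) ≤ k * τ n / t := by
            rw [le_div_iff₀ ht0]; linarith
          linarith
        · have : k * τ n / t ≤ 1 := by
            rw [div_le_one ht0]; exact hk1
          have : 0 < ε / (4 * M) := by positivity
          linarith
      calc _ ≤ ε / (4 * M) * M := by gcongr
        _ = ε / 4 := by field_simp
    have := norm_add_le (t⁻¹ • ((1 + a) ^ k - 1 - k • a)) ((k * τ n / t - 1) • D + (D - X))
    have := norm_add_le ((k * τ n / t - 1) • D) (D - X)
    linarith
  -- Choosing for each `t` an element within `t` of the infimum gives one family that serves every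
  -- `ε`.
  have hex : ∀ t : ℝ, ∃ u : G, 0 < t →
      ‖t⁻¹ • (ψ u - 1) - X‖ < (⨅ v : G, ‖t⁻¹ • (ψ v - 1) - X‖) + t := by
    intro t
    by_cases ht : 0 < t
    · obtain ⟨u, hu⟩ := exists_lt_of_ciInf_lt (lt_add_of_pos_right
        (⨅ v : G, ‖t⁻¹ • (ψ v - 1) - X‖) ht)
      exact ⟨u, fun _ => hu⟩
    · exact ⟨1, fun h => absurd h ht⟩
  choose u hu using hex
  refine ⟨u, Metric.tendsto_nhdsWithin_nhds.mpr fun ε hε => ?_⟩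
  obtain ⟨δ, hδ, hk⟩ := key (ε / 2) (by positivity)
  refine ⟨min δ (ε / 2), by positivity, fun {t} ht hd => ?_⟩
  have ht0 : 0 < t := ht
  rw [Real.dist_eq, sub_zero, abs_of_pos ht0] at hd
  obtain ⟨v, hv⟩ := hk t ht0 (hd.trans_le (min_le_left _ _))
  have h1 := hu t ht0
  have h2 : (⨅ v : G, ‖t⁻¹ • (ψ v - 1) - X‖) ≤ ‖t⁻¹ • (ψ v - 1) - X‖ :=
    ciInf_le ⟨0, by rintro _ ⟨w, rfl⟩; exact norm_nonneg _⟩ v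
  have h3 := hd.trans_le (min_le_right _ _)
  rw [dist_eq_norm]
  linarith

end Tangent

end TraceRoots

/-! ### A Schwarz–Pick estimate for functions omitting a segment. -/

namespace TraceRoots

open Filter Topology Metric

theorem norm_deriv_le_of_re_pos {R : ℂ → ℂ} {c : ℂ} {ρ : ℝ} (hρ : 0 < ρ)
    (hR : DifferentiableOn ℂ R (ball c ρ)) (hpos : ∀ z ∈ ball c ρ, 0 < (R z).re) :
    ‖deriv R c‖ ≤ 2 * (R c).re / ρ := by
  have hc : c ∈ ball c ρ := mem_ball_self hρ
  have h0 := hpos c hc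
  have hden : ∀ z ∈ ball c ρ, R z + (starRingEnd ℂ) (R c) ≠ 0 := by
    intro z hz h
    have := congrArg Complex.re h
    simp only [Complex.add_re, Complex.conj_re, Complex.zero_re] at this
    have := hpos z hz
    linarith
  -- Cayley transform of the right half plane onto the unit disc, sending `R c` to `0`.
  set φ : ℂ → ℂ := fun z => (R z - R c) / (R z + (starRingEnd ℂ) (R c)) with hφ
  have hφd : DifferentiableOn ℂ φ (ball c ρ) :=
    (hR.sub_const _).div (hR.add_const _) hden
  have hmaps : Set.MapsTo φ (ball c ρ) (closedBall (φ c) 1) := by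
    intro z hz
    have : φ c = 0 := by simp [hφ]
    rw [this, mem_closedBall_zero_iff, hφ]
    simp only [norm_div]
    rw [div_le_one (norm_pos_iff.mpr (hden z hz)), ← sq_le_sq₀ (norm_nonneg _) (norm_nonneg _),
      ← Complex.normSq_eq_norm_sq, ← Complex.normSq_eq_norm_sq]
    simp only [Complex.normSq_apply, Complex.sub_re, Complex.sub_im, Complex.add_re,
      Complex.add_im, Complex.conj_re, Complex.conj_im]
    nlinarith [mul_pos (hpos z hz) h0]
  have h1 := Complex.norm_deriv_le_div_of_mapsTo_ball hφd hmaps hρ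
  have hRd : HasDerivAt R (deriv R c) c :=
    (hR.differentiableAt (isOpen_ball.mem_nhds hc)).hasDerivAt
  have hφ' := (hRd.sub_const (R c)).div (hRd.add_const ((starRingEnd ℂ) (R c))) (hden c hc)
  have h2 : deriv φ c = deriv R c / ((2 * (R c).re : ℝ) : ℂ) := by
    have h3 : R c + (starRingEnd ℂ) (R c) = ((2 * (R c).re : ℝ) : ℂ) := by
      rw [Complex.add_conj]
    rw [show deriv φ c = _ from hφ'.deriv, h3]
    have : ((2 * (R c).re : ℝ) : ℂ) ≠ 0 := by
      rw [Complex.ofReal_ne_zero]; positivity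
    field_simp
    ring
  rw [h2, norm_div, Complex.norm_real, Real.norm_of_nonneg (by positivity),
    div_le_iff₀ (by positivity)] at h1
  calc _ ≤ _ := h1
    _ = _ := by ring

/-- A holomorphic function on a disc omitting `[-2, 2]` has controlled derivative at the centre. -/
theorem norm_deriv_le_of_omits_segment {T : ℂ → ℂ} {c : ℂ} {ρ : ℝ} (hρ : 0 < ρ)
    (hT : DifferentiableOn ℂ T (ball c ρ))
    (hom : ∀ z ∈ ball c ρ, ∀ s : ℝ, |s| ≤ 2 → T z ≠ s) :
    ‖deriv T c‖ ≤ ‖T c ^ 2 - 4‖ / ρ := by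
  have hc : c ∈ ball c ρ := mem_ball_self hρ
  have hne : ∀ z ∈ ball c ρ, T z + 2 ≠ 0 := by
    intro z hz h
    exact hom z hz (-2) (by norm_num) (by push_cast; linear_combination h)
  -- This Möbius map sends `[-2, 2)` minus its pole `-2`, together with `2`, to the nonpositive
  -- reals, so `S` takes values in the slit plane and has a square root `R` in the right half plane.
  set S : ℂ → ℂ := fun z => (T z - 2) / (T z + 2) with hS
  have hSd : DifferentiableOn ℂ S (ball c ρ) := (hT.sub_const _).div (hT.add_const _) hne
  have hST : ∀ z ∈ ball c ρ, S z * (T z + 2) = T z - 2 := by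
    intro z hz; rw [hS]; exact div_mul_cancel₀ _ (hne z hz)
  have hslit : ∀ z ∈ ball c ρ, S z ∈ Complex.slitPlane := by
    intro z hz
    by_contra h
    rw [Complex.mem_slitPlane_iff, not_or, not_lt, not_not] at h
    obtain ⟨h1, h2⟩ := h
    have h3 : S z = ((S z).re : ℂ) := Complex.ext rfl (by simp [h2])
    set x := (S z).re with hx
    have h4 : (1 - x : ℝ) ≠ 0 := by linarith
    refine hom z hz (2 * (1 + x) / (1 - x)) ?_ ?_
    · rw [abs_le, div_le_iff₀ (by linarith), le_div_iff₀ (by linarith)]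
      constructor <;> linarith
    · have h5 := hST z hz
      rw [h3] at h5
      have h6 : (1 - (x : ℂ)) ≠ 0 := by exact_mod_cast h4
      push_cast
      field_simp
      linear_combination -h5
  set R : ℂ → ℂ := fun z => Complex.exp (Complex.log (S z) / 2) with hR
  have hRd : DifferentiableOn ℂ R (ball c ρ) := ((hSd.clog hslit).div_const 2).cexp
  have hRS : ∀ z ∈ ball c ρ, R z ^ 2 = S z := by
    intro z hz
    rw [hR]
    simp only
    rw [← Complex.exp_nat_mul]
    push_cast
    rw [mul_div_cancel₀ _ (two_ne_zero), Complex.exp_log (Complex.slitPlane_ne_zero (hslit z hz))]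
  have hRpos : ∀ z ∈ ball c ρ, 0 < (R z).re := by
    intro z hz
    rw [hR]
    simp only
    rw [Complex.exp_re]
    refine mul_pos (Real.exp_pos _) (Real.cos_pos_of_mem_Ioo ?_)
    have h1 := Complex.mem_slitPlane_iff_arg.mp (hslit z hz)
    have h2 := Complex.neg_pi_lt_arg (S z)
    have h3 := lt_of_le_of_ne (Complex.arg_le_pi (S z)) h1.1
    have : (Complex.log (S z) / 2).im = (S z).arg / 2 := by
      rw [Complex.div_ofNat_im, Complex.log_im]
    rw [this]
    constructor <;> linarith
  have hkey := norm_deriv_le_of_re_pos hρ hRd hRpos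
  have dR : HasDerivAt R (deriv R c) c :=
    (hRd.differentiableAt (isOpen_ball.mem_nhds hc)).hasDerivAt
  have dT : HasDerivAt T (deriv T c) c :=
    (hT.differentiableAt (isOpen_ball.mem_nhds hc)).hasDerivAt
  have h1 : (fun z => R z ^ 2 * (T z + 2)) =ᶠ[𝓝 c] fun z => T z - 2 := by
    filter_upwards [isOpen_ball.mem_nhds hc] with z hz
    rw [hRS z hz, hST z hz]
  have h2 := ((dR.pow 2).mul (dT.add_const 2)).unique
    ((dT.sub_const 2).congr_of_eventuallyEq h1)
  have h3 := hRS c hc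
  have h4 := hST c hc
  have h5 : 4 * deriv T c = 2 * R c * deriv R c * (T c + 2) ^ 2 := by
    simp only [Pi.pow_apply] at h2
    push_cast at h2
    have h6 : (T c + 2) * (1 - S c) = 4 := by linear_combination -h4
    linear_combination -(T c + 2) * h2 - deriv T c * h6 + deriv T c * (T c + 2) * h3
  have h6 : 4 * ‖deriv T c‖ = 2 * ‖R c‖ * ‖deriv R c‖ * ‖T c + 2‖ ^ 2 := by
    have := congrArg norm h5
    simpa only [norm_mul, norm_pow, Complex.norm_ofNat] using this
  have h7 : ‖R c‖ ^ 2 * ‖T c + 2‖ = ‖T c - 2‖ := by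
    rw [← norm_pow, ← norm_mul, h3, h4]
  have h8 : ‖T c ^ 2 - 4‖ = ‖T c - 2‖ * ‖T c + 2‖ := by
    rw [← norm_mul]; congr 1; ring
  have h9 : ‖deriv R c‖ ≤ 2 * ‖R c‖ / ρ := by
    refine hkey.trans ?_
    have := Complex.re_le_norm (R c)
    gcongr
  have h10 : 2 * ‖R c‖ * ‖deriv R c‖ * ‖T c + 2‖ ^ 2 ≤
      2 * ‖R c‖ * (2 * ‖R c‖ / ρ) * ‖T c + 2‖ ^ 2 := by gcongr
  have h11 : 2 * ‖R c‖ * (2 * ‖R c‖ / ρ) * ‖T c + 2‖ ^ 2 = 4 * (‖T c ^ 2 - 4‖ / ρ) := by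
    rw [h8, ← h7]; ring
  linarith

theorem omits_segment_of_omits_cos {P : Polynomial ℂ} (hP : ∀ w, P ≠ Polynomial.C w)
    {c : ℂ} {ρ : ℝ}
    (hom : ∀ z ∈ ball c ρ, ∀ p q : ℕ, 0 < p → p < q →
      P.eval z ≠ ((2 * Real.cos (Real.pi * p / q) : ℝ) : ℂ)) :
    ∀ z ∈ ball c ρ, ∀ s : ℝ, |s| ≤ 2 → P.eval z ≠ s := by
  intro z hz s hs hzs
  have hρ : 0 < ρ := pos_of_mem_ball hz
  have han : AnalyticOnNhd ℂ (fun z => P.eval z) (ball c ρ) := fun x _ => by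
    exact (Polynomial.differentiable P).analyticAt x
  rcases han.is_constant_or_isOpen (convex_ball c ρ).isPreconnected with ⟨w, hw⟩ | hopen
  · refine hP w (Polynomial.eq_of_infinite_eval_eq _ _ ?_)
    refine Set.Infinite.mono (s := ball c ρ) (fun x hx => ?_) ?_
    · simp [hw x hx]
    · exact infinite_of_mem_nhds c (ball_mem_nhds c hρ)
  · have h1 := hopen (ball c ρ) le_rfl isOpen_ball
    have h2 : IsOpen ((fun x : ℝ => ((2 * Real.cos (Real.pi * x) : ℝ) : ℂ)) ⁻¹'
        ((fun z => P.eval z) '' ball c ρ)) := h1.preimage (by fun_prop)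
    set θ := Real.arccos (s / 2) with hθ
    have hpi := Real.pi_pos
    -- The closure covers the endpoints `s = ±2`; the rational found nearby is still strictly
    -- between `0` and `1`.
    have h3 : θ / Real.pi ∈ closure (Set.Ioo (0 : ℝ) 1) := by
      rw [closure_Ioo (by norm_num)]
      exact ⟨div_nonneg (Real.arccos_nonneg _) hpi.le,
        (div_le_one hpi).mpr (Real.arccos_le_pi _)⟩
    have h4 : θ / Real.pi ∈ (fun x : ℝ => ((2 * Real.cos (Real.pi * x) : ℝ) : ℂ)) ⁻¹'
        ((fun z => P.eval z) '' ball c ρ) := by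
      refine ⟨z, hz, ?_⟩
      simp only
      rw [hzs, mul_div_cancel₀ _ hpi.ne', hθ, Real.cos_arccos]
      · push_cast; ring
      · linarith [(abs_le.mp hs).1]
      · linarith [(abs_le.mp hs).2]
    obtain ⟨r, hr⟩ := Rat.isDenseEmbedding_coe_real.dense.exists_mem_open
      (h2.inter isOpen_Ioo) (mem_closure_iff.mp h3 _ h2 h4)
    obtain ⟨⟨x, hx, hxr⟩, hr0, hr1⟩ := hr
    have hr0' : 0 < r := by exact_mod_cast hr0
    have hr1' : r < 1 := by exact_mod_cast hr1
    refine hom x hx r.num.toNat r.den ?_ ?_ ?_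
    · have := Rat.num_pos.mpr hr0'; omega
    · have h5 := Rat.num_pos.mpr hr0'
      have h6 := Rat.num_lt_denom_iff.mpr hr1'
      omega
    · simp only at hxr
      rw [hxr]
      congr 3
      rw [mul_div_assoc]
      congr 1
      have h5 : ((r.num.toNat : ℤ)) = r.num := Int.toNat_of_nonneg (Rat.num_pos.mpr hr0').le
      have h6 : ((r.num.toNat : ℕ) : ℝ) = (r.num : ℝ) := by exact_mod_cast congrArg (Int.cast (R := ℝ)) h5
      rw [h6]
      exact_mod_cast (Rat.num_div_den r).symm

/-! ### Powers of matrices of determinant one. -/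

open Matrix

theorem sq_eq_of_det_one {R : Type*} [CommRing R] (M : Matrix (Fin 2) (Fin 2) R)
    (hM : M.det = 1) : M * M = M.trace • M - 1 := by
  rw [Matrix.det_fin_two] at hM
  ext i j
  fin_cases i <;> fin_cases j <;>
    simp [Matrix.mul_apply, Fin.sum_univ_two, Matrix.trace_fin_two]
  · linear_combination -hM
  · ring
  · ring
  · linear_combination -hM

/-- Cayley–Hamilton with the Chebyshev recursion for `sin (nθ)`. When `sin ((n + 1)θ) = 0 ≠ sin θ`,
it shows that `M ^ (n + 1)` is scalar. -/
theorem pow_of_trace_cos (M : Matrix (Fin 2) (Fin 2) ℂ) (hM : M.det = 1) (θ : ℂ)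
    (ht : M.trace = 2 * Complex.cos θ) (n : ℕ) :
    Complex.sin θ • M ^ (n + 1) =
      Complex.sin ((n + 1) * θ) • M - Complex.sin (n * θ) • (1 : Matrix (Fin 2) (Fin 2) ℂ) := by
  induction n with
  | zero => simp
  | succ n ih =>
    rw [pow_succ, ← Matrix.smul_mul, ih, sub_mul, Matrix.smul_mul, Matrix.smul_mul, one_mul,
      sq_eq_of_det_one M hM, ht, smul_sub, smul_smul, sub_right_comm, ← sub_smul]
    have : Complex.sin ((n + 1) * θ) * (2 * Complex.cos θ) - Complex.sin (n * θ) =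
        Complex.sin (((n + 1 : ℕ) + 1) * θ) := by
      have h1 : (n : ℂ) * θ = (n + 1) * θ - θ := by ring
      have h2 : (((n + 1 : ℕ) : ℂ) + 1) * θ = (n + 1) * θ + θ := by push_cast; ring
      rw [h1, h2, Complex.sin_sub, Complex.sin_add]; ring
    rw [this]
    push_cast
    rfl

theorem trace_pow_of_trace_eq (M : Matrix (Fin 2) (Fin 2) ℂ) (hM : M.det = 1) {s : ℂ}
    (hs : s ≠ 0) (ht : M.trace = s + s⁻¹) (n : ℕ) : (M ^ n).trace = s ^ n + (s⁻¹) ^ n := by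
  have : (M ^ n).trace = s ^ n + (s⁻¹) ^ n ∧ (M ^ (n + 1)).trace = s ^ (n + 1) + (s⁻¹) ^ (n + 1) := by
    induction n with
    | zero => simp [ht, Matrix.trace_one]; norm_num
    | succ n ih =>
      refine ⟨ih.2, ?_⟩
      rw [pow_succ, pow_succ, mul_assoc, sq_eq_of_det_one M hM, mul_sub, mul_one,
        Matrix.mul_smul, ← pow_succ, Matrix.trace_sub, Matrix.trace_smul, ih.1, ih.2, ht,
        smul_eq_mul]
      have : s * s⁻¹ = 1 := mul_inv_cancel₀ hs
      linear_combination (s ^ n + s⁻¹ ^ n) * this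
  exact this.1

end TraceRoots

/-! ### Existence of trace polynomials of good words. -/

namespace TraceRoots

theorem map_altProd {G H : Type*} [Group G] [Group H] (φ : G →* H) (a b : G) (s : ℤ)
    (rs : List ℤ) : φ (altProd a b s rs) = altProd (φ a) (φ b) s rs := by
  induction rs generalizing s with
  | nil => simp [altProd]
  | cons r rs ih => simp [altProd, ih]

theorem evalWord_altProd {G : Type*} [Group G] (f g : G) (s : ℤ) (rs : List ℤ) :
    evalWord (altProd (FreeGroup.of 0) (FreeGroup.of 1) s rs) f g = altProd f g s rs := by
  rw [evalWord, map_altProd]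
  simp

/-- The value at `(x, z)` of a polynomial in `ℤ[x][z]`. -/
noncomputable def polyVal (x z : ℂ) : Polynomial (Polynomial ℤ) →+* ℂ :=
  Polynomial.eval₂RingHom (Polynomial.eval₂RingHom (Int.castRingHom ℂ) x) z

theorem polyVal_apply (x z : ℂ) (p : Polynomial (Polynomial ℤ)) :
    polyVal x z p = (specialize p x).eval z := by
  rw [polyVal, specialize, Polynomial.eval_map]
  rfl

@[simp] theorem polyVal_X (x z : ℂ) : polyVal x z Polynomial.X = z := by
  simp [polyVal]

@[simp] theorem polyVal_C_X (x z : ℂ) : polyVal x z (Polynomial.C Polynomial.X) = x := by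
  simp [polyVal]

theorem coeff_eval_neg_of_polyVal {p : Polynomial (Polynomial ℤ)}
    (h : ∀ x z, polyVal (-x) z p = polyVal x z p) (n : ℕ) (x : ℂ) :
    (p.coeff n).eval₂ (Int.castRingHom ℂ) (-x) = (p.coeff n).eval₂ (Int.castRingHom ℂ) x := by
  have h1 : specialize p (-x) = specialize p x := by
    refine Polynomial.funext fun z => ?_
    rw [← polyVal_apply, ← polyVal_apply, h]
  have h2 := congrArg (fun q => Polynomial.coeff q n) h1
  simpa [specialize] using h2

theorem exists_comp_of_even {q : Polynomial ℤ}
    (h : ∀ x : ℂ, q.eval₂ (Int.castRingHom ℂ) (-x) = q.eval₂ (Int.castRingHom ℂ) x) :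
    ∃ r : Polynomial ℤ, r.comp (Polynomial.X ^ 2 - 4) = q := by
  have h1 : (q.map (Int.castRingHom ℂ)).comp (Polynomial.C (-1) * Polynomial.X) = q.map (Int.castRingHom ℂ) := by
    refine Polynomial.funext fun x => ?_
    simp only [Polynomial.eval_comp, Polynomial.eval_mul, Polynomial.eval_C, Polynomial.eval_X,
      Polynomial.eval_map, neg_one_mul]
    exact h x
  have hodd : ∀ n, ¬ 2 ∣ n → q.coeff n = 0 := by
    intro n hn
    have h2 := congrArg (fun q => Polynomial.coeff q n) h1
    have h3 : Odd n := by rwa [← Nat.not_even_iff_odd, even_iff_two_dvd]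
    simp only [Polynomial.comp_C_mul_X_coeff, h3.neg_one_pow, Polynomial.coeff_map] at h2
    have h4 : ((q.coeff n : ℤ) : ℂ) = 0 := by
      simp only [eq_intCast] at h2
      linear_combination -h2 / 2
    exact_mod_cast h4
  have h2 : Polynomial.expand ℤ 2 (Polynomial.contract 2 q) = q := by
    ext n
    rw [Polynomial.coeff_expand two_pos]
    split_ifs with hn
    · rw [Polynomial.coeff_contract two_ne_zero, Nat.div_mul_cancel hn]
    · exact (hodd n hn).symm
  -- `contract 2 q` is a polynomial in `x²`; the shift by `4` rewrites it in `x² - 4`.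
  refine ⟨(Polynomial.contract 2 q).comp (Polynomial.X + 4), ?_⟩
  rw [Polynomial.comp_assoc]
  nth_rewrite 2 [← h2]
  rw [Polynomial.expand_eq_comp_X_pow]
  congr 1
  simp

/-- The trace of a Möbius transformation is defined only up to sign, so a polynomial in `t` has to
be even before it can be written in `β = t² - 4`. -/
theorem exists_polyVal_of_even {p : Polynomial (Polynomial ℤ)}
    (h : ∀ x z, polyVal (-x) z p = polyVal x z p) :
    ∃ q : Polynomial (Polynomial ℤ), ∀ x z, polyVal (x ^ 2 - 4) z q = polyVal x z p := by
  have h1 : p ∈ Polynomial.lifts (Polynomial.compRingHom (Polynomial.X ^ 2 - 4 : Polynomial ℤ)) := by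
    rw [Polynomial.lifts_iff_coeff_lifts]
    intro n
    obtain ⟨r, hr⟩ := exists_comp_of_even (coeff_eval_neg_of_polyVal h n)
    exact ⟨r, hr⟩
  obtain ⟨q, hq⟩ := (Polynomial.mem_lifts _).mp h1
  refine ⟨q, fun x z => ?_⟩
  rw [← hq, polyVal, polyVal, Polynomial.coe_eval₂RingHom, Polynomial.coe_eval₂RingHom,
    Polynomial.eval₂_map]
  congr 1
  ext
  · simp
  · simp

/-- `Z` is a combination of `1`, `A`, `C`, `A C` with given coefficients. -/
def quatComb (A C : Matrix (Fin 2) (Fin 2) ℂ) (p : Fin 4 → ℂ) : Matrix (Fin 2) (Fin 2) ℂ :=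
  p 0 • 1 + p 1 • A + p 2 • C + p 3 • (A * C)

/-- The combinations of `1`, `A`, `C`, `A C` with coefficients integer polynomials in
`t = tr A = tr C` and `γ = tr (A C⁻¹) - 2`, as functions of `A`, `C`. -/
def IsQuatPoly (Z : Matrix.SpecialLinearGroup (Fin 2) ℂ → Matrix.SpecialLinearGroup (Fin 2) ℂ →
    Matrix (Fin 2) (Fin 2) ℂ) : Prop :=
  ∃ p : Fin 4 → Polynomial (Polynomial ℤ), ∀ A C : Matrix.SpecialLinearGroup (Fin 2) ℂ,
    A.1.trace = C.1.trace →
      Z A C = quatComb A.1 C.1 fun i => polyVal A.1.trace ((A * C⁻¹).1.trace - 2) (p i)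

theorem SL2_cases (A : Matrix.SpecialLinearGroup (Fin 2) ℂ) :
    ∃ a b c d : ℂ, A.1 = !![a, b; c, d] ∧ a * d - b * c = 1 := by
  refine ⟨_, _, _, _, Matrix.eta_fin_two A.1, ?_⟩
  rw [← Matrix.det_fin_two, A.2]

theorem SL2_inv_coe (A : Matrix.SpecialLinearGroup (Fin 2) ℂ) :
    (A⁻¹).1 = A.1.trace • 1 - A.1 := by
  have : (A⁻¹).1 = A.1.adjugate := Matrix.SpecialLinearGroup.coe_inv A
  rw [this, Matrix.adjugate_fin_two]
  ext i j
  fin_cases i <;> fin_cases j <;> simp [Matrix.trace_fin_two]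

theorem trace_mul_SL2_inv (A C : Matrix.SpecialLinearGroup (Fin 2) ℂ) :
    (A * C⁻¹).1.trace = A.1.trace * C.1.trace - (A * C).1.trace := by
  have h : (A * C⁻¹).1 = A.1 * (C⁻¹).1 := rfl
  have h' : (A * C).1 = A.1 * C.1 := rfl
  rw [h, h', SL2_inv_coe, mul_sub, Matrix.mul_smul, mul_one, Matrix.trace_sub, Matrix.trace_smul,
    smul_eq_mul, mul_comm]

/-- The relation `A C + C A = t (A + C) - (γ + 2)`. -/
theorem mul_swap_of_trace_eq (A C : Matrix.SpecialLinearGroup (Fin 2) ℂ)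
    (h : A.1.trace = C.1.trace) :
    C.1 * A.1 = A.1.trace • A.1 + A.1.trace • C.1 - (A * C⁻¹).1.trace • 1 - A.1 * C.1 := by
  rw [trace_mul_SL2_inv, ← h]
  have h' : (A * C).1 = A.1 * C.1 := rfl
  rw [h']
  obtain ⟨a, b, c, d, hA, hd⟩ := SL2_cases A
  obtain ⟨a', b', c', d', hC, hd'⟩ := SL2_cases C
  rw [hA, hC] at h ⊢
  simp only [Matrix.trace_fin_two_of] at h
  obtain rfl : d' = a + d - a' := by linear_combination -h
  ext i j
  fin_cases i <;> fin_cases j <;> simp [Matrix.trace_fin_two] <;> ring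

theorem IsQuatPoly.mul_left {Z} (hZ : IsQuatPoly Z) : IsQuatPoly fun A C => A.1 * Z A C := by
  obtain ⟨p, hp⟩ := hZ
  refine ⟨![-p 1, p 0 + Polynomial.C Polynomial.X * p 1, -p 3,
    p 2 + Polynomial.C Polynomial.X * p 3], fun A C h => ?_⟩
  simp only [hp A C h, quatComb, mul_add, Matrix.mul_smul, mul_one, ← mul_assoc,
    sq_eq_of_det_one A.1 A.2]
  simp only [sub_mul, Matrix.smul_mul, one_mul, Matrix.cons_val, map_neg, map_add, map_mul,
    polyVal_C_X]
  module

/-- Together with `mul_left`: the span of `1`, `A`, `C`, `A C` over `ℤ[t, γ]` is stable under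
multiplication by `A`, by Cayley–Hamilton and `mul_swap_of_trace_eq`. -/
theorem IsQuatPoly.mul_right {Z} (hZ : IsQuatPoly Z) : IsQuatPoly fun A C => Z A C * A.1 := by
  obtain ⟨p, hp⟩ := hZ
  refine ⟨![-p 1 - (Polynomial.X + 2) * p 2 - Polynomial.C Polynomial.X * p 3,
    p 0 + Polynomial.C Polynomial.X * p 1 + Polynomial.C Polynomial.X * p 2 +
      (Polynomial.C Polynomial.X ^ 2 - (Polynomial.X + 2)) * p 3,
    Polynomial.C Polynomial.X * p 2 + p 3, -p 2], fun A C h => ?_⟩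
  simp only [hp A C h, quatComb, add_mul, Matrix.smul_mul, one_mul, mul_assoc,
    mul_swap_of_trace_eq A C h]
  simp only [mul_sub, mul_add, Matrix.mul_smul, mul_one, ← mul_assoc, sq_eq_of_det_one A.1 A.2]
  simp only [sub_mul, Matrix.smul_mul, one_mul, Matrix.cons_val, map_neg, map_add, map_mul,
    map_sub, map_pow, polyVal_C_X, polyVal_X, map_ofNat]
  module

theorem IsQuatPoly.const_smul {Z} (hZ : IsQuatPoly Z) :
    IsQuatPoly fun A C => A.1.trace • Z A C := by
  obtain ⟨p, hp⟩ := hZ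
  refine ⟨fun i => Polynomial.C Polynomial.X * p i, fun A C h => ?_⟩
  simp only [hp A C h, quatComb, map_mul, polyVal_C_X]
  module

theorem IsQuatPoly.sub {Z Z'} (hZ : IsQuatPoly Z) (hZ' : IsQuatPoly Z') :
    IsQuatPoly fun A C => Z A C - Z' A C := by
  obtain ⟨p, hp⟩ := hZ
  obtain ⟨p', hp'⟩ := hZ'
  refine ⟨fun i => p i - p' i, fun A C h => ?_⟩
  simp only [hp A C h, hp' A C h, quatComb, map_sub]
  module

theorem IsQuatPoly.conj {Z} (hZ : IsQuatPoly Z) : IsQuatPoly fun A C => A.1 * Z A C * (A⁻¹).1 := by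
  have h := hZ.mul_left.const_smul.sub hZ.mul_left.mul_right
  refine ⟨h.choose, fun A C hAC => ?_⟩
  rw [← h.choose_spec A C hAC]
  beta_reduce
  rw [SL2_inv_coe, mul_sub, Matrix.mul_smul, mul_one]

theorem IsQuatPoly.conj_inv {Z} (hZ : IsQuatPoly Z) :
    IsQuatPoly fun A C => (A⁻¹).1 * Z A C * A.1 := by
  have h := hZ.mul_right.const_smul.sub hZ.mul_left.mul_right
  refine ⟨h.choose, fun A C hAC => ?_⟩
  rw [← h.choose_spec A C hAC]
  beta_reduce
  rw [SL2_inv_coe, sub_mul, Matrix.smul_mul, one_mul, sub_mul,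
    Matrix.smul_mul]

theorem SL2_mul_coe {R : Type*} [CommRing R] (A B : Matrix.SpecialLinearGroup (Fin 2) R) :
    (A * B).1 = A.1 * B.1 := rfl

theorem SL2_coe_congr {R : Type*} [CommRing R] {A B : Matrix.SpecialLinearGroup (Fin 2) R}
    (h : A = B) : A.1 = B.1 := by rw [h]

theorem IsQuatPoly.conj_zpow {Z} (hZ : IsQuatPoly Z) (r : ℤ) :
    IsQuatPoly fun A C => (A ^ r).1 * Z A C * (A ^ (-r)).1 := by
  induction r using Int.induction_on with
  | zero => simpa using hZ
  | succ n ih =>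
    have h := ih.conj
    refine ⟨h.choose, fun A C hAC => ?_⟩
    rw [← h.choose_spec A C hAC]
    beta_reduce
    have h1 : A ^ ((n : ℤ) + 1) = A * A ^ (n : ℤ) := by rw [add_comm, zpow_one_add]
    have h2 : A ^ (-((n : ℤ) + 1)) = A ^ (-(n : ℤ)) * A⁻¹ := by
      rw [← zpow_sub_one]; congr 1; ring
    rw [h1, h2, SL2_mul_coe, SL2_mul_coe]
    simp only [mul_assoc]
  | pred n ih =>
    have h := ih.conj_inv
    refine ⟨h.choose, fun A C hAC => ?_⟩
    rw [← h.choose_spec A C hAC]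
    beta_reduce
    have h1 : A ^ (-(n : ℤ) - 1) = A⁻¹ * A ^ (-(n : ℤ)) := by
      rw [← zpow_neg_one, ← zpow_add]; congr 1; ring
    have h2 : A ^ (-(-(n : ℤ) - 1)) = A ^ (- -(n : ℤ)) * A := by
      rw [← zpow_add_one]; congr 1; ring
    rw [h1, h2, SL2_mul_coe, SL2_mul_coe]
    simp only [mul_assoc]

theorem gammaSL_eq (A B : Matrix.SpecialLinearGroup (Fin 2) ℂ) :
    gammaSL A B = (A * (B * A * B⁻¹)⁻¹).1.trace - 2 := by
  have : A * (B * A * B⁻¹)⁻¹ = A * B * A⁻¹ * B⁻¹ := by group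
  rw [this, gammaSL]

theorem trace_conj_SL2 (A B : Matrix.SpecialLinearGroup (Fin 2) ℂ) :
    (B * A * B⁻¹).1.trace = A.1.trace := by
  rw [SL2_mul_coe, Matrix.trace_mul_comm, ← SL2_mul_coe]
  rw [show B⁻¹ * (B * A) = A by group]

theorem trace_inv_SL2 (A : Matrix.SpecialLinearGroup (Fin 2) ℂ) :
    (A⁻¹).1.trace = A.1.trace := by
  have := trace_mul_SL2_inv 1 A
  simp only [one_mul] at this
  rw [this]
  simp [Matrix.trace_one]
  ring

theorem gammaSL_inv_right (A B : Matrix.SpecialLinearGroup (Fin 2) ℂ) :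
    gammaSL A B⁻¹ = gammaSL A B := by
  rw [gammaSL, gammaSL, ← trace_inv_SL2 (A * B * A⁻¹ * B⁻¹), ← trace_conj_SL2 _ B]
  rw [show B * (A * B⁻¹ * A⁻¹ * B⁻¹⁻¹) * B⁻¹ = (A * B * A⁻¹ * B⁻¹)⁻¹ by group]

/-- The good-word conjugate `W A W⁻¹` is an integral combination of `1`, `A`, `C`, `A C`. -/
theorem exists_quatComb_altProd (rs : List ℤ) (s : ℤ) (hs : s = 1 ∨ s = -1) :
    ∃ p : Fin 4 → Polynomial (Polynomial ℤ), ∀ A B : Matrix.SpecialLinearGroup (Fin 2) ℂ,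
      (altProd A B s rs * A * (altProd A B s rs)⁻¹).1 =
        quatComb A.1 (B ^ s * A * (B ^ s)⁻¹).1 fun i => polyVal A.1.trace (gammaSL A B) (p i) := by
  induction rs generalizing s with
  | nil =>
    refine ⟨![0, 0, 1, 0], fun A B => ?_⟩
    simp [quatComb, altProd]
  | cons r rs ih =>
    obtain ⟨p, hp⟩ := ih (-s) (by rcases hs with rfl | rfl <;> simp)
    have h1 : IsQuatPoly fun A C => quatComb A.1 C.1 fun i =>
      polyVal A.1.trace ((A * C⁻¹).1.trace - 2) (p i) := ⟨p, fun _ _ _ => rfl⟩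
    obtain ⟨q, hq⟩ := h1.conj_zpow r
    have hswap : ∃ q' : Fin 4 → Polynomial (Polynomial ℤ),
        ∀ A C : Matrix.SpecialLinearGroup (Fin 2) ℂ, A.1.trace = C.1.trace →
        quatComb C.1 A.1 (fun i => polyVal A.1.trace ((A * C⁻¹).1.trace - 2) (q i)) =
        quatComb A.1 C.1 (fun i => polyVal A.1.trace ((A * C⁻¹).1.trace - 2) (q' i)) := by
      refine ⟨![q 0 - (Polynomial.X + 2) * q 3, q 2 + Polynomial.C Polynomial.X * q 3,
        q 1 + Polynomial.C Polynomial.X * q 3, - q 3], fun A C h => ?_⟩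
      simp only [quatComb, mul_swap_of_trace_eq A C h, Matrix.cons_val, map_neg, map_add, map_mul,
        map_sub, polyVal_C_X, polyVal_X, map_ofNat]
      module
    obtain ⟨q', hq'⟩ := hswap
    refine ⟨q', fun A B => ?_⟩
    have hg : ∀ s : ℤ, s = 1 ∨ s = -1 → (A * (B ^ s * A * (B ^ s)⁻¹)⁻¹).1.trace - 2 = gammaSL A B := by
      rintro s (rfl | rfl)
      · rw [zpow_one, gammaSL_eq]
      · rw [zpow_neg_one, ← gammaSL_eq, gammaSL_inv_right]
    have ht := fun s : ℤ => trace_conj_SL2 A (B ^ s)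
    set C := B ^ s * A * (B ^ s)⁻¹ with hC
    set C' := B ^ (-s) * A * (B ^ (-s))⁻¹ with hC'
    have h2 := hq' A C (ht s).symm
    rw [hg s hs] at h2
    rw [← h2]
    have h3 := hq A C' (ht (-s)).symm
    have hgs : (A * C'⁻¹).1.trace - 2 = gammaSL A B :=
      hg (-s) (by rcases hs with rfl | rfl <;> simp)
    beta_reduce at h3
    rw [hgs, ← hp A B] at h3
    -- The alternation of signs matters here: conjugation by `B ^ s` carries `(A, C')`, where `C' =
    -- B ^ (-s) A B ^ s`, to `(C, A)`, so the combination stays in the span for the single pair `A`,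
    -- `C`.
    have h4 : (altProd A B s (r :: rs) * A * (altProd A B s (r :: rs))⁻¹).1 =
        (B ^ s).1 * ((A ^ r).1 * (altProd A B (-s) rs * A * (altProd A B (-s) rs)⁻¹).1 *
          (A ^ (-r)).1) * ((B ^ s)⁻¹).1 := by
      simp only [← SL2_mul_coe]
      refine SL2_coe_congr ?_
      rw [altProd]; group
    rw [h4, h3]
    have h5 : (B ^ s).1 * A.1 * ((B ^ s)⁻¹).1 = C.1 := rfl
    have h6 : (B ^ s).1 * C'.1 * ((B ^ s)⁻¹).1 = A.1 := by
      simp only [← SL2_mul_coe]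
      refine SL2_coe_congr ?_
      rw [hC']; group
    have h7 : (B ^ s).1 * ((B ^ s)⁻¹).1 = 1 := by
      rw [← SL2_mul_coe, mul_inv_cancel]; rfl
    have h7' : ((B ^ s)⁻¹).1 * (B ^ s).1 = 1 := by
      rw [← SL2_mul_coe, inv_mul_cancel]; rfl
    have h8 : (B ^ s).1 * (A.1 * C'.1) * ((B ^ s)⁻¹).1 = C.1 * A.1 := by
      rw [← h5]
      nth_rewrite 3 [← h6]
      simp only [mul_assoc]
      rw [← mul_assoc _ (B ^ s).1, h7', one_mul]
    simp only [quatComb, mul_add, add_mul, Matrix.mul_smul, Matrix.smul_mul, mul_one, h5, h6, h7,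
      h8]

/-- `γ(A, W) = t² - 2 - tr(A · W A W⁻¹)`, and `W A W⁻¹` is known from `exists_quatComb_altProd`. -/
theorem exists_polyVal_gammaSL_altProd (rs : List ℤ) (s : ℤ) (hs : s = 1 ∨ s = -1) :
    ∃ p : Polynomial (Polynomial ℤ), ∀ A B : Matrix.SpecialLinearGroup (Fin 2) ℂ,
      gammaSL A (altProd A B s rs) = polyVal A.1.trace (gammaSL A B) p := by
  obtain ⟨p, hp⟩ := exists_quatComb_altProd rs s hs
  refine ⟨Polynomial.C Polynomial.X ^ 2 - 2 - (Polynomial.C Polynomial.X * p 0 +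
    (Polynomial.C Polynomial.X ^ 2 - 2) * p 1 +
    (Polynomial.C Polynomial.X ^ 2 - (Polynomial.X + 2)) * p 2 +
    ((Polynomial.C Polynomial.X ^ 2 - (Polynomial.X + 2)) * Polynomial.C Polynomial.X
      - Polynomial.C Polynomial.X) * p 3), fun A B => ?_⟩
  have ht := trace_conj_SL2 A (B ^ s)
  have hg : (A * (B ^ s * A * (B ^ s)⁻¹)⁻¹).1.trace - 2 = gammaSL A B := by
    rcases hs with rfl | rfl
    · rw [zpow_one, gammaSL_eq]
    · rw [zpow_neg_one, ← gammaSL_eq, gammaSL_inv_right]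
  rw [gammaSL_eq, trace_mul_SL2_inv, trace_conj_SL2, SL2_mul_coe A, hp]
  set C := B ^ s * A * (B ^ s)⁻¹ with hC
  rw [trace_mul_SL2_inv, ht, SL2_mul_coe] at hg
  simp only [quatComb, mul_add, Matrix.mul_smul, mul_one, ← mul_assoc, sq_eq_of_det_one A.1 A.2]
  simp only [sub_mul, Matrix.smul_mul, one_mul, Matrix.trace_add, Matrix.trace_sub,
    Matrix.trace_smul, Matrix.trace_one, ht, smul_eq_mul, Fintype.card_fin, map_add,
    map_mul, map_sub, map_pow, polyVal_C_X, polyVal_X, map_ofNat]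
  generalize polyVal A.1.trace (gammaSL A B) (p 2) = y2
  generalize polyVal A.1.trace (gammaSL A B) (p 3) = y3
  push_cast
  linear_combination (y2 + A.1.trace * y3) * hg

/-- `upperMat` as an element of `SL₂`. -/
def upperSL {R : Type*} [CommRing R] {l m : R} (h : l * m = 1) (c : R) :
    Matrix.SpecialLinearGroup (Fin 2) R :=
  ⟨upperMat l m c, by rw [upperMat, Matrix.det_fin_two_of, h]; ring⟩

/-- `turnMat` as an element of `SL₂`. -/
def turnSL (R : Type*) [CommRing R] : Matrix.SpecialLinearGroup (Fin 2) R :=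
  ⟨turnMat R, by rw [turnMat, Matrix.det_fin_two_of]; ring⟩

theorem upperSL_inv_coe {R : Type*} [CommRing R] {l m : R} (h : l * m = 1) (c : R) :
    ((upperSL h c)⁻¹).1 = upperMat m l (-c) := by
  have : ((upperSL h c)⁻¹).1 = (upperMat l m c).adjugate := Matrix.SpecialLinearGroup.coe_inv _
  rw [this, Matrix.adjugate_fin_two]
  simp [upperMat]

theorem turnSL_inv_coe (R : Type*) [CommRing R] : ((turnSL R)⁻¹).1 = turnMatInv R := by
  have : ((turnSL R)⁻¹).1 = (turnMat R).adjugate := Matrix.SpecialLinearGroup.coe_inv _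
  rw [this, Matrix.adjugate_fin_two]
  simp [turnMat, turnMatInv]

/-- `γ` of an upper triangular matrix and an arbitrary one. -/
theorem gammaSL_upperSL {l m : ℂ} (h : l * m = 1) (c : ℂ)
    (W : Matrix.SpecialLinearGroup (Fin 2) ℂ) :
    gammaSL (upperSL h c) W = W.1 1 0 * (c ^ 2 * W.1 1 0 + c * (l - m) * (W.1 0 0 - W.1 1 1)
      - (l - m) ^ 2 * W.1 0 1) := by
  obtain ⟨p, q, r, s, hW, hd⟩ := SL2_cases W
  have h1 : (W⁻¹).1 = !![s, -q; -r, p] := by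
    have : (W⁻¹).1 = W.1.adjugate := Matrix.SpecialLinearGroup.coe_inv W
    rw [this, hW, Matrix.adjugate_fin_two]
    simp
  rw [gammaSL, SL2_mul_coe, SL2_mul_coe, SL2_mul_coe, h1, upperSL_inv_coe, hW]
  simp [upperSL, upperMat, Matrix.trace_fin_two]
  linear_combination (2 * p * s - 2 * q * r) * h + 2 * hd

theorem gammaSL_upperSL_turnSL {l m : ℂ} (h : l * m = 1) (c : ℂ) :
    gammaSL (upperSL h c) (turnSL ℂ) = (l - m) ^ 2 + c ^ 2 := by
  rw [gammaSL_upperSL]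
  simp [turnSL, turnMat]
  ring

theorem exists_add_eq_mul_eq_one (t : ℂ) : ∃ l m : ℂ, l * m = 1 ∧ l + m = t := by
  obtain ⟨s, hs⟩ := IsAlgClosed.exists_pow_nat_eq (t ^ 2 - 4) two_pos
  exact ⟨(t + s) / 2, (t - s) / 2, by linear_combination -hs / 4, by ring⟩

/-- Since all pairs `(t, γ)` occur, evenness can be tested on matrices. -/
theorem exists_SL2_pair (t z : ℂ) : ∃ A B : Matrix.SpecialLinearGroup (Fin 2) ℂ,
    A.1.trace = t ∧ gammaSL A B = z := by
  obtain ⟨l, m, h, rfl⟩ := exists_add_eq_mul_eq_one t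
  obtain ⟨c, hc⟩ := IsAlgClosed.exists_pow_nat_eq (z - (l - m) ^ 2) two_pos
  refine ⟨upperSL h c, turnSL ℂ, ?_, ?_⟩
  · simp [upperSL, upperMat, Matrix.trace_fin_two]
  · rw [gammaSL_upperSL_turnSL, hc]; ring

theorem exists_tracePolynomial_altProd (rs : List ℤ) (s : ℤ) (hs : s = 1 ∨ s = -1) :
    ∃ p : Polynomial (Polynomial ℤ),
      IsTracePolynomial (altProd (FreeGroup.of 0) (FreeGroup.of 1) s rs) p := by
  -- Replacing `A` by `-A` flips `t` but changes neither `γ(A, B)` nor `γ(A, w(A, B))`, so `p` is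
  -- even in `t`.
  obtain ⟨p, hp⟩ := exists_polyVal_gammaSL_altProd rs s hs
  obtain ⟨q, hq⟩ := exists_polyVal_of_even (p := p) (by
    intro t z
    obtain ⟨A, B, rfl, rfl⟩ := exists_SL2_pair t z
    have hcen : A⁻¹ * (-A) ∈ Subgroup.center (Matrix.SpecialLinearGroup (Fin 2) ℂ) := by
      refine Matrix.SpecialLinearGroup.mem_center_iff.mpr ⟨-1, by norm_num, ?_⟩
      rw [mul_neg, inv_mul_cancel]
      ext i j
      fin_cases i <;> fin_cases j <;> simp
    have h1 := hp (-A) B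
    have h2 := gammaSL_congr hcen (B := B) (B' := B) (by rw [inv_mul_cancel]; exact one_mem _)
    have h3 : gammaSL A (altProd A B s rs) = gammaSL (-A) (altProd (-A) B s rs) := by
      refine gammaSL_congr hcen ?_
      have h4 := fun A => map_altProd (QuotientGroup.mk' (Subgroup.center
        (Matrix.SpecialLinearGroup (Fin 2) ℂ))) A B s rs
      refine QuotientGroup.eq.mp ?_
      have h5 : (QuotientGroup.mk' (Subgroup.center
        (Matrix.SpecialLinearGroup (Fin 2) ℂ))) A = QuotientGroup.mk' _ (-A) :=
        QuotientGroup.eq.mpr hcen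
      exact (h4 A).trans (by rw [h5, ← h4]; rfl)
    rw [← h3, hp A B, ← h2] at h1
    rw [h1]
    congr 2
    simp)
  refine ⟨q, fun f g => ?_⟩
  obtain ⟨A, rfl⟩ := QuotientGroup.mk_surjective f
  obtain ⟨B, rfl⟩ := QuotientGroup.mk_surjective g
  rw [evalWord_altProd]
  have h1 := map_altProd (QuotientGroup.mk' (Subgroup.center
    (Matrix.SpecialLinearGroup (Fin 2) ℂ))) A B s rs
  have h2 : altProd (QuotientGroup.mk A : Moebius) (QuotientGroup.mk B) s rs =
    QuotientGroup.mk (altProd A B s rs) := h1.symm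
  rw [h2, ← polyVal_apply]
  exact (hp A B).trans (hq _ _).symm

end TraceRoots

/-! ### Reduced words and the one-parameter family of standard pairs. -/

namespace TraceRoots

open Polynomial

theorem altProd_neg {K : Type*} [Group K] {a b : K} (hb : b * b = 1) (s : ℤ) (rs : List ℤ) :
    altProd a b (-s) rs = altProd a b s rs := by
  have hb' : b⁻¹ = b := inv_eq_of_mul_eq_one_left hb
  have h : ∀ s : ℤ, b ^ (-s) = b ^ s := fun s => by rw [zpow_neg, ← inv_zpow, hb']
  induction rs generalizing s with
  | nil => exact h s
  | cons r rs ih => rw [altProd, altProd, h, ih]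

/-- In a group generated by `a` and an involution `b`, every element that is not a power of `a` is
a reduced alternating product, up to powers of `a` at both ends. -/
theorem exists_reduced_form {K : Type*} [Group K] {a b : K} (hb : b * b = 1) {x : K}
    (hx : x ∈ Subgroup.closure ({a, b} : Set K)) :
    (∃ r : ℤ, x = a ^ r) ∨ ∃ (r r' : ℤ) (rs : List ℤ), (∀ i ∈ rs, a ^ i ≠ 1) ∧
      x = a ^ r * altProd a b 1 rs * a ^ r' := by
  have hb' : b⁻¹ = b := inv_eq_of_mul_eq_one_left hb
  have hA : ∀ (k : ℤ) (y : K), ((∃ r : ℤ, y = a ^ r) ∨ ∃ (r r' : ℤ) (rs : List ℤ),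
      (∀ i ∈ rs, a ^ i ≠ 1) ∧ y = a ^ r * altProd a b 1 rs * a ^ r') →
      ((∃ r : ℤ, a ^ k * y = a ^ r) ∨ ∃ (r r' : ℤ) (rs : List ℤ),
      (∀ i ∈ rs, a ^ i ≠ 1) ∧ a ^ k * y = a ^ r * altProd a b 1 rs * a ^ r') := by
    rintro k y (⟨r, rfl⟩ | ⟨r, r', rs, hrs, rfl⟩)
    · exact Or.inl ⟨k + r, (zpow_add a k r).symm⟩
    · exact Or.inr ⟨k + r, r', rs, hrs, by rw [zpow_add, mul_assoc, mul_assoc, mul_assoc]⟩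
  have hB : ∀ y : K, ((∃ r : ℤ, y = a ^ r) ∨ ∃ (r r' : ℤ) (rs : List ℤ),
      (∀ i ∈ rs, a ^ i ≠ 1) ∧ y = a ^ r * altProd a b 1 rs * a ^ r') →
      ((∃ r : ℤ, b * y = a ^ r) ∨ ∃ (r r' : ℤ) (rs : List ℤ),
      (∀ i ∈ rs, a ^ i ≠ 1) ∧ b * y = a ^ r * altProd a b 1 rs * a ^ r') := by
    rintro y (⟨r, rfl⟩ | ⟨r, r', rs, hrs, rfl⟩)
    · exact Or.inr ⟨0, r, [], by simp, by simp [altProd]⟩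
    · by_cases hr : a ^ r = 1
      · rw [hr, one_mul]
        cases rs with
        | nil =>
          refine Or.inl ⟨r', ?_⟩
          rw [altProd, zpow_one, ← mul_assoc, hb, one_mul]
        | cons i rs =>
          refine Or.inr ⟨i, r', rs, fun j hj => hrs j (List.mem_cons_of_mem _ hj), ?_⟩
          rw [altProd, zpow_one, altProd_neg hb]
          simp only [← mul_assoc]
          rw [hb, one_mul]
      · refine Or.inr ⟨0, r', r :: rs, ?_, ?_⟩
        · intro i hi
          rcases List.mem_cons.mp hi with rfl | hi
          · exact hr
          · exact hrs i hi
        · rw [altProd, zpow_one, altProd_neg hb, zpow_zero, one_mul]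
          simp only [mul_assoc]
  induction hx using Subgroup.closure_induction_left with
  | one => exact Or.inl ⟨0, (zpow_zero a).symm⟩
  | mul_left g hg y hy ih =>
    rcases hg with rfl | hg
    · simpa using hA 1 y ih
    · rw [Set.mem_singleton_iff.mp hg]; exact hB y ih
  | inv_mul_cancel g hg y hy ih =>
    rcases hg with rfl | hg
    · simpa using hA (-1) y ih
    · rw [Set.mem_singleton_iff.mp hg, hb']; exact hB y ih

section Family

variable {l m : ℂ} (h : l * m = 1)

theorem C_mul_C_eq_one {l m : ℂ} (h : l * m = 1) : (C l : ℂ[X]) * C m = 1 := by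
  rw [← C_mul, h, C_1]

/-- The generic matrix `[[l, X], [0, m]]`. -/
noncomputable def polyUpper {l m : ℂ} (h : l * m = 1) : Matrix.SpecialLinearGroup (Fin 2) ℂ[X] :=
  upperSL (C_mul_C_eq_one h) X

/-- Evaluation at `c` of matrices of polynomials. -/
noncomputable def evalSL (c : ℂ) :
    Matrix.SpecialLinearGroup (Fin 2) ℂ[X] →* Matrix.SpecialLinearGroup (Fin 2) ℂ :=
  Matrix.SpecialLinearGroup.map (evalRingHom c)

theorem evalSL_apply (c : ℂ) (W : Matrix.SpecialLinearGroup (Fin 2) ℂ[X]) (i j : Fin 2) :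
    (evalSL c W).1 i j = (W.1 i j).eval c := rfl

theorem evalSL_polyUpper (c : ℂ) : evalSL c (polyUpper h) = upperSL h c := by
  refine Subtype.ext ?_
  ext i j
  rw [evalSL_apply]
  fin_cases i <;> fin_cases j <;> simp [polyUpper, upperSL, upperMat]

theorem evalSL_turnSL (c : ℂ) : evalSL c (turnSL ℂ[X]) = turnSL ℂ := by
  refine Subtype.ext ?_
  ext i j
  rw [evalSL_apply]
  fin_cases i <;> fin_cases j <;> simp [turnSL, turnMat]

/-- The relation for `U` is free of division so that `l = m` is allowed. -/
theorem polyUpper_zpow (r : ℤ) : ∃ U : ℂ, U * (l - m) = l ^ r - m ^ r ∧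
    (polyUpper h ^ r).1 = !![C (l ^ r), C U * X; 0, C (m ^ r)] := by
  have hl : l ≠ 0 := left_ne_zero_of_mul_eq_one h
  have hm : m ≠ 0 := right_ne_zero_of_mul_eq_one h
  induction r using Int.induction_on with
  | zero =>
    refine ⟨0, by simp, ?_⟩
    refine Matrix.ext fun i j => ?_
    fin_cases i <;> fin_cases j <;> simp
  | succ n ih =>
    obtain ⟨U, hU, hA⟩ := ih
    refine ⟨l ^ (n : ℤ) + U * m, ?_, ?_⟩
    · rw [zpow_add_one₀ hl, zpow_add_one₀ hm]
      linear_combination m * hU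
    · rw [zpow_add_one, SL2_mul_coe, hA, zpow_add_one₀ hl, zpow_add_one₀ hm]
      refine Matrix.ext fun i j => ?_
      fin_cases i <;> fin_cases j <;> simp [polyUpper, upperSL, upperMat]
      ring
  | pred n ih =>
    obtain ⟨U, hU, hA⟩ := ih
    have e1 : l ^ (-(n : ℤ) - 1) = l ^ (-(n : ℤ)) * m := by
      rw [zpow_sub_one₀ hl, eq_inv_of_mul_eq_one_right h]
    have e2 : m ^ (-(n : ℤ) - 1) = m ^ (-(n : ℤ)) * l := by
      rw [zpow_sub_one₀ hm, eq_inv_of_mul_eq_one_left h]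
    refine ⟨U * l - l ^ (-(n : ℤ)), ?_, ?_⟩
    · rw [e1, e2]
      linear_combination l * hU
    · rw [zpow_sub_one, SL2_mul_coe, hA, e1, e2, polyUpper, upperSL_inv_coe]
      refine Matrix.ext fun i j => ?_
      fin_cases i <;> fin_cases j <;> simp [upperMat]
      ring

theorem polyUpper_zpow_of_not_mem_center {r : ℤ}
    (hr : polyUpper h ^ r ∉ Subgroup.center (Matrix.SpecialLinearGroup (Fin 2) ℂ[X])) :
    ∃ U : ℂ, U ≠ 0 ∧ (polyUpper h ^ r).1 = !![C (l ^ r), C U * X; 0, C (m ^ r)] := by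
  obtain ⟨U, hU, hA⟩ := polyUpper_zpow h r
  refine ⟨U, ?_, hA⟩
  rintro rfl
  rw [zero_mul] at hU
  apply hr
  have h1 : l ^ r = m ^ r := by linear_combination -hU
  have h2 : l ^ r * m ^ r = 1 := by rw [← mul_zpow, h, one_zpow]
  refine Matrix.SpecialLinearGroup.mem_center_iff.mpr ⟨C (l ^ r), ?_, ?_⟩
  · rw [Fintype.card_fin, sq]
    nth_rewrite 2 [h1]
    rw [← C_mul, h2, C_1]
  · rw [hA, ← h1]
    refine Matrix.ext fun i j => ?_
    fin_cases i <;> fin_cases j <;> simp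

theorem upperSL_zpow_mem_center {r : ℤ} (c : ℂ)
    (hr : polyUpper h ^ r ∈ Subgroup.center (Matrix.SpecialLinearGroup (Fin 2) ℂ[X])) :
    upperSL h c ^ r ∈ Subgroup.center (Matrix.SpecialLinearGroup (Fin 2) ℂ) := by
  obtain ⟨p, hp, hA⟩ := Matrix.SpecialLinearGroup.mem_center_iff.mp hr
  refine Matrix.SpecialLinearGroup.mem_center_iff.mpr ⟨p.eval c, ?_, ?_⟩
  · rw [← eval_pow, hp, eval_one]
  · rw [← evalSL_polyUpper, ← map_zpow]
    ext i j
    rw [evalSL_apply, ← hA]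
    fin_cases i <;> fin_cases j <;> simp

/-- The exponents of a reduced word in the generic matrix. -/
def IsReduced (rs : List ℤ) : Prop :=
  ∀ r ∈ rs, polyUpper h ^ r ∉ Subgroup.center (Matrix.SpecialLinearGroup (Fin 2) ℂ[X])

/-- Each further exponent `r` multiplies the top coefficient of the lower left entry by `±U`, which
is nonzero because the generic `A ^ r` is not central. -/
theorem altProd_polyUpper_degree {rs : List ℤ} (hrs : IsReduced h rs) {s : ℤ}
    (hs : s = 1 ∨ s = -1) :
    ((altProd (polyUpper h) (turnSL ℂ[X]) s rs).1 1 0).coeff rs.length ≠ 0 ∧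
    ∀ i j, ((altProd (polyUpper h) (turnSL ℂ[X]) s rs).1 i j).natDegree ≤ rs.length := by
  induction rs generalizing s with
  | nil =>
    rw [altProd]
    rcases hs with rfl | rfl
    · rw [zpow_one]
      refine ⟨by simp [turnSL, turnMat], fun i j => ?_⟩
      fin_cases i <;> fin_cases j <;> simp [turnSL, turnMat]
    · rw [zpow_neg_one, turnSL_inv_coe]
      refine ⟨by simp [turnMatInv], fun i j => ?_⟩
      fin_cases i <;> fin_cases j <;> simp [turnMatInv]
  | cons r rs ih =>
    obtain ⟨h1, h2⟩ := ih (fun i hi => hrs i (List.mem_cons_of_mem _ hi)) (s := -s)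
      (by rcases hs with rfl | rfl <;> simp)
    obtain ⟨U, hU, hA⟩ := polyUpper_zpow_of_not_mem_center h (hrs r List.mem_cons_self)
    rw [altProd, SL2_mul_coe, SL2_mul_coe, hA]
    set V := (altProd (polyUpper h) (turnSL ℂ[X]) (-s) rs).1
    obtain ⟨e, he, hJ⟩ : ∃ e : ℂ, e ≠ 0 ∧ (turnSL ℂ[X] ^ s).1 = !![0, -C e; C e, 0] := by
      rcases hs with rfl | rfl
      · exact ⟨1, one_ne_zero, by rw [zpow_one]; simp [turnSL, turnMat]⟩
      · exact ⟨-1, neg_ne_zero.mpr one_ne_zero, by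
          rw [zpow_neg_one, turnSL_inv_coe]; simp [turnMatInv]⟩
    have hlow : ∀ j, natDegree (C (e * l ^ r) * V 0 j + C (e * U) * X * V 1 j) ≤ rs.length + 1 := by
      intro j
      refine natDegree_add_le_of_degree_le ?_ ?_
      · exact (natDegree_C_mul_le _ _).trans ((h2 0 j).trans (Nat.le_succ _))
      · refine natDegree_mul_le.trans ?_
        have : natDegree (C (e * U) * X : ℂ[X]) ≤ 1 :=
          (natDegree_C_mul_le _ _).trans natDegree_X_le
        have := h2 1 j
        omega
    have hup : ∀ j, natDegree (-(C (e * m ^ r) * V 1 j)) ≤ rs.length + 1 := by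
      intro j
      rw [natDegree_neg]
      exact (natDegree_C_mul_le _ _).trans ((h2 1 j).trans (Nat.le_succ _))
    have hprod : !![0, -C e; C e, 0] * !![C (l ^ r), C U * X; 0, C (m ^ r)] * V =
        !![-(C (e * m ^ r) * V 1 0), -(C (e * m ^ r) * V 1 1);
          C (e * l ^ r) * V 0 0 + C (e * U) * X * V 1 0,
          C (e * l ^ r) * V 0 1 + C (e * U) * X * V 1 1] := by
      rw [Matrix.eta_fin_two V]
      refine Matrix.ext fun i j => ?_
      fin_cases i <;> fin_cases j <;> simp [-map_zpow₀, -mul_eq_mul_right_iff] <;> ring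
    rw [hJ, hprod, List.length_cons]
    refine ⟨?_, fun i j => ?_⟩
    · have h3 : (V 0 0).coeff (rs.length + 1) = 0 :=
        coeff_eq_zero_of_natDegree_lt (Nat.lt_succ_of_le (h2 0 0))
      have h4 : (C (e * l ^ r) * V 0 0 + C (e * U) * X * V 1 0).coeff (rs.length + 1) =
          e * U * (V 1 0).coeff rs.length := by
        rw [coeff_add, coeff_C_mul, h3, mul_zero, zero_add, mul_assoc, coeff_C_mul, coeff_X_mul]
      simp only [Matrix.of_apply, Matrix.cons_val_one, Matrix.cons_val_zero]
      rw [h4]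
      exact mul_ne_zero (mul_ne_zero he hU) h1
    · fin_cases i <;> fin_cases j
      · exact hup 0
      · exact hup 1
      · exact hlow 0
      · exact hlow 1

/-- `γ` of the generic matrix and another matrix of polynomials. -/
noncomputable def gammaPoly (l m : ℂ) (W : Matrix.SpecialLinearGroup (Fin 2) ℂ[X]) : ℂ[X] :=
  W.1 1 0 * (X ^ 2 * W.1 1 0 + (C (l - m) * (W.1 0 0 - W.1 1 1)) * X - C ((l - m) ^ 2) * W.1 0 1)

theorem eval_gammaPoly (W : Matrix.SpecialLinearGroup (Fin 2) ℂ[X]) (c : ℂ) :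
    (gammaPoly l m W).eval c = gammaSL (upperSL h c) (evalSL c W) := by
  rw [gammaSL_upperSL, gammaPoly]
  simp only [evalSL_apply, eval_mul, eval_add, eval_sub, eval_pow, eval_X, eval_C]
  ring

/-- With `n` exponents, the second factor has a nonzero coefficient in degree `n + 2`: it comes from
`X² W₁₀`, the other terms having degree at most `n + 1`. -/
theorem gammaPoly_altProd_ne_zero {rs : List ℤ} (hrs : IsReduced h rs) :
    gammaPoly l m (altProd (polyUpper h) (turnSL ℂ[X]) 1 rs) ≠ 0 := by
  obtain ⟨h1, h2⟩ := altProd_polyUpper_degree h hrs (Or.inl rfl)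
  rw [gammaPoly]
  set V := (altProd (polyUpper h) (turnSL ℂ[X]) 1 rs).1
  refine mul_ne_zero (fun h0 => h1 (by rw [h0, coeff_zero])) (fun h0 => h1 ?_)
  have h3 := congrArg (fun p => coeff p (rs.length + 2)) h0
  simp only [coeff_zero, coeff_sub, coeff_add] at h3
  rw [coeff_X_pow_mul, coeff_mul_X, coeff_C_mul, coeff_C_mul, coeff_sub,
    coeff_eq_zero_of_natDegree_lt (lt_of_le_of_lt (h2 0 0) (Nat.lt_succ_self _)),
    coeff_eq_zero_of_natDegree_lt (lt_of_le_of_lt (h2 1 1) (Nat.lt_succ_self _)),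
    coeff_eq_zero_of_natDegree_lt (lt_of_le_of_lt (h2 0 1) (by omega))] at h3
  simpa using h3

theorem beta_upperSL (c : ℂ) : beta (QuotientGroup.mk (upperSL h c)) = (l - m) ^ 2 := by
  rw [beta_mk]
  simp [upperSL, upperMat, Matrix.trace_fin_two]
  linear_combination (4 : ℂ) * h

theorem mk_altProd (A B : Matrix.SpecialLinearGroup (Fin 2) ℂ) (s : ℤ) (rs : List ℤ) :
    altProd (QuotientGroup.mk A : Moebius) (QuotientGroup.mk B) s rs =
    QuotientGroup.mk (altProd A B s rs) :=
  (map_altProd (QuotientGroup.mk' (Subgroup.center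
    (Matrix.SpecialLinearGroup (Fin 2) ℂ))) A B s rs).symm

theorem eval_specialize_eq_gammaPoly {rs : List ℤ} {p : Polynomial (Polynomial ℤ)}
    (hp : IsTracePolynomial (altProd (FreeGroup.of 0) (FreeGroup.of 1) 1 rs) p) (c : ℂ) :
    (specialize p ((l - m) ^ 2)).eval ((l - m) ^ 2 + c ^ 2) =
      (gammaPoly l m (altProd (polyUpper h) (turnSL ℂ[X]) 1 rs)).eval c := by
  have h1 := hp (QuotientGroup.mk (upperSL h c)) (QuotientGroup.mk (turnSL ℂ))
  rw [beta_upperSL, evalWord_altProd, mk_altProd] at h1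
  rw [eval_gammaPoly h, map_altProd, evalSL_polyUpper, evalSL_turnSL, ← gammaSL_upperSL_turnSL h]
  exact h1.symm

theorem specialize_ne_zero {rs : List ℤ} (hrs : IsReduced h rs) {p : Polynomial (Polynomial ℤ)}
    (hp : IsTracePolynomial (altProd (FreeGroup.of 0) (FreeGroup.of 1) 1 rs) p) :
    specialize p ((l - m) ^ 2) ≠ 0 := by
  intro h0
  refine gammaPoly_altProd_ne_zero h hrs (Polynomial.funext fun c => ?_)
  rw [← eval_specialize_eq_gammaPoly h hp, h0, eval_zero, eval_zero]

end Family

end TraceRoots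

/-! ### From trace bounds to bounds on derivatives of matrices. -/

namespace TraceRoots

open Filter Topology Polynomial

attribute [local instance] Matrix.linftyOpNormedRing Matrix.linftyOpNormedAlgebra

/-- Complex `2 × 2` matrices. -/
abbrev Mat2 : Type := Matrix (Fin 2) (Fin 2) ℂ

/-- Complex `2 × 2` matrices over the dual numbers. -/
abbrev DualMat : Type := TrivSqZeroExt Mat2 Mat2

/-- The value at `c` of a matrix of polynomials. -/
noncomputable def valMat (c : ℂ) (W : Matrix.SpecialLinearGroup (Fin 2) ℂ[X]) : Mat2 :=
  W.1.map (eval c)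

/-- The derivative at `c` of a matrix of polynomials. -/
noncomputable def derivMat (c : ℂ) (W : Matrix.SpecialLinearGroup (Fin 2) ℂ[X]) : Mat2 :=
  W.1.map fun p => (derivative p).eval c

theorem valMat_mul (c : ℂ) (V W : Matrix.SpecialLinearGroup (Fin 2) ℂ[X]) :
    valMat c (V * W) = valMat c V * valMat c W := by
  ext i j
  simp [valMat, Matrix.mul_apply, Fin.sum_univ_two]

theorem derivMat_mul (c : ℂ) (V W : Matrix.SpecialLinearGroup (Fin 2) ℂ[X]) :
    derivMat c (V * W) = valMat c V * derivMat c W + derivMat c V * valMat c W := by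
  ext i j
  simp [valMat, derivMat, Matrix.mul_apply, Fin.sum_univ_two]
  ring

/-- Evaluation of a matrix of polynomials at the dual number `c + ε`. -/
noncomputable def jet (c : ℂ) : Matrix.SpecialLinearGroup (Fin 2) ℂ[X] →* DualMat where
  toFun W := (valMat c W, derivMat c W)
  map_one' := by
    refine TrivSqZeroExt.ext (show valMat c 1 = 1 from ?_) (show derivMat c 1 = 0 from ?_)
    · ext i j
      fin_cases i <;> fin_cases j <;> simp [valMat]
    · ext i j
      fin_cases i <;> fin_cases j <;> simp [derivMat]
  map_mul' V W := by
    refine TrivSqZeroExt.ext ?_ ?_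
    · exact valMat_mul c V W
    · exact derivMat_mul c V W

theorem exists_norm_trace_le : ∃ K : ℝ, 0 < K ∧ ∀ M : Mat2, ‖M.trace‖ ≤ K * ‖M‖ := by
  obtain ⟨K, hK, h⟩ := (LinearMap.toContinuousLinearMap
    (Matrix.traceLinearMap (Fin 2) ℂ ℂ : Mat2 →ₗ[ℂ] ℂ)).bound
  exact ⟨K, hK, h⟩

/-- As `γ ≠ 0`, the matrices `1`, `J`, `A`, `A J` form a basis, so the four traces determine `M` and
the injective linear map they define is bounded below. -/
theorem exists_norm_le_of_traces {l m c : ℂ} (hg : (l - m) ^ 2 + c ^ 2 ≠ 0) :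
    ∃ K : ℝ, 0 < K ∧ ∀ (M : Mat2) (B : ℝ), ‖M.trace‖ ≤ B → ‖(M * turnMat ℂ).trace‖ ≤ B →
      ‖(M * upperMat l m c).trace‖ ≤ B → ‖(M * (upperMat l m c * turnMat ℂ)).trace‖ ≤ B →
      ‖M‖ ≤ K * B := by
  let T : Mat2 → (Mat2 →ₗ[ℂ] ℂ) := fun Y =>
    (Matrix.traceLinearMap (Fin 2) ℂ ℂ).comp (LinearMap.mulRight ℂ Y)
  let L : Mat2 →ₗ[ℂ] (Fin 4 → ℂ) := LinearMap.pi
    ![T 1, T (turnMat ℂ), T (upperMat l m c), T (upperMat l m c * turnMat ℂ)]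
  have hker : L.ker = ⊥ := by
    refine LinearMap.ker_eq_bot'.mpr fun M hM => ?_
    have h0 := congrFun hM 0
    have h1 := congrFun hM 1
    have h2 := congrFun hM 2
    have h3 := congrFun hM 3
    simp [L, T, turnMat, upperMat, Matrix.trace_fin_two, Matrix.mul_apply, Fin.sum_univ_two]
      at h0 h1 h2 h3
    have e1 : ((l - m) ^ 2 + c ^ 2) * M 0 0 = 0 := by
      linear_combination (l - m) * h2 + c * h3 - (l - m) * m * h0 - c * m * h1
    have e2 : ((l - m) ^ 2 + c ^ 2) * M 1 0 = 0 := by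
      linear_combination c * h2 - (l - m) * h3 - c * m * h0 + (l - m) * m * h1
    have q1 := (mul_eq_zero.mp e1).resolve_left hg
    have q2 := (mul_eq_zero.mp e2).resolve_left hg
    have q3 : M 0 1 = 0 := by linear_combination h1 + q2
    have q4 : M 1 1 = 0 := by linear_combination h0 - q1
    ext i j
    fin_cases i <;> fin_cases j <;> simp [q1, q2, q3, q4]
  obtain ⟨K, hK, hL⟩ := L.exists_antilipschitzWith hker
  refine ⟨K, hK, fun M B h0 h1 h2 h3 => ?_⟩
  have h4 := hL.le_mul_dist M 0
  rw [dist_zero_right, map_zero, dist_zero_right] at h4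
  refine h4.trans (mul_le_mul_of_nonneg_left ?_ K.2)
  refine (pi_norm_le_iff_of_nonneg ((norm_nonneg _).trans h0)).mpr fun i => ?_
  fin_cases i
  · simpa [L, T] using h0
  · simpa [L, T] using h1
  · simpa [L, T] using h2
  · simpa [L, T, Matrix.mul_assoc] using h3

/-- The group generated by the generic matrix and the half turn. -/
noncomputable def polyGroup {l m : ℂ} (h : l * m = 1) :
    Subgroup (Matrix.SpecialLinearGroup (Fin 2) ℂ[X]) :=
  Subgroup.closure {polyUpper h, turnSL ℂ[X]}

theorem polyUpper_mem {l m : ℂ} (h : l * m = 1) : polyUpper h ∈ polyGroup h :=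
  Subgroup.subset_closure (by simp)

theorem turnSL_mem {l m : ℂ} (h : l * m = 1) : turnSL ℂ[X] ∈ polyGroup h :=
  Subgroup.subset_closure (by simp)

theorem valMat_polyUpper {l m : ℂ} (h : l * m = 1) (c : ℂ) :
    valMat c (polyUpper h) = upperMat l m c := by
  ext i j
  fin_cases i <;> fin_cases j <;> simp [valMat, polyUpper, upperSL, upperMat]

theorem valMat_turnSL (c : ℂ) : valMat c (turnSL ℂ[X]) = turnMat ℂ := by
  ext i j
  fin_cases i <;> fin_cases j <;> simp [valMat, turnSL, turnMat]

theorem valMat_polyUpper_inv {l m : ℂ} (h : l * m = 1) (c : ℂ) :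
    valMat c (polyUpper h)⁻¹ = upperMat m l (-c) := by
  rw [valMat, polyUpper, upperSL_inv_coe]
  ext i j
  fin_cases i <;> fin_cases j <;> simp [upperMat]

theorem valMat_turnSL_inv (c : ℂ) : valMat c (turnSL ℂ[X])⁻¹ = turnMatInv ℂ := by
  rw [valMat, turnSL_inv_coe]
  ext i j
  fin_cases i <;> fin_cases j <;> simp [turnMatInv]

theorem derivMat_polyUpper {l m : ℂ} (h : l * m = 1) (c : ℂ) :
    derivMat c (polyUpper h) = nilMat := by
  ext i j
  fin_cases i <;> fin_cases j <;> simp [derivMat, polyUpper, upperSL, upperMat, nilMat]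

theorem derivMat_polyUpper_inv {l m : ℂ} (h : l * m = 1) (c : ℂ) :
    derivMat c (polyUpper h)⁻¹ = -nilMat := by
  rw [derivMat, polyUpper, upperSL_inv_coe]
  ext i j
  fin_cases i <;> fin_cases j <;> simp [upperMat, nilMat]

theorem derivMat_turnSL (c : ℂ) : derivMat c (turnSL ℂ[X]) = 0 := by
  ext i j
  fin_cases i <;> fin_cases j <;> simp [derivMat, turnSL, turnMat]

theorem derivMat_turnSL_inv (c : ℂ) : derivMat c (turnSL ℂ[X])⁻¹ = 0 := by
  rw [derivMat, turnSL_inv_coe]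
  ext i j
  fin_cases i <;> fin_cases j <;> simp [turnMatInv]

/-- Derivatives of traces controlled by the traces. -/
def HasTraceBound {l m : ℂ} (h : l * m = 1) (c : ℂ) (K : ℝ) : Prop :=
  ∀ g ∈ polyGroup h, ‖(derivMat c g).trace‖ ≤ K * ‖(valMat c g).trace ^ 2 - 4‖

/-- The trace bound for `g y` controls `tr(g' y) + tr(g y')`. For `g` near `1` this bounds `tr(g'
y)`, and letting `y` run through `1`, `J`, `A`, `A J` bounds `g'`. -/
theorem HasTraceBound.exists_norm_derivMat_le {l m : ℂ} {h : l * m = 1} {c : ℂ} {K : ℝ}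
    (hK : HasTraceBound h c K) (hK0 : 0 ≤ K) (hg : (l - m) ^ 2 + c ^ 2 ≠ 0) :
    ∃ D : ℝ, 0 < D ∧ ∀ g ∈ polyGroup h, ‖valMat c g - 1‖ ≤ 1 → ‖derivMat c g‖ ≤ D := by
  obtain ⟨Kt, hKt, htr⟩ := exists_norm_trace_le
  obtain ⟨Kl, hKl, hL⟩ := exists_norm_le_of_traces (l := l) (m := m) (c := c) hg
  set N := ‖(1 : Mat2)‖ + 1 with hN
  have hN0 : 0 ≤ N := by positivity
  have hb : ∀ y ∈ polyGroup h, ∃ B : ℝ, 0 ≤ B ∧ ∀ g ∈ polyGroup h, ‖valMat c g - 1‖ ≤ 1 →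
      ‖(derivMat c g * valMat c y).trace‖ ≤ B := by
    intro y hy
    refine ⟨K * ((Kt * (N * ‖valMat c y‖)) ^ 2 + 4) + Kt * (N * ‖derivMat c y‖), by positivity,
      fun g hgm h1 => ?_⟩
    have h2 : ‖valMat c g‖ ≤ N := by
      have := norm_sub_norm_le (valMat c g) 1
      linarith
    have h3 := hK _ (mul_mem hgm hy)
    rw [valMat_mul, derivMat_mul, Matrix.trace_add] at h3
    have h4 : ‖(valMat c g * derivMat c y).trace‖ ≤ Kt * (N * ‖derivMat c y‖) := by
      refine (htr _).trans (mul_le_mul_of_nonneg_left ?_ hKt.le)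
      refine (norm_mul_le _ _).trans (mul_le_mul_of_nonneg_right h2 (norm_nonneg _))
    have h5 : ‖(valMat c g * valMat c y).trace‖ ≤ Kt * (N * ‖valMat c y‖) := by
      refine (htr _).trans (mul_le_mul_of_nonneg_left ?_ hKt.le)
      refine (norm_mul_le _ _).trans (mul_le_mul_of_nonneg_right h2 (norm_nonneg _))
    have h6 : ‖(valMat c g * valMat c y).trace ^ 2 - 4‖ ≤ (Kt * (N * ‖valMat c y‖)) ^ 2 + 4 := by
      refine (norm_sub_le _ _).trans ?_
      rw [norm_pow, Complex.norm_ofNat]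
      gcongr
    have h7 := mul_le_mul_of_nonneg_left h6 hK0
    have h8 := norm_sub_norm_le ((derivMat c g * valMat c y).trace)
      (-(valMat c g * derivMat c y).trace)
    rw [norm_neg, sub_neg_eq_add, add_comm (derivMat c g * valMat c y).trace] at h8
    linarith
  have hA := polyUpper_mem h
  have hJ := turnSL_mem h
  obtain ⟨B0, hB0, h0⟩ := hb 1 (one_mem _)
  obtain ⟨B1, hB1, h1⟩ := hb _ hJ
  obtain ⟨B2, hB2, h2⟩ := hb _ hA
  obtain ⟨B3, hB3, h3⟩ := hb _ (mul_mem hA hJ)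
  refine ⟨Kl * (B0 + B1 + B2 + B3 + 1), by positivity, fun g hgm hg1 => ?_⟩
  have e0 := h0 g hgm hg1
  have e1 := h1 g hgm hg1
  have e2 := h2 g hgm hg1
  have e3 := h3 g hgm hg1
  have hone : valMat c 1 = 1 := congrArg TrivSqZeroExt.fst (map_one (jet c))
  rw [hone, mul_one] at e0
  rw [valMat_turnSL] at e1
  rw [valMat_polyUpper] at e2
  rw [valMat_mul, valMat_turnSL, valMat_polyUpper] at e3
  exact hL _ _ (by linarith) (by linarith) (by linarith) (by linarith)

theorem norm_derivMat_pow_sub_le (c : ℂ) (g : Matrix.SpecialLinearGroup (Fin 2) ℂ[X]) (k : ℕ) :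
    ‖derivMat c (g ^ k) - (k : ℝ) • derivMat c g‖ ≤
      k * ‖derivMat c g‖ * ((1 + ‖valMat c g - 1‖) ^ k - 1) := by
  have hv : ∀ k, valMat c (g ^ k) = (1 + (valMat c g - 1)) ^ k := by
    intro k
    rw [add_sub_cancel]
    exact congrArg TrivSqZeroExt.fst (map_pow (jet c) g k)
  induction k with
  | zero =>
    have hone : derivMat c 1 = 0 := congrArg TrivSqZeroExt.snd (map_one (jet c))
    simp [hone]
  | succ k ih =>
    set d := derivMat c g with hd
    set a := valMat c g - 1 with ha
    set P := (1 + ‖a‖) ^ k with hP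
    set Dk := derivMat c (g ^ k) with hDk
    have h1 := (norm_pow_sub_one_le a k).1
    rw [← hv] at h1
    have hP1 : 1 ≤ P := one_le_pow₀ (by linarith [norm_nonneg a])
    have e : derivMat c (g ^ (k + 1)) - ((k + 1 : ℕ) : ℝ) • d =
        (Dk - (k : ℝ) • d) + Dk * a + (valMat c (g ^ k) - 1) * d := by
      rw [pow_succ, derivMat_mul, ← hDk, ← hd, ha, mul_sub, sub_mul, mul_one, one_mul]
      push_cast
      rw [add_smul, one_smul]
      abel
    have h2 : ‖Dk‖ ≤ k * ‖d‖ * P := by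
      have h3 := norm_sub_norm_le Dk ((k : ℝ) • d)
      rw [norm_smul, Real.norm_natCast] at h3
      linarith
    have h4 : ‖Dk * a‖ ≤ k * ‖d‖ * P * ‖a‖ :=
      (norm_mul_le _ _).trans (mul_le_mul_of_nonneg_right h2 (norm_nonneg _))
    have h5 : ‖(valMat c (g ^ k) - 1) * d‖ ≤ (P - 1) * ‖d‖ :=
      (norm_mul_le _ _).trans (mul_le_mul_of_nonneg_right h1 (norm_nonneg _))
    rw [e]
    refine (norm_add₃_le).trans ?_
    rw [pow_succ]
    have h6 : 0 ≤ ‖d‖ * (P * ‖a‖) := by positivity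
    push_cast
    nlinarith

/-- As long as `g ^ k` stays near `1`, its derivative, roughly `k g'`, obeys the uniform bound. With
`α = ‖g - 1‖` one can take `k` of order `1/α`, which makes `g'` of order `α`; if `α = 0`, every `k`
is allowed and `g' = 0`. -/
theorem HasTraceBound.exists_norm_derivMat_le_mul {l m : ℂ} {h : l * m = 1} {c : ℂ} {K : ℝ}
    (hK : HasTraceBound h c K) (hK0 : 0 ≤ K) (hg : (l - m) ^ 2 + c ^ 2 ≠ 0) :
    ∃ D : ℝ, 0 < D ∧ ∀ g ∈ polyGroup h, ‖valMat c g - 1‖ ≤ 1 / 6 →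
      ‖derivMat c g‖ ≤ D * ‖valMat c g - 1‖ := by
  obtain ⟨D, hD, hb⟩ := hK.exists_norm_derivMat_le hK0 hg
  refine ⟨12 * D, by positivity, fun g hgm h1 => ?_⟩
  set α := ‖valMat c g - 1‖ with hα
  have hα0 : 0 ≤ α := norm_nonneg _
  have key : ∀ k : ℕ, k * α ≤ 1 / 3 → k * ‖derivMat c g‖ ≤ 2 * D := by
    intro k hk
    have hka : 0 ≤ k * α := by positivity
    have h2 := one_add_pow_le_exp hα0 k
    have h3 := Real.abs_exp_sub_one_sub_id_le (x := k * α) (by rw [abs_of_nonneg hka]; linarith)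
    have h4 := le_abs_self (Real.exp (k * α) - 1 - k * α)
    have h5 : (1 + α) ^ k ≤ 3 / 2 := by nlinarith
    have h6 := (norm_pow_sub_one_le (valMat c g - 1) k).1
    have h7 : valMat c (g ^ k) = (1 + (valMat c g - 1)) ^ k := by
      rw [add_sub_cancel]
      exact congrArg TrivSqZeroExt.fst (map_pow (jet c) g k)
    rw [← h7] at h6
    have h8 := hb _ (pow_mem hgm k) (by linarith)
    have h9 := norm_derivMat_pow_sub_le c g k
    have h10 := norm_sub_norm_le ((k : ℝ) • derivMat c g) (derivMat c (g ^ k))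
    rw [norm_sub_rev, norm_smul, Real.norm_natCast] at h10
    have h11 : k * ‖derivMat c g‖ * ((1 + α) ^ k - 1) ≤ k * ‖derivMat c g‖ * (1 / 2) :=
      mul_le_mul_of_nonneg_left (by linarith) (by positivity)
    linarith
  rcases hα0.eq_or_lt with h0 | h0
  · rw [← h0, mul_zero]
    by_contra hne
    push Not at hne
    obtain ⟨k, hk⟩ := exists_nat_gt (2 * D / ‖derivMat c g‖)
    rw [div_lt_iff₀ hne] at hk
    have := key k (by rw [← h0]; norm_num)
    linarith
  -- The floor loses at most one step, and `α ≤ 1/6` leaves `kα ≥ 1/6`; hence the factor `12 = 6 ·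
  -- 2`.
  · have h2 := key ⌊1 / (3 * α)⌋₊ (by
      have := Nat.floor_le (show 0 ≤ 1 / (3 * α) by positivity)
      rw [le_div_iff₀ (by positivity)] at this
      linarith)
    have h3 := Nat.lt_floor_add_one (1 / (3 * α))
    rw [div_lt_iff₀ (by positivity)] at h3
    set k : ℝ := (⌊1 / (3 * α)⌋₊ : ℝ)
    have h4 : 1 ≤ 6 * k * α := by nlinarith
    have h5 := norm_nonneg (derivMat c g)
    nlinarith

end TraceRoots

/-! ### The tangent space of the group of jets. -/

namespace TraceRoots

open Filter Topology Polynomial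

attribute [local instance] Matrix.linftyOpNormedRing Matrix.linftyOpNormedAlgebra

instance : @CompleteSpace DualMat
    (inferInstance : NormedRing DualMat).toPseudoMetricSpace.toUniformSpace :=
  have : Module.Finite ℝ DualMat := inferInstanceAs (Module.Finite ℝ (Mat2 × Mat2))
  FiniteDimensional.complete ℝ DualMat

/-- The jets at `c` of the elements of `polyGroup h`. -/
noncomputable def groupJet {l m : ℂ} (h : l * m = 1) (c : ℂ) : polyGroup h →* DualMat :=
  (jet c).comp (polyGroup h).subtype

/-- Dual number matrices as pairs. -/
noncomputable def pairToDual : MatPair →ₗ[ℝ] DualMat where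
  toFun p := (p.1, p.2)
  map_add' _ _ := rfl
  map_smul' _ _ := rfl

/-- The tangent space of the group of jets, as a space of pairs of matrices. -/
noncomputable def jetTangent {l m : ℂ} (h : l * m = 1) (c : ℂ) : Submodule ℝ MatPair :=
  (tangentSpace (groupJet h c)).comap pairToDual

theorem dualMat_tendsto_iff {ι : Type*} {f : Filter ι} {u : ι → DualMat} {X : DualMat} :
    Tendsto u f (𝓝 X) ↔ Tendsto (fun i => ‖(u i).fst - X.fst‖) f (𝓝 0) ∧
      Tendsto (fun i => ‖(u i).snd - X.snd‖) f (𝓝 0) := by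
  rw [TrivSqZeroExt.nhds_def]
  exact tendsto_prod_iff'.trans
    (and_congr tendsto_iff_norm_sub_tendsto_zero tendsto_iff_norm_sub_tendsto_zero)

theorem tendsto_entry {ι : Type*} {f : Filter ι} {u : ι → Mat2} {X : Mat2}
    (h : Tendsto (fun i => ‖u i - X‖) f (𝓝 0)) (i j : Fin 2) :
    Tendsto (fun k => u k i j) f (𝓝 (X i j)) := by
  have h1 : Tendsto u f (𝓝 X) := tendsto_iff_norm_sub_tendsto_zero.mpr h
  have h2 : Continuous fun M : Mat2 => M i j := by fun_prop
  exact (h2.tendsto X).comp h1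

theorem exists_family_of_mem_jetTangent {l m : ℂ} {h : l * m = 1} {c : ℂ} {p : MatPair}
    (hp : p ∈ jetTangent h c) : ∃ u : ℝ → polyGroup h,
      Tendsto (fun t => ‖t⁻¹ • (valMat c (u t).1 - 1) - p.1‖) (𝓝[>] 0) (𝓝 0) ∧
      Tendsto (fun t => ‖t⁻¹ • derivMat c (u t).1 - p.2‖) (𝓝[>] 0) (𝓝 0) := by
  obtain ⟨u, hu⟩ := hp
  obtain ⟨h1, h2⟩ := dualMat_tendsto_iff.mp hu
  refine ⟨u, h1, ?_⟩
  refine h2.congr fun t => ?_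
  rw [TrivSqZeroExt.snd_smul, TrivSqZeroExt.snd_sub, TrivSqZeroExt.snd_one, sub_zero]
  rfl

theorem conj_mem_jetTangent {l m : ℂ} {h : l * m = 1} {c : ℂ} {p : MatPair}
    (hp : p ∈ jetTangent h c) {g : Matrix.SpecialLinearGroup (Fin 2) ℂ[X]}
    (hg : g ∈ polyGroup h) :
    (valMat c g * p.1 * valMat c g⁻¹,
      valMat c g * p.1 * derivMat c g⁻¹ +
        (valMat c g * p.2 + derivMat c g * p.1) * valMat c g⁻¹) ∈ jetTangent h c :=
  conj_mem_tangentVectors (ψ := groupJet h c) hp ⟨g, hg⟩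

theorem lie_mem_jetTangent {l m : ℂ} {h : l * m = 1} {c : ℂ} {p q : MatPair}
    (hp : p ∈ jetTangent h c) (hq : q ∈ jetTangent h c) :
    (p.1 * q.1 - q.1 * p.1, (p.1 * q.2 + p.2 * q.1) - (q.1 * p.2 + q.2 * p.1)) ∈
      jetTangent h c :=
  lie_mem_tangentVectors (ψ := groupJet h c) hp hq

theorem tendsto_id_nhdsGT_zero : Tendsto (fun t : ℝ => (t : ℂ)) (𝓝[>] 0) (𝓝 0) := by
  refine tendsto_nhdsWithin_of_tendsto_nhds ?_
  exact_mod_cast Complex.continuous_ofReal.tendsto 0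

theorem det_valMat (c : ℂ) (g : Matrix.SpecialLinearGroup (Fin 2) ℂ[X]) :
    valMat c g 0 0 * valMat c g 1 1 - valMat c g 0 1 * valMat c g 1 0 = 1 := by
  have h := g.2
  rw [Matrix.det_fin_two] at h
  have h1 := congrArg (eval c) h
  simpa [valMat] using h1

theorem det_derivMat (c : ℂ) (g : Matrix.SpecialLinearGroup (Fin 2) ℂ[X]) :
    derivMat c g 0 0 * valMat c g 1 1 + valMat c g 0 0 * derivMat c g 1 1
      - derivMat c g 0 1 * valMat c g 1 0 - valMat c g 0 1 * derivMat c g 1 0 = 0 := by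
  have h := g.2
  rw [Matrix.det_fin_two] at h
  have h1 := congrArg (fun p => eval c (derivative p)) h
  simp at h1
  simp only [derivMat, valMat, Matrix.map_apply]
  linear_combination h1

/-- With `g = 1 + tX`, the condition `det g = 1` reads `tr X + t det X = 0`; let `t → 0`. -/
theorem trace_fst_of_mem_jetTangent {l m : ℂ} {h : l * m = 1} {c : ℂ} {p : MatPair}
    (hp : p ∈ jetTangent h c) : p.1.trace = 0 := by
  obtain ⟨u, hu, -⟩ := exists_family_of_mem_jetTangent hp
  have e := tendsto_entry hu
  have h1 := (e 0 0).add (e 1 1)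
  have h2 := (((e 0 0).mul (e 1 1)).sub ((e 0 1).mul (e 1 0))).mul tendsto_id_nhdsGT_zero
  have h3 := h1.add h2
  rw [mul_zero, add_zero, ← Matrix.trace_fin_two] at h3
  refine tendsto_nhds_unique h3 (tendsto_const_nhds.congr' ?_)
  filter_upwards [self_mem_nhdsWithin] with t ht
  have ht' : (t : ℂ) ≠ 0 := by exact_mod_cast (ne_of_gt ht)
  have hd := det_valMat c (u t).1
  simp [Matrix.smul_apply]
  field_simp
  linear_combination -hd

theorem trace_snd_of_mem_jetTangent {l m : ℂ} {h : l * m = 1} {c : ℂ} {p : MatPair}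
    (hp : p ∈ jetTangent h c) : p.2.trace = 0 := by
  obtain ⟨u, hu, hv⟩ := exists_family_of_mem_jetTangent hp
  have e := tendsto_entry hu
  have e' := tendsto_entry hv
  have h1 := (e' 0 0).add (e' 1 1)
  have h2 := (((((e 0 0).mul (e' 1 1)).add ((e' 0 0).mul (e 1 1))).sub
    ((e 0 1).mul (e' 1 0))).sub ((e' 0 1).mul (e 1 0))).mul tendsto_id_nhdsGT_zero
  have h3 := h1.add h2
  rw [mul_zero, add_zero, ← Matrix.trace_fin_two] at h3
  refine tendsto_nhds_unique h3 (tendsto_const_nhds.congr' ?_)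
  filter_upwards [self_mem_nhdsWithin] with t ht
  have ht' : (t : ℂ) ≠ 0 := by exact_mod_cast (ne_of_gt ht)
  have hd := det_derivMat c (u t).1
  simp [Matrix.smul_apply]
  field_simp
  linear_combination -hd

theorem HasTraceBound.isTangentGraph {l m : ℂ} {h : l * m = 1} {c : ℂ} {K : ℝ}
    (hK : HasTraceBound h c K) (hK0 : 0 ≤ K) (hg : (l - m) ^ 2 + c ^ 2 ≠ 0)
    (hnd : ∀ ε > 0, ∃ g ∈ polyGroup h, valMat c g ≠ 1 ∧ ‖valMat c g - 1‖ < ε) :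
    IsTangentGraph l m c (jetTangent h c) := by
  obtain ⟨D, hD, hb⟩ := hK.exists_norm_derivMat_le_mul hK0 hg
  have hA := polyUpper_mem h
  refine ⟨fun p => trace_fst_of_mem_jetTangent, fun p => trace_snd_of_mem_jetTangent, ?_,
    fun p hp q hq => lie_mem_jetTangent hp hq, ?_, ?_, ?_, ?_⟩
  · intro Y hY
    obtain ⟨u, hu, hv⟩ := exists_family_of_mem_jetTangent hY
    simp only [sub_zero] at hu
    have h1 : Tendsto (fun t => ‖t⁻¹ • derivMat c (u t).1‖) (𝓝[>] 0) (𝓝 0) := by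
      have h2 := hu.const_mul D
      rw [mul_zero] at h2
      refine squeeze_zero' (Eventually.of_forall fun _ => norm_nonneg _) ?_ h2
      have h3 := tendsto_nhdsWithin_of_tendsto_nhds (s := Set.Ioi 0)
        (tendsto_id (α := ℝ) (x := 𝓝 0))
      -- The product is `‖valMat c (u t) - 1‖`, so the linear bound `hb` applies for small `t`.
      have h4 := (h3.mul hu).eventually_lt_const (u := 1 / 6) (by norm_num)
      filter_upwards [self_mem_nhdsWithin, h4] with t ht h5
      have ht0 : 0 < t := ht
      rw [norm_smul, Real.norm_of_nonneg (by positivity), id, mul_inv_cancel_left₀ ht0.ne'] at h5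
      have h6 := hb _ (u t).2 h5.le
      rw [norm_smul, norm_smul]
      calc _ ≤ ‖t⁻¹‖ * (D * ‖valMat c (u t).1 - 1‖) := by gcongr
        _ = _ := by ring
    have h2 := hv.add h1
    rw [add_zero] at h2
    have h3 : ‖Y‖ ≤ 0 := by
      refine ge_of_tendsto h2 (Eventually.of_forall fun t => ?_)
      have := norm_sub_norm_le Y (t⁻¹ • derivMat c (u t).1)
      rw [norm_sub_rev] at this
      linarith
    exact norm_le_zero_iff.mp h3
  · intro p hp
    replace hp := SetLike.mem_coe.mp hp
    have := conj_mem_jetTangent hp hA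
    rw [valMat_polyUpper, valMat_polyUpper_inv, derivMat_polyUpper, derivMat_polyUpper_inv] at this
    refine SetLike.mem_coe.mpr ?_
    convert this using 2
    rw [mul_neg, add_mul]; abel
  · intro p hp
    replace hp := SetLike.mem_coe.mp hp
    have := conj_mem_jetTangent hp (inv_mem hA)
    rw [inv_inv, valMat_polyUpper, valMat_polyUpper_inv, derivMat_polyUpper,
      derivMat_polyUpper_inv] at this
    refine SetLike.mem_coe.mpr ?_
    convert this using 2
    rw [add_mul]; abel
  · intro p hp
    replace hp := SetLike.mem_coe.mp hp
    have := conj_mem_jetTangent hp (turnSL_mem h)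
    rw [valMat_turnSL, valMat_turnSL_inv, derivMat_turnSL, derivMat_turnSL_inv] at this
    refine SetLike.mem_coe.mpr ?_
    convert this using 2
    rw [mul_zero, zero_mul, add_zero, zero_add]
  · have hpos : ∀ n : ℕ, (0 : ℝ) < 1 / (6 * ((n : ℝ) + 1)) := fun n => by positivity
    choose g hgm hg1 hgn using fun n => hnd _ (hpos n)
    set τ : ℕ → ℝ := fun n => ‖valMat c (g n) - 1‖ with hτ
    have hτ0 : ∀ n, 0 < τ n := fun n => norm_pos_iff.mpr (sub_ne_zero.mpr (hg1 n))
    have hτl : Tendsto τ atTop (𝓝 0) := by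
      refine squeeze_zero (fun n => (hτ0 n).le) (fun n => (hgn n).le) ?_
      have := (tendsto_one_div_add_atTop_nhds_zero_nat (𝕜 := ℝ)).const_mul (1 / 6)
      rw [mul_zero] at this
      refine this.congr fun n => ?_
      field_simp
    have hτ6 : ∀ n, τ n ≤ 1 / 6 := by
      intro n
      refine (hgn n).le.trans (one_div_le_one_div_of_le (by norm_num) ?_)
      have : (0 : ℝ) ≤ n := Nat.cast_nonneg n
      linarith
    -- Rescaled jets: the first components have norm `1` and the second are bounded by `D`, so a
    -- subsequence converges to a tangent vector with nonzero first component.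
    let x : ℕ → MatPair := fun n => ((τ n)⁻¹ • (valMat c (g n) - 1), (τ n)⁻¹ • derivMat c (g n))
    have hx1 : ∀ n, ‖(x n).1‖ = 1 := by
      intro n
      simp only [x]
      rw [norm_smul, norm_inv, Real.norm_of_nonneg (hτ0 n).le, inv_mul_cancel₀ (hτ0 n).ne']
    have hx2 : ∀ n, ‖(x n).2‖ ≤ D := by
      intro n
      simp only [x]
      rw [norm_smul, norm_inv, Real.norm_of_nonneg (hτ0 n).le, inv_mul_le_iff₀ (hτ0 n), mul_comm]
      exact hb _ (hgm n) (hτ6 n)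
    have : ProperSpace MatPair := FiniteDimensional.proper_real MatPair
    obtain ⟨p, -, φ, hφ, hp⟩ := tendsto_subseq_of_bounded
      (Metric.isBounded_closedBall (x := (0 : MatPair)) (r := max 1 D)) (x := x) (fun n => by
        rw [mem_closedBall_zero_iff, Prod.norm_def]
        exact max_le_max (hx1 n).le (hx2 n))
    have hp0 := tendsto_iff_norm_sub_tendsto_zero.mp hp
    have hp1 : Tendsto (fun n => ‖(x (φ n)).1 - p.1‖) atTop (𝓝 0) :=
      squeeze_zero (fun _ => norm_nonneg _) (fun n => norm_fst_le (x (φ n) - p)) hp0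
    have hp2 : Tendsto (fun n => ‖(x (φ n)).2 - p.2‖) atTop (𝓝 0) :=
      squeeze_zero (fun _ => norm_nonneg _) (fun n => norm_snd_le (x (φ n) - p)) hp0
    refine ⟨p, ?_, ?_⟩
    · refine mem_tangentVectors_of_seq (ψ := groupJet h c) (g := fun n => ⟨g (φ n), hgm (φ n)⟩)
        (τ := fun n => τ (φ n)) (fun n => hτ0 _) (hτl.comp hφ.tendsto_atTop) ?_
      refine dualMat_tendsto_iff.mpr ⟨hp1, hp2.congr fun n => ?_⟩
      rw [TrivSqZeroExt.snd_smul, TrivSqZeroExt.snd_sub, TrivSqZeroExt.snd_one, sub_zero]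
      rfl
    · intro h0
      simp only [h0, sub_zero, hx1] at hp1
      exact one_ne_zero (tendsto_nhds_unique tendsto_const_nhds hp1)

/-- If the derivatives of the traces are controlled then the group of values is discrete. -/
theorem HasTraceBound.isolated {l m : ℂ} {h : l * m = 1} {c : ℂ} {K : ℝ}
    (hK : HasTraceBound h c K) (hK0 : 0 ≤ K) (hc : c ≠ 0) (ht : l + m ≠ 0)
    (hg : (l - m) ^ 2 + c ^ 2 ≠ 0) :
    ∃ ε > 0, ∀ g ∈ polyGroup h, ‖valMat c g - 1‖ < ε → valMat c g = 1 := by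
  by_contra hcon
  push Not at hcon
  refine IsTangentGraph.false h hc ht hg _ (hK.isTangentGraph hK0 hg fun ε hε => ?_)
  obtain ⟨g, h1, h2, h3⟩ := hcon ε hε
  exact ⟨g, h1, h3, h2⟩

end TraceRoots

/-! ### Elliptic elements of finite order produce roots. -/

namespace TraceRoots

open Filter Topology Polynomial

theorem gammaSL_one_right (A : Matrix.SpecialLinearGroup (Fin 2) ℂ) : gammaSL A 1 = 0 := by
  rw [gammaSL]
  have : A * 1 * A⁻¹ * 1⁻¹ = 1 := by group
  rw [this]
  simp [Matrix.trace_one]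

theorem gammaSL_zpow_mul_mul_zpow (A W : Matrix.SpecialLinearGroup (Fin 2) ℂ) (r r' : ℤ) :
    gammaSL A (A ^ r * W * A ^ r') = gammaSL A W := by
  rw [gammaSL, gammaSL, ← trace_conj_SL2 (A * W * A⁻¹ * W⁻¹) (A ^ r)]
  congr 1
  refine congrArg Matrix.trace (SL2_coe_congr ?_)
  group

theorem gammaSL_conj (A B S : Matrix.SpecialLinearGroup (Fin 2) ℂ) :
    gammaSL (S * A * S⁻¹) (S * B * S⁻¹) = gammaSL A B := by
  rw [gammaSL, gammaSL, ← trace_conj_SL2 (A * B * A⁻¹ * B⁻¹) S]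
  congr 1
  refine congrArg Matrix.trace (SL2_coe_congr ?_)
  group

theorem evalSL_mem_center (c : ℂ) {W : Matrix.SpecialLinearGroup (Fin 2) ℂ[X]}
    (hW : W ∈ Subgroup.center (Matrix.SpecialLinearGroup (Fin 2) ℂ[X])) :
    evalSL c W ∈ Subgroup.center (Matrix.SpecialLinearGroup (Fin 2) ℂ) := by
  obtain ⟨p, hp, hA⟩ := Matrix.SpecialLinearGroup.mem_center_iff.mp hW
  refine Matrix.SpecialLinearGroup.mem_center_iff.mpr ⟨p.eval c, ?_, ?_⟩
  · rw [← eval_pow, hp, eval_one]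
  · ext i j
    rw [evalSL_apply, ← hA]
    fin_cases i <;> fin_cases j <;> simp

theorem mem_center_of_coe_eq_smul_one {M : Matrix.SpecialLinearGroup (Fin 2) ℂ} {k : ℂ}
    (h : M.1 = k • 1) : M ∈ Subgroup.center (Matrix.SpecialLinearGroup (Fin 2) ℂ) := by
  have h1 := M.2
  rw [h] at h1
  refine Matrix.SpecialLinearGroup.mem_center_iff.mpr ⟨k, by simpa using h1, ?_⟩
  rw [h, Matrix.scalar_apply, Matrix.smul_one_eq_diagonal]

theorem pow_mem_center_of_trace_eq_cos {M : Matrix.SpecialLinearGroup (Fin 2) ℂ} {p q : ℕ}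
    (hp : 0 < p) (hpq : p < q) (ht : M.1.trace = ((2 * Real.cos (Real.pi * p / q) : ℝ) : ℂ)) :
    M ^ q ∈ Subgroup.center (Matrix.SpecialLinearGroup (Fin 2) ℂ) := by
  obtain ⟨n, rfl⟩ := Nat.exists_eq_add_of_lt (hp.trans hpq)
  rw [zero_add] at *
  set θ : ℝ := Real.pi * p / ((n + 1 : ℕ) : ℝ) with hθ
  have hp' : (0 : ℝ) < p := by exact_mod_cast hp
  have hpq' : (p : ℝ) < ((n + 1 : ℕ) : ℝ) := by exact_mod_cast hpq
  have hs : Real.sin θ ≠ 0 := by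
    refine (Real.sin_pos_of_pos_of_lt_pi (by positivity) ?_).ne'
    rw [hθ, div_lt_iff₀ (hp'.trans hpq')]
    exact mul_lt_mul_of_pos_left hpq' Real.pi_pos
  have hsq : Real.sin ((n + 1) * θ) = 0 := by
    have : ((n : ℝ) + 1) * θ = p * Real.pi := by
      rw [hθ]; push_cast; field_simp
    rw [this, Real.sin_nat_mul_pi]
  have h1 := pow_of_trace_cos M.1 M.2 θ (by rw [ht]; push_cast; rfl) n
  refine mem_center_of_coe_eq_smul_one (k := (Real.sin θ : ℂ)⁻¹ * -Real.sin (n * θ)) ?_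
  have hsq' : Complex.sin ((n + 1) * θ) = 0 := by exact_mod_cast congrArg Complex.ofReal hsq
  rw [hsq', zero_smul, zero_sub, ← neg_smul] at h1
  have hs' : (Real.sin θ : ℂ) ≠ 0 := by exact_mod_cast hs
  have h2 : (M ^ (n + 1)).1 = M.1 ^ (n + 1) := rfl
  rw [h2, mul_smul]
  refine (eq_inv_smul_iff₀ hs').mpr ?_
  push_cast
  exact h1

theorem exists_eval_eq_of_forall_ne_C {P : ℂ[X]} (hP : ∀ w, P ≠ C w) (t : ℂ) :
    ∃ z, P.eval z = t := by
  have h1 : (P - C t).degree ≠ 0 := by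
    intro h0
    refine hP ((P - C t).coeff 0 + t) (sub_eq_iff_eq_add.mp (eq_C_of_degree_eq_zero h0) |>.trans ?_)
    rw [← C_add]
  obtain ⟨z, hz⟩ := IsAlgClosed.exists_root _ h1
  exact ⟨z, by simpa [sub_eq_zero] using hz⟩

theorem trace_evalSL (c : ℂ) (g : Matrix.SpecialLinearGroup (Fin 2) ℂ[X]) :
    (evalSL c g).1.trace = g.1.trace.eval c := by
  rw [Matrix.trace_fin_two, Matrix.trace_fin_two, eval_add]
  rfl

/-- An element whose trace is not constant has no power which is a power of the generic
upper triangular matrix, up to sign. -/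
theorem zpow_inv_mul_pow_not_mem_center {l m : ℂ} (h : l * m = 1)
    {g : Matrix.SpecialLinearGroup (Fin 2) ℂ[X]} (hg : ∀ w, g.1.trace ≠ C w) {q : ℕ} (hq : q ≠ 0)
    (r : ℤ) : (polyUpper h ^ r)⁻¹ * g ^ q ∉
      Subgroup.center (Matrix.SpecialLinearGroup (Fin 2) ℂ[X]) := by
  intro hcen
  have key : ∀ z, ((evalSL z g).1 ^ q).trace ^ 2 = (l ^ r + m ^ r) ^ 2 := by
    intro z
    obtain ⟨k, hk, hA⟩ := Matrix.SpecialLinearGroup.mem_center_iff.mp (evalSL_mem_center z hcen)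
    have h1 : evalSL z g ^ q = evalSL z (polyUpper h ^ r) * evalSL z ((polyUpper h ^ r)⁻¹ * g ^ q) := by
      rw [← map_mul, mul_inv_cancel_left, map_pow]
    have h2 : (evalSL z g).1 ^ q = (evalSL z g ^ q).1 := rfl
    obtain ⟨U, -, hU⟩ := polyUpper_zpow h r
    have h3 : (evalSL z (polyUpper h ^ r)).1.trace = l ^ r + m ^ r := by
      rw [trace_evalSL, hU]
      simp [Matrix.trace_fin_two, -map_zpow₀]
    have hk2 : k ^ 2 = 1 := by simpa using hk
    rw [h2, h1, SL2_mul_coe, ← hA, Matrix.scalar_apply, ← Matrix.smul_one_eq_diagonal,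
      Matrix.mul_smul, mul_one, Matrix.trace_smul, h3, smul_eq_mul, mul_pow, hk2, one_mul]
  -- By `key`, `tr(g ^ q)²` is constant. Where `tr g = 2` it equals `4`; where `tr g = 2 + 1/2` it
  -- equals `(2 ^ q + 2 ^ (-q))²`, which differs from `4` for `q ≠ 0`.
  obtain ⟨z, hz⟩ := exists_eval_eq_of_forall_ne_C hg 2
  obtain ⟨y, hy⟩ := exists_eval_eq_of_forall_ne_C hg (2 + 2⁻¹)
  rw [← trace_evalSL] at hz hy
  have h1 := trace_pow_of_trace_eq _ (evalSL z g).2 (s := 1) one_ne_zero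
    (by rw [hz]; norm_num) q
  have h2 := trace_pow_of_trace_eq _ (evalSL y g).2 (s := 2) two_ne_zero hy q
  have h3 := (key z).trans (key y).symm
  rw [h1, h2, inv_one, one_pow, inv_pow] at h3
  have h4 : (2 : ℂ) ^ q ≠ 0 := pow_ne_zero _ two_ne_zero
  have h5 : ((2 : ℂ) ^ q - (2 ^ q)⁻¹) ^ 2 = 0 := by
    have := mul_inv_cancel₀ h4
    linear_combination -h3 - 4 * this
  have h6 : (2 : ℂ) ^ q * 2 ^ q = 1 := by
    have := sub_eq_zero.mp (pow_eq_zero_iff two_ne_zero |>.mp h5)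
    nth_rewrite 2 [this]
    exact mul_inv_cancel₀ h4
  have h7 : (2 : ℕ) ^ (q + q) = 1 := by
    rw [← pow_add] at h6
    exact_mod_cast h6
  rw [Nat.pow_eq_one] at h7
  omega

/-- If the generic group has an elliptic element of finite order at `z`, with non constant trace,
then some reduced word has `γ = 0` at `z`. -/
theorem exists_eval_gammaPoly_eq_zero {l m : ℂ} (h : l * m = 1)
    {g : Matrix.SpecialLinearGroup (Fin 2) ℂ[X]} (hg : g ∈ polyGroup h)
    (hgt : ∀ w, g.1.trace ≠ C w) {z : ℂ} {p q : ℕ} (hp : 0 < p) (hpq : p < q)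
    (hz : g.1.trace.eval z = ((2 * Real.cos (Real.pi * p / q) : ℝ) : ℂ)) :
    ∃ rs, IsReduced h rs ∧
      (gammaPoly l m (altProd (polyUpper h) (turnSL ℂ[X]) 1 rs)).eval z = 0 := by
  let π := QuotientGroup.mk' (Subgroup.center (Matrix.SpecialLinearGroup (Fin 2) ℂ[X]))
  have hb : π (turnSL ℂ[X]) * π (turnSL ℂ[X]) = 1 := by
    rw [← map_mul]
    refine (QuotientGroup.eq_one_iff _).mpr (Matrix.SpecialLinearGroup.mem_center_iff.mpr
      ⟨-1, by simp, ?_⟩)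
    refine Matrix.ext fun i j => ?_
    rw [SL2_mul_coe]
    fin_cases i <;> fin_cases j <;> simp [turnSL, turnMat]
  -- The reduction takes place over `ℂ[X]` modulo the centre, where `J` is an involution, so the
  -- resulting word is reduced generically and not merely at `z`.
  have hx : π (g ^ q) ∈ Subgroup.closure {π (polyUpper h), π (turnSL ℂ[X])} := by
    have h1 := Subgroup.mem_map_of_mem π (pow_mem hg q)
    rwa [polyGroup, MonoidHom.map_closure, Set.image_pair] at h1
  rcases exists_reduced_form hb hx with ⟨r, hr⟩ | ⟨r, r', rs, hrs, hr⟩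
  · rw [← map_zpow] at hr
    exact absurd (QuotientGroup.eq.mp hr.symm)
      (zpow_inv_mul_pow_not_mem_center h hgt (by omega) r)
  · refine ⟨rs, fun i hi hcen => hrs i hi ?_, ?_⟩
    · rw [← map_zpow]
      exact (QuotientGroup.eq_one_iff _).mpr hcen
    · rw [← map_altProd, ← map_zpow, ← map_zpow, ← map_mul, ← map_mul] at hr
      have h1 := evalSL_mem_center z (QuotientGroup.eq.mp hr.symm)
      rw [map_mul, map_inv, map_mul, map_mul, map_zpow, map_zpow, evalSL_polyUpper] at h1
      have h2 := gammaSL_congr (A := upperSL h z) (A' := upperSL h z)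
        (by rw [inv_mul_cancel]; exact one_mem _) h1
      rw [gammaSL_zpow_mul_mul_zpow] at h2
      rw [eval_gammaPoly h, h2, map_pow, ← gammaSL_one_right (upperSL h z)]
      refine (gammaSL_congr (by rw [inv_mul_cancel]; exact one_mem _) ?_).symm
      rw [inv_one, one_mul]
      exact pow_mem_center_of_trace_eq_cos hp hpq ((trace_evalSL z g).trans hz)

/-- A nonconstant trace omits all `2 cos(πp/q)` on the disc, hence all of `[-2, 2]`, and
Schwarz–Pick applies; a constant trace has zero derivative. -/
theorem hasTraceBound_of_forall_eval_ne_zero {l m : ℂ} {h : l * m = 1} {c : ℂ} {ρ : ℝ}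
    (hρ : 0 < ρ) (hno : ∀ rs, IsReduced h rs → ∀ z ∈ Metric.ball c ρ,
      (gammaPoly l m (altProd (polyUpper h) (turnSL ℂ[X]) 1 rs)).eval z ≠ 0) :
    HasTraceBound h c (1 / ρ) := by
  intro g hg
  have h1 : (derivMat c g).trace = (derivative g.1.trace).eval c := by
    rw [Matrix.trace_fin_two, Matrix.trace_fin_two, derivative_add, eval_add]
    rfl
  have h2 : (valMat c g).trace = g.1.trace.eval c := trace_evalSL c g
  rw [h1, h2]
  by_cases hP : ∀ w, g.1.trace ≠ C w
  · have h3 := norm_deriv_le_of_omits_segment (T := fun z => g.1.trace.eval z) hρ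
      g.1.trace.differentiable.differentiableOn (omits_segment_of_omits_cos hP
        fun z hz p q hp hpq h0 => by
          obtain ⟨rs, hrs, h4⟩ := exists_eval_gammaPoly_eq_zero h hg hP hp hpq h0
          exact hno rs hrs z hz h4)
    rw [Polynomial.deriv] at h3
    rw [one_div_mul_eq_div]
    exact h3
  · push Not at hP
    obtain ⟨w, hw⟩ := hP
    rw [hw, derivative_C, eval_zero, norm_zero]
    positivity

end TraceRoots

/-! ### Normal form of a pair, and freeness. -/

namespace TraceRoots

open Filter Topology Polynomial

attribute [local instance] Matrix.linftyOpNormedRing Matrix.linftyOpNormedAlgebra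

theorem trace_eq_two_of_mulVec_eq {N : Matrix.SpecialLinearGroup (Fin 2) ℂ} {v : Fin 2 → ℂ}
    (hv : v ≠ 0) (h : N.1.mulVec v = v) : N.1.trace = 2 := by
  have h1 : (N.1 - 1).det = 0 := Matrix.exists_mulVec_eq_zero_iff.mp
    ⟨v, hv, by rw [Matrix.sub_mulVec, h, Matrix.one_mulVec, sub_self]⟩
  have h2 := N.2
  rw [Matrix.det_fin_two] at h1 h2
  simp at h1
  rw [Matrix.trace_fin_two]
  linear_combination -h1 + h2

/-- Matrices with a common eigenvector have `γ = 0`. -/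
theorem gammaSL_eq_zero_of_eigenvector {A B : Matrix.SpecialLinearGroup (Fin 2) ℂ} {v : Fin 2 → ℂ}
    {l k : ℂ} (hv : v ≠ 0) (hl : l ≠ 0) (hk : k ≠ 0) (hA : A.1.mulVec v = l • v)
    (hB : B.1.mulVec v = k • v) : gammaSL A B = 0 := by
  have h1 : (A * B).1.mulVec v = (k * l) • v := by
    rw [SL2_mul_coe, ← Matrix.mulVec_mulVec, hB, Matrix.mulVec_smul, hA, smul_smul]
  have h2 : (B * A).1.mulVec v = (k * l) • v := by
    rw [SL2_mul_coe, ← Matrix.mulVec_mulVec, hA, Matrix.mulVec_smul, hB, smul_smul, mul_comm]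
  have h3 : (A * B * A⁻¹ * B⁻¹ * (B * A)).1 = (A * B).1 := SL2_coe_congr (by group)
  have h4 : (A * B * A⁻¹ * B⁻¹).1.mulVec ((k * l) • v) = (k * l) • v := by
    rw [← h2, Matrix.mulVec_mulVec, ← SL2_mul_coe, h3, h1, h2]
  rw [Matrix.mulVec_smul] at h4
  rw [gammaSL, trace_eq_two_of_mulVec_eq hv (smul_right_injective _ (mul_ne_zero hk hl) h4),
    sub_self]

theorem mul_self_eq_neg_one_of_trace_eq_zero {B : Matrix.SpecialLinearGroup (Fin 2) ℂ}
    (hB : B.1.trace = 0) : B.1 * B.1 = -1 := by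
  rw [sq_eq_of_det_one B.1 B.2, hB, zero_smul, zero_sub]

/-- A pair of matrices, the second of trace zero, without common eigenvector is conjugate to a
member of the one parameter family of standard pairs. -/
theorem exists_conj_standard_pair {A B : Matrix.SpecialLinearGroup (Fin 2) ℂ} {l m : ℂ}
    (h : l * m = 1) (hA : A.1.trace = l + m) (hB : B.1.trace = 0) (hγ : gammaSL A B ≠ 0) :
    ∃ (c : ℂ) (S : Matrix.SpecialLinearGroup (Fin 2) ℂ),
      A = S * upperSL h c * S⁻¹ ∧ B = S * turnSL ℂ * S⁻¹ := by
  have hl : l ≠ 0 := left_ne_zero_of_mul_eq_one h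
  obtain ⟨v, hv, hv'⟩ : ∃ v ≠ 0, (A.1 - l • 1).mulVec v = 0 := by
    refine Matrix.exists_mulVec_eq_zero_iff.mpr ?_
    have h2 := A.2
    rw [Matrix.trace_fin_two] at hA
    rw [Matrix.det_fin_two] at h2 ⊢
    simp
    linear_combination h2 - l * hA - h
  have hAv : A.1.mulVec v = l • v := by
    rw [Matrix.sub_mulVec, Matrix.smul_mulVec, Matrix.one_mulVec] at hv'
    exact sub_eq_zero.mp hv'
  -- In the basis `v`, `w = B v` the matrix `B` becomes `J`, because `B² = -1`, and `A` becomes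
  -- upper triangular. Dependence of `v` and `w` would give a common eigenvector and `γ = 0`.
  set w := B.1.mulVec v with hw
  have hBw : B.1.mulVec w = -v := by
    rw [hw, Matrix.mulVec_mulVec, mul_self_eq_neg_one_of_trace_eq_zero hB, Matrix.neg_mulVec,
      Matrix.one_mulVec]
  have hd : v 0 * w 1 - w 0 * v 1 ≠ 0 := by
    intro h0
    obtain ⟨k, hk⟩ : ∃ k : ℂ, w = k • v := by
      by_cases hv0 : v 0 = 0
      · have hv1 : v 1 ≠ 0 := fun hv1 => hv (by ext i; fin_cases i <;> assumption)
        refine ⟨w 1 / v 1, ?_⟩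
        ext i
        fin_cases i
        · simp [hv0, hv1] at h0 ⊢; exact h0
        · simp [hv1]
      · refine ⟨w 0 / v 0, ?_⟩
        ext i
        fin_cases i
        · simp [hv0]
        · simp; field_simp; linear_combination h0
    refine hγ (gammaSL_eq_zero_of_eigenvector hv hl (k := k) ?_ hAv (hw ▸ hk))
    rintro rfl
    rw [hk, zero_smul, Matrix.mulVec_zero] at hBw
    exact hv (neg_eq_zero.mp hBw.symm)
  -- Scaling both basis vectors by `e` gives determinant one.
  obtain ⟨e, he⟩ := IsAlgClosed.exists_pow_nat_eq (v 0 * w 1 - w 0 * v 1)⁻¹ two_pos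
  let S : Matrix.SpecialLinearGroup (Fin 2) ℂ :=
    ⟨!![e * v 0, e * w 0; e * v 1, e * w 1], by
      rw [Matrix.det_fin_two_of]
      have := mul_inv_cancel₀ hd
      rw [← he] at this
      linear_combination this⟩
  have hBS : B * S = S * turnSL ℂ := by
    refine Subtype.ext ?_
    have e0 := congrFun hw 0
    have e1 := congrFun hw 1
    have e2 := congrFun hBw 0
    have e3 := congrFun hBw 1
    simp [Matrix.mulVec, dotProduct] at e0 e1 e2 e3
    change B.1 * !![e * v 0, e * w 0; e * v 1, e * w 1] = !![e * v 0, e * w 0; e * v 1, e * w 1] * turnMat ℂ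
    ext i j
    fin_cases i <;> fin_cases j <;> simp [turnMat, Matrix.mul_apply, -mul_eq_mul_left_iff]
    · linear_combination -e * e0
    · linear_combination e * e2
    · linear_combination -e * e1
    · linear_combination e * e3
  set T := S⁻¹ * A * S with hT
  have hAS : A * S = S * T := by rw [hT]; group
  have hcol : (A * S).1 0 0 = l * (e * v 0) ∧ (A * S).1 1 0 = l * (e * v 1) := by
    have e0 := congrFun hAv 0
    have e1 := congrFun hAv 1
    simp [Matrix.mulVec, dotProduct] at e0 e1
    constructor
    · change (A.1 * !![e * v 0, e * w 0; e * v 1, e * w 1]) 0 0 = _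
      simp [Matrix.mul_apply]; linear_combination e * e0
    · change (A.1 * !![e * v 0, e * w 0; e * v 1, e * w 1]) 1 0 = _
      simp [Matrix.mul_apply]; linear_combination e * e1
  have hTeq : T = upperSL h (T.1 0 1) := by
    have h1 : T.1 = (S⁻¹).1 * (A * S).1 := by rw [← SL2_mul_coe, hT, mul_assoc]
    have h2 : (S⁻¹).1 = !![e * w 1, -(e * w 0); -(e * v 1), e * v 0] := by
      have : (S⁻¹).1 = S.1.adjugate := Matrix.SpecialLinearGroup.coe_inv _
      rw [this, Matrix.adjugate_fin_two]
      simp [S]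
    have hS := S.2
    have hTd := T.2
    have t0 : T.1 0 0 = l := by
      rw [h1, h2, Matrix.mul_apply, Fin.sum_univ_two, hcol.1, hcol.2]
      simp only [S, Matrix.det_fin_two_of] at hS
      simp
      linear_combination l * hS
    have t1 : T.1 1 0 = 0 := by
      rw [h1, h2, Matrix.mul_apply, Fin.sum_univ_two, hcol.1, hcol.2]
      simp
      ring
    rw [Matrix.det_fin_two, t0, t1] at hTd
    have t2 : T.1 1 1 = m := by
      refine mul_left_cancel₀ hl ?_
      rw [h]; linear_combination hTd
    refine Subtype.ext ?_
    change T.1 = upperMat l m (T.1 0 1)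
    ext i j
    fin_cases i <;> fin_cases j <;> simp [upperMat, t0, t1, t2]
  refine ⟨T.1 0 1, S, ?_, ?_⟩
  · rw [← hTeq, ← hAS, mul_inv_cancel_right]
  · rw [← hBS, mul_inv_cancel_right]

theorem mul_self_mem_center_of_trace_eq_zero {B : Matrix.SpecialLinearGroup (Fin 2) ℂ}
    (hB : B.1.trace = 0) : B * B ∈ Subgroup.center (Matrix.SpecialLinearGroup (Fin 2) ℂ) :=
  mem_center_of_coe_eq_smul_one (k := -1)
    (by rw [SL2_mul_coe, mul_self_eq_neg_one_of_trace_eq_zero hB, neg_one_smul])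

theorem altProd_conj {G : Type*} [Group G] (a b k : G) (s : ℤ) (rs : List ℤ) :
    altProd (k * a * k⁻¹) (k * b * k⁻¹) s rs = k * altProd a b s rs * k⁻¹ :=
  (map_altProd (MulAut.conj k).toMonoidHom a b s rs).symm

theorem gamma_zpow_mul_mul_zpow (f w : Moebius) (r r' : ℤ) :
    gamma f (f ^ r * w * f ^ r') = gamma f w := by
  obtain ⟨A, rfl⟩ := QuotientGroup.mk_surjective f
  obtain ⟨W, rfl⟩ := QuotientGroup.mk_surjective w
  exact gammaSL_zpow_mul_mul_zpow A W r r'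

theorem gamma_one_right (f : Moebius) : gamma f 1 = 0 := by
  obtain ⟨A, rfl⟩ := QuotientGroup.mk_surjective f
  exact gammaSL_one_right A

/-- If the group is not the free product of `⟨f⟩` and `⟨g⟩`, where `g` is an involution, then
some reduced word has `γ = 0`. -/
theorem exists_gamma_altProd_eq_zero {f g : Moebius} (hg : g * g = 1) (hfg : ¬ IsFreeOn f g) :
    ∃ rs : List ℤ, (∀ r ∈ rs, f ^ r ≠ 1) ∧ gamma f (altProd f g 1 rs) = 0 := by
  by_contra! hcon
  refine hfg ((injective_iff_map_eq_one _).mpr fun x hx => ?_)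
  set φ := Monoid.Coprod.lift (Subgroup.zpowers f).subtype (Subgroup.zpowers g).subtype with hφ
  let f' : Subgroup.zpowers f := ⟨f, Subgroup.mem_zpowers f⟩
  let g' : Subgroup.zpowers g := ⟨g, Subgroup.mem_zpowers g⟩
  have hf' : ∀ y : Subgroup.zpowers f, ∃ r : ℤ, f' ^ r = y := by
    rintro ⟨_, r, rfl⟩; exact ⟨r, rfl⟩
  have hg' : ∀ y : Subgroup.zpowers g, ∃ r : ℤ, g' ^ r = y := by
    rintro ⟨_, r, rfl⟩; exact ⟨r, rfl⟩
  let a : Monoid.Coprod (Subgroup.zpowers f) (Subgroup.zpowers g) := Monoid.Coprod.inl f'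
  let b : Monoid.Coprod (Subgroup.zpowers f) (Subgroup.zpowers g) := Monoid.Coprod.inr g'
  have hφa : φ a = f := Monoid.Coprod.lift_apply_inl _ _ _
  have hφb : φ b = g := Monoid.Coprod.lift_apply_inr _ _ _
  have ha : ∀ r : ℤ, f ^ r = 1 → a ^ r = 1 := by
    intro r hr
    have : f' ^ r = 1 := Subtype.ext hr
    rw [← map_zpow, this, map_one]
  have hb : b * b = 1 := by
    have : g' * g' = 1 := Subtype.ext hg
    rw [← map_mul, this, map_one]
  have hmem : ∀ y, y ∈ Subgroup.closure {a, b} := by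
    intro y
    induction y using Monoid.Coprod.induction_on with
    | inl y =>
      obtain ⟨r, rfl⟩ := hf' y
      rw [map_zpow]
      exact zpow_mem (Subgroup.subset_closure (by simp [a])) r
    | inr y =>
      obtain ⟨r, rfl⟩ := hg' y
      rw [map_zpow]
      exact zpow_mem (Subgroup.subset_closure (by simp [b])) r
    | mul y z hy hz => exact mul_mem hy hz
  rcases exists_reduced_form hb (hmem x) with ⟨r, rfl⟩ | ⟨r, r', rs, hrs, rfl⟩
  · rw [map_zpow, hφa] at hx
    exact ha r hx
  · refine absurd ?_ (hcon rs fun i hi h0 => hrs i hi (ha i h0))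
    rw [map_mul, map_mul, map_altProd, map_zpow, map_zpow, hφa, hφb] at hx
    rw [← gamma_zpow_mul_mul_zpow f _ r r', hx, gamma_one_right]

end TraceRoots

/-! ### Discreteness in `PSL(2, ℂ)` and the conclusion. -/

namespace TraceRoots

open Filter Topology Polynomial

attribute [local instance] Matrix.linftyOpNormedRing Matrix.linftyOpNormedAlgebra

/-- If the identity is isolated among the values at `c` then the corresponding subgroup of
`PSL(2, ℂ)` is discrete. -/
theorem generatesDiscrete_of_isolated {l m : ℂ} (h : l * m = 1) (c : ℂ)
    (S : Matrix.SpecialLinearGroup (Fin 2) ℂ) {ε : ℝ} (hε : 0 < ε)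
    (hiso : ∀ g ∈ polyGroup h, ‖valMat c g - 1‖ < ε → valMat c g = 1) :
    GeneratesDiscrete (QuotientGroup.mk (S * upperSL h c * S⁻¹))
      (QuotientGroup.mk (S * turnSL ℂ * S⁻¹)) := by
  let π : Matrix.SpecialLinearGroup (Fin 2) ℂ →* Moebius :=
    QuotientGroup.mk' (Subgroup.center (Matrix.SpecialLinearGroup (Fin 2) ℂ))
  let φ : Matrix.SpecialLinearGroup (Fin 2) ℂ[X] →* Matrix.SpecialLinearGroup (Fin 2) ℂ :=
    (MulAut.conj S).toMonoidHom.comp (evalSL c)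
  have hφA : φ (polyUpper h) = S * upperSL h c * S⁻¹ := by
    rw [← evalSL_polyUpper]; rfl
  have hφB : φ (turnSL ℂ[X]) = S * turnSL ℂ * S⁻¹ := by
    rw [← evalSL_turnSL c]; rfl
  have hgen : Subgroup.closure ({π (S * upperSL h c * S⁻¹), π (S * turnSL ℂ * S⁻¹)} : Set Moebius) =
      (polyGroup h).map (π.comp φ) := by
    rw [polyGroup, MonoidHom.map_closure, Set.image_pair, ← hφA, ← hφB]
    rfl
  let V : Set (Matrix.SpecialLinearGroup (Fin 2) ℂ) := {X | ‖(S⁻¹ * X * S).1 - 1‖ < ε}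
  have hV : IsOpen V := by
    refine isOpen_lt ?_ continuous_const
    have h1 : Continuous fun X : Matrix.SpecialLinearGroup (Fin 2) ℂ => (S⁻¹ * X * S).1 :=
      continuous_subtype_val.comp (by fun_prop)
    exact (h1.sub continuous_const).norm
  have hV' : IsOpen (π '' V) := QuotientGroup.isOpenMap_coe V hV
  -- Since `J² = -1`, the matrix group contains the centre, so either lift of a Möbius
  -- transformation in the group comes from `polyGroup h`.
  have hneg : ∀ w ∈ polyGroup h, ∀ ζ ∈ Subgroup.center (Matrix.SpecialLinearGroup (Fin 2) ℂ),
      ∃ w' ∈ polyGroup h, φ w' = φ w * ζ := by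
    intro w hw ζ hζ
    obtain ⟨k, hk, hA⟩ := Matrix.SpecialLinearGroup.mem_center_iff.mp hζ
    have hk2 : k * k = 1 := by simpa [sq] using hk
    rcases mul_self_eq_one_iff.mp hk2 with rfl | rfl
    · have hζ1 : ζ = 1 := Subtype.ext (by rw [← hA, map_one]; rfl)
      exact ⟨w, hw, by rw [hζ1, mul_one]⟩
    · have hJ : turnSL ℂ * turnSL ℂ = ζ := by
        refine Subtype.ext ?_
        rw [← hA, SL2_mul_coe]
        ext i j
        fin_cases i <;> fin_cases j <;> simp [turnSL, turnMat]
      refine ⟨w * (turnSL ℂ[X] * turnSL ℂ[X]),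
        mul_mem hw (mul_mem (turnSL_mem h) (turnSL_mem h)), ?_⟩
      rw [map_mul, map_mul, hφB]
      congr 1
      rw [show S * turnSL ℂ * S⁻¹ * (S * turnSL ℂ * S⁻¹) = S * (turnSL ℂ * turnSL ℂ) * S⁻¹ by group,
        hJ, Subgroup.mem_center_iff.mp hζ S, mul_inv_cancel_right]
  refine discreteTopology_of_isOpen_singleton_one ?_
  have hpre : ({1} : Set (Subgroup.closure ({π (S * upperSL h c * S⁻¹),
      π (S * turnSL ℂ * S⁻¹)} : Set Moebius))) = Subtype.val ⁻¹' (π '' V) := by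
    ext ⟨x, hx⟩
    simp only [Set.mem_singleton_iff, Set.mem_preimage]
    constructor
    · intro hx1
      have hx1' : x = 1 := congrArg Subtype.val hx1
      refine ⟨1, ?_, ?_⟩
      · have h1 : S⁻¹ * 1 * S = 1 := by group
        change ‖(S⁻¹ * 1 * S).1 - 1‖ < ε
        rw [h1]
        simpa using hε
      · rw [map_one, hx1']
    · rintro ⟨X, hXV, hX⟩
      rw [hgen] at hx
      obtain ⟨w, hw, hwx⟩ := hx
      have h1 : (φ w)⁻¹ * X ∈ Subgroup.center (Matrix.SpecialLinearGroup (Fin 2) ℂ) :=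
        QuotientGroup.eq.mp (hwx.trans hX.symm)
      obtain ⟨w', hw', he⟩ := hneg w hw _ h1
      rw [mul_inv_cancel_left] at he
      have h2 : S⁻¹ * X * S = evalSL c w' := by
        rw [← he]
        change S⁻¹ * (S * evalSL c w' * S⁻¹) * S = _
        group
      have h3 : valMat c w' = 1 := hiso w' hw' (by
        have h3 : ‖(S⁻¹ * X * S).1 - 1‖ < ε := hXV
        rwa [h2] at h3)
      have h4 : evalSL c w' = 1 := Subtype.ext h3
      refine Subtype.ext ?_
      rw [h4] at h2
      have h5 : X = 1 := by
        have : X = S * (S⁻¹ * X * S) * S⁻¹ := by group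
        rw [this, h2]; group
      change x = 1
      rw [← hX, h5, map_one]
  exact hpre ▸ hV'.preimage continuous_subtype_val

theorem exists_root_of_eval_gammaPoly {l m : ℂ} (h : l * m = 1) {U : Set ℂ} {rs : List ℤ}
    (hrs : IsReduced h rs) {z : ℂ} (hz : (l - m) ^ 2 + z ^ 2 ∈ U)
    (h0 : (gammaPoly l m (altProd (polyUpper h) (turnSL ℂ[X]) 1 rs)).eval z = 0) :
    ∃ w : FreeGroup (Fin 2), IsGoodWord w ∧
      ∃ p : Polynomial (Polynomial ℤ), IsTracePolynomial w p ∧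
        specialize p ((l - m) ^ 2) ≠ 0 ∧
        ∃ z ∈ U, (specialize p ((l - m) ^ 2)).IsRoot z := by
  obtain ⟨p, hp⟩ := exists_tracePolynomial_altProd rs 1 (Or.inl rfl)
  exact ⟨_, ⟨1, rs, Or.inl rfl, rfl⟩, p, hp, specialize_ne_zero h hrs hp, _, hz,
    (eval_specialize_eq_gammaPoly h hp z).trans h0⟩

theorem isReduced_nil {l m : ℂ} (h : l * m = 1) : IsReduced h [] := by
  simp [IsReduced]

theorem isReduced_singleton_one {l m : ℂ} (h : l * m = 1) : IsReduced h [1] := by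
  intro r hr hcen
  obtain rfl := List.mem_singleton.mp hr
  rw [zpow_one] at hcen
  obtain ⟨k, -, hk⟩ := Matrix.SpecialLinearGroup.mem_center_iff.mp hcen
  have := congrFun (congrFun hk 0) 1
  simp [polyUpper, upperSL, upperMat] at this
  exact X_ne_zero this.symm

theorem eval_zero_gammaPoly_singleton_one {l m : ℂ} (h : l * m = 1) :
    (gammaPoly l m (altProd (polyUpper h) (turnSL ℂ[X]) 1 [1])).eval 0 = 0 := by
  have h1 : (altProd (polyUpper h) (turnSL ℂ[X]) 1 [1]).1 =
      turnMat ℂ[X] * upperMat (C l) (C m) X * turnMatInv ℂ[X] := by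
    rw [← turnSL_inv_coe]
    simp [altProd]
    rfl
  rw [gammaPoly, h1]
  simp [turnMat, upperMat, turnMatInv]

theorem eval_gammaPoly_turnSL {l m : ℂ} (h : l * m = 1) (z : ℂ) :
    (gammaPoly l m (altProd (polyUpper h) (turnSL ℂ[X]) 1 [])).eval z = (l - m) ^ 2 + z ^ 2 := by
  rw [altProd, zpow_one, eval_gammaPoly h, evalSL_turnSL, gammaSL_upperSL_turnSL]

theorem exists_isReduced_eval_eq_zero {l m : ℂ} (h : l * m = 1) (ht : l + m ≠ 0)
    {A B : Matrix.SpecialLinearGroup (Fin 2) ℂ} (hA : A.1.trace = l + m) (hB : B.1.trace = 0)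
    (hAB : ¬ (GeneratesDiscrete (QuotientGroup.mk A) (QuotientGroup.mk B) ∧
      IsFreeOn (QuotientGroup.mk A) (QuotientGroup.mk B)))
    {U : Set ℂ} (hU : IsOpen U) (hγ : gammaSL A B ∈ U) :
    ∃ rs, IsReduced h rs ∧ ∃ z, (l - m) ^ 2 + z ^ 2 ∈ U ∧
      (gammaPoly l m (altProd (polyUpper h) (turnSL ℂ[X]) 1 rs)).eval z = 0 := by
  by_cases hγ0 : gammaSL A B = 0
  · obtain ⟨z, hz⟩ := IsAlgClosed.exists_pow_nat_eq (-(l - m) ^ 2) two_pos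
    -- The word `b` has trace polynomial `z`, with root `0`.
    refine ⟨[], isReduced_nil h, z, ?_, ?_⟩
    · rwa [hz, add_neg_cancel, ← hγ0]
    · rw [eval_gammaPoly_turnSL h, hz, add_neg_cancel]
  obtain ⟨c, S, rfl, rfl⟩ := exists_conj_standard_pair h hA hB hγ0
  rw [gammaSL_conj, gammaSL_upperSL_turnSL] at hγ hγ0
  by_cases hc : c = 0
  · subst hc
    -- Here `γ = β`. At `c = 0` both `A` and `J A J⁻¹` are diagonal, so the word `b a b⁻¹` has `γ =
    -- 0`.
    exact ⟨[1], isReduced_singleton_one h, 0, hγ, eval_zero_gammaPoly_singleton_one h⟩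
  by_contra! hcon
  refine hAB ⟨?_, ?_⟩
  -- The neighbourhood `U` of `γ` is pulled back to a disc of parameters along `z ↦ β + z²`.
  · have hnhds : {z : ℂ | (l - m) ^ 2 + z ^ 2 ∈ U} ∈ 𝓝 c := by
      refine (hU.preimage (f := fun z : ℂ => (l - m) ^ 2 + z ^ 2) (by fun_prop)).mem_nhds hγ
    obtain ⟨ρ, hρ, hball⟩ := Metric.mem_nhds_iff.mp hnhds
    have hK : HasTraceBound h c (1 / ρ) := hasTraceBound_of_forall_eval_ne_zero hρ
      fun rs hrs z hz => hcon rs hrs z (hball hz)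
    obtain ⟨ε, hε, hiso⟩ := hK.isolated (by positivity) hc ht hγ0
    exact generatesDiscrete_of_isolated h c S hε hiso
  · by_contra hfree
    obtain ⟨rs, hrs, h0⟩ := exists_gamma_altProd_eq_zero
      ((QuotientGroup.eq_one_iff _).mpr (mul_self_mem_center_of_trace_eq_zero hB)) hfree
    refine hcon rs (fun r hr hcen => hrs r hr ?_) c hγ ?_
    · refine (QuotientGroup.eq_one_iff _).mpr ?_
      beta_reduce
      rw [conj_zpow]
      exact (inferInstance : (Subgroup.center (Matrix.SpecialLinearGroup (Fin 2) ℂ)).Normal).conj_mem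
        _ (upperSL_zpow_mem_center h c hcen) S
    · rw [mk_altProd, altProd_conj] at h0
      rw [eval_gammaPoly h, map_altProd, evalSL_polyUpper, evalSL_turnSL, ← gammaSL_conj _ _ S]
      exact h0

end TraceRoots

theorem theorem12p1 (f g : TraceRoots.Moebius)
    (hf : TraceRoots.beta f ≠ -4) (hg : TraceRoots.beta g = -4)
    (hfg : ¬ (TraceRoots.GeneratesDiscrete f g ∧ TraceRoots.IsFreeOn f g))
    (U : Set ℂ) (hU : IsOpen U) (hγ : TraceRoots.gamma f g ∈ U) :
    ∃ w : FreeGroup (Fin 2), TraceRoots.IsGoodWord w ∧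
      ∃ p : Polynomial (Polynomial ℤ), TraceRoots.IsTracePolynomial w p ∧
        TraceRoots.specialize p (TraceRoots.beta f) ≠ 0 ∧
        ∃ z ∈ U, (TraceRoots.specialize p (TraceRoots.beta f)).IsRoot z := by
  obtain ⟨A, rfl⟩ := QuotientGroup.mk_surjective f
  obtain ⟨B, rfl⟩ := QuotientGroup.mk_surjective g
  obtain ⟨l, m, h, hA⟩ := TraceRoots.exists_add_eq_mul_eq_one A.1.trace
  have hβ : TraceRoots.beta (QuotientGroup.mk A) = (l - m) ^ 2 := by
    rw [TraceRoots.beta_mk, ← hA]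
    linear_combination 4 * h
  have ht : l + m ≠ 0 := by
    intro h0
    refine hf ?_
    rw [TraceRoots.beta_mk, ← hA, h0]
    norm_num
  have hB : B.1.trace = 0 := by
    rw [TraceRoots.beta_mk] at hg
    refine pow_eq_zero_iff two_ne_zero |>.mp ?_
    linear_combination hg
  obtain ⟨rs, hrs, z, hz, h0⟩ :=
    TraceRoots.exists_isReduced_eval_eq_zero h ht hA.symm hB hfg hU hγ
  rw [hβ]
  exact TraceRoots.exists_root_of_eval_gammaPoly h hrs hz h0
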